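/- Let $n\ge 1$ be an integer and $\lambda>n$ a real number. Equip $\mathrm{Symm}(n,\mathbb{R})$, the space of real symmetric $n\times n$ matrices, with the inner product $\mathrm{tr}(AB)$ and the corresponding Lebesgue measure $dX$. Let $\Omega_n\subset\mathrm{Symm}(n,\mathbb{R})$ be the cone of positive definite matrices, $\mathscr{S}_n=\{Z\in\mathrm{Symm}(n,\mathbb{C}) : \mathrm{Im}(Z)>0\}$, and $dZ=dX\,dY$ for $Z=X+iY$. Put \[ \Gamma_{\Omega_n}(s)=(2\pi)^{\frac{n(n-1)}{4}}\prod_{j=1}^n\Gamma\Big(s-\frac{j-1}{2}\Big),\qquad C_{\lambda,n}=\frac{\Gamma_{\Omega_n}(\lambda)}{\pi^{\frac{n(n+1)}{2}}\,\Gamma_{\Omega_n}\big(\lambda-\frac{n+1}{2}\big)}, \] and let $\widehat{v}_\lambda$ be the measure on $\mathscr{S}_n$ given by \[ d\widehat{v}_\lambda(Z)=C_{\lambda,n}\det(-i(Z-\overline{Z}))^{\lambda-n-1}dZ = C_{\lambda,n}\det(2Y)^{\lambda-n-1}\,dX\,dY . \] Let $\mathcal{A}^2_\lambda(\mathscr{S}_n)$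 be the weighted Bergman space of holomorphic functions in $L^2(\mathscr{S}_n,\widehat{v}_\lambda)$. Identify $L^2(\mathscr{S}_n,\widehat{v}_\lambda)$ with $L^2(\mathrm{Symm}(n,\mathbb{R}),dX)\otimes L^2(\Omega_n,C_{\lambda,n}\det(2Y)^{\lambda-n-1}dY)$ through $Z=X+iY$, and let $U=\mathcal{F}\otimes I$ be the unitary operator on it for which $\mathcal{F}$ is the unitary Fourier transform on $L^2(\mathrm{Symm}(n,\mathbb{R}))$, given on $L^1\cap L^2$ by \[ (\mathcal{F}f)(X)=(2\pi)^{-\frac{n(n+1)}{4}}\int_{\mathrm{Symm}(n,\mathbb{R})}e^{-i\,\mathrm{tr}(X\xi)}f(\xi)\,d\xi . \] Let $L^2(\Omega_n)$ be taken with respect to $dX$. Then the formula \[ (S_\lambda f)(X,Y)=\frac{(2\pi)^{\frac{n(n+1)}{4}}}{\Gamma_{\Omega_n}(\lambda)^{1/2}}\,\chi_{\Omega_n}(X)f(X)\det(X)^{\frac{\lambda}{2}-\frac{n+1}{4}}e^{-\mathrm{tr}(XY)} \] defines a bounded operator $S_\lambda:L^2(\Omega_n)\to L^2(\mathrm{Symm}(n,\mathbb{R}))\otimes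 L^2(\Omega_n,C_{\lambda,n}\det(2Y)^{\lambda-n-1}dY)$, and the operator $R_\lambda=S_\lambda^*U:L^2(\mathscr{S}_n,\widehat{v}_\lambda)\to L^2(\Omega_n)$ is a partial isometry with initial space $\mathcal{A}^2_\lambda(\mathscr{S}_n)$ and final space $L^2(\Omega_n)$. In particular, its adjoint $R_\lambda^*:L^2(\Omega_n)\to L^2(\mathscr{S}_n,\widehat{v}_\lambda)$ is an isometry onto $\mathcal{A}^2_\lambda(\mathscr{S}_n)$. Furthermore, for every $f\in L^2(\Omega_n)$ and every $Z\in\mathscr{S}_n$ one has \[ (R_\lambda^*f)(Z)=\frac{1}{\Gamma_{\Omega_n}(\lambda)^{1/2}}\int_{\Omega_n}f(\xi)\det(\xi)^{\frac{\lambda}{2}-\frac{n+1}{4}}e^{i\,\mathrm{tr}(\xi Z)}\,d\xi , \] where the integral converges absolutely and $R_\lambda^*f$ denotes the holomorphic representative of its class. -/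

import Mathlib

open MeasureTheory
open scoped TensorProduct ENNReal

noncomputable section

section TensorL2

theorem ae_prod_fst {α β : Type*} [MeasurableSpace α] [MeasurableSpace β]
    (μ : Measure α) (ν : Measure β) {p : α → Prop} (h : ∀ᵐ x ∂μ, p x) : ∀ᵐ z ∂(μ.prod ν), p z.1 :=
  Measure.quasiMeasurePreserving_fst.ae h

theorem ae_prod_snd {α β : Type*} [MeasurableSpace α] [MeasurableSpace β]
    (μ : Measure α) (ν : Measure β) {p : β → Prop} (h : ∀ᵐ x ∂ν, p x) : ∀ᵐ z ∂(μ.prod ν), p z.2 :=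
  Measure.quasiMeasurePreserving_snd.ae h

variable {α β : Type*} [MeasurableSpace α] [MeasurableSpace β]
  (μ : Measure α) (ν : Measure β) [SigmaFinite μ] [SigmaFinite ν]

theorem memLp_prod_mul {μ : Measure α} {ν : Measure β} [SigmaFinite μ] [SigmaFinite ν]
    {f : α → ℂ} {g : β → ℂ} (hf : MemLp f 2 μ) (hg : MemLp g 2 ν) :
    MemLp (fun z : α × β => f z.1 * g z.2) 2 (μ.prod ν) := by
  have hm : AEStronglyMeasurable (fun z : α × β => f z.1 * g z.2) (μ.prod ν) :=
    hf.1.comp_fst.mul hg.1.comp_snd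
  rw [memLp_two_iff_integrable_sq_norm hm]
  have := ((memLp_two_iff_integrable_sq_norm hf.1).1 hf).mul_prod
    ((memLp_two_iff_integrable_sq_norm hg.1).1 hg)
  refine this.congr (Filter.Eventually.of_forall fun z => ?_)
  simp [mul_pow]

/-- The elementary tensor `f ⊗ g`, realized as the function `(x, y) ↦ f x * g y`. -/
def L2.prodMul (f : Lp ℂ 2 μ) (g : Lp ℂ 2 ν) : Lp ℂ 2 (μ.prod ν) :=
  (memLp_prod_mul (Lp.memLp f) (Lp.memLp g)).toLp (fun z : α × β => f z.1 * g z.2)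

theorem L2.prodMul_coe (f : Lp ℂ 2 μ) (g : Lp ℂ 2 ν) :
    L2.prodMul μ ν f g =ᵐ[μ.prod ν] fun z : α × β => f z.1 * g z.2 :=
  MemLp.coeFn_toLp _

theorem L2.inner_prodMul (f f' : Lp ℂ 2 μ) (g g' : Lp ℂ 2 ν) :
    inner ℂ (L2.prodMul μ ν f g) (L2.prodMul μ ν f' g') = inner ℂ f f' * inner ℂ g g' := by
  rw [L2.inner_def, L2.inner_def, L2.inner_def, ← integral_prod_mul]
  refine integral_congr_ae ?_
  filter_upwards [L2.prodMul_coe μ ν f g, L2.prodMul_coe μ ν f' g'] with z h1 h2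
  rw [h1, h2]
  simp
  ring

/-- The bilinear map `(f, g) ↦ f ⊗ g`. -/
def L2.prodMulₗ : Lp ℂ 2 μ →ₗ[ℂ] Lp ℂ 2 ν →ₗ[ℂ] Lp ℂ 2 (μ.prod ν) :=
  LinearMap.mk₂ ℂ (L2.prodMul μ ν)
    (fun f f' g => by
      apply Lp.ext
      filter_upwards [L2.prodMul_coe μ ν (f + f') g, L2.prodMul_coe μ ν f g,
        L2.prodMul_coe μ ν f' g, Lp.coeFn_add (L2.prodMul μ ν f g) (L2.prodMul μ ν f' g),
        ae_prod_fst μ ν (Lp.coeFn_add f f')] with z h1 h2 h3 h4 h5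
      rw [h1, h4, h5, Pi.add_apply, Pi.add_apply, h2, h3, add_mul])
    (fun c f g => by
      apply Lp.ext
      filter_upwards [L2.prodMul_coe μ ν (c • f) g, L2.prodMul_coe μ ν f g,
        Lp.coeFn_smul c (L2.prodMul μ ν f g), ae_prod_fst μ ν (Lp.coeFn_smul c f)] with z h1 h2 h3 h4
      rw [h1, h3, h4, Pi.smul_apply, Pi.smul_apply, h2, smul_eq_mul, smul_eq_mul, mul_assoc])
    (fun f g g' => by
      apply Lp.ext
      filter_upwards [L2.prodMul_coe μ ν f (g + g'), L2.prodMul_coe μ ν f g,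
        L2.prodMul_coe μ ν f g', Lp.coeFn_add (L2.prodMul μ ν f g) (L2.prodMul μ ν f g'),
        ae_prod_snd μ ν (Lp.coeFn_add g g')] with z h1 h2 h3 h4 h5
      rw [h1, h4, h5, Pi.add_apply, Pi.add_apply, h2, h3, mul_add])
    (fun c f g => by
      apply Lp.ext
      filter_upwards [L2.prodMul_coe μ ν f (c • g), L2.prodMul_coe μ ν f g,
        Lp.coeFn_smul c (L2.prodMul μ ν f g), ae_prod_snd μ ν (Lp.coeFn_smul c g)] with z h1 h2 h3 h4
      rw [h1, h3, h4, Pi.smul_apply, Pi.smul_apply, h2, smul_eq_mul, smul_eq_mul, mul_left_comm])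

/-- The canonical isometric embedding `L²(μ) ⊗ L²(ν) → L²(μ × ν)` of the algebraic tensor product,
`f ⊗ g ↦ ((x, y) ↦ f x * g y)`. -/
def L2.tensorEmbedding : Lp ℂ 2 μ ⊗[ℂ] Lp ℂ 2 ν →ₗᵢ[ℂ] Lp ℂ 2 (μ.prod ν) :=
  (TensorProduct.lift (L2.prodMulₗ μ ν)).isometryOfInner (fun x y => by
    induction x using TensorProduct.induction_on with
    | zero => simp
    | add a b ha hb => rw [map_add, inner_add_left, inner_add_left, ha, hb]
    | tmul f g =>
      induction y using TensorProduct.induction_on with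
      | zero => simp
      | add a b ha hb => rw [map_add, inner_add_right, inner_add_right, ha, hb]
      | tmul f' g' =>
        rw [TensorProduct.lift.tmul, TensorProduct.lift.tmul, TensorProduct.inner_tmul]
        exact L2.inner_prodMul μ ν f f' g g')

theorem L2.tensorEmbedding_tmul (f : Lp ℂ 2 μ) (g : Lp ℂ 2 ν) :
    L2.tensorEmbedding μ ν (f ⊗ₜ g) = L2.prodMul μ ν f g := rfl

theorem L2.setIntegral_eq_zero {h : Lp ℂ 2 (μ.prod ν)}
    (hh : ∀ f g, inner ℂ (L2.prodMul μ ν f g) h = 0)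
    {A : Set α} {B : Set β} (hA : MeasurableSet A) (hB : MeasurableSet B)
    (hμA : μ A ≠ ∞) (hνB : ν B ≠ ∞) : ∫ z in A ×ˢ B, h z ∂(μ.prod ν) = 0 := by
  have hAB : (μ.prod ν) (A ×ˢ B) ≠ ∞ := by
    rw [Measure.prod_prod]; exact ENNReal.mul_ne_top hμA hνB
  have key : L2.prodMul μ ν (indicatorConstLp 2 hA hμA 1) (indicatorConstLp 2 hB hνB 1)
      = indicatorConstLp 2 (hA.prod hB) hAB (1 : ℂ) := by
    apply Lp.ext
    filter_upwards [L2.prodMul_coe μ ν (indicatorConstLp 2 hA hμA 1) (indicatorConstLp 2 hB hνB 1),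
      indicatorConstLp_coeFn (p := 2) (hs := hA.prod hB) (hμs := hAB) (c := (1 : ℂ)),
      ae_prod_fst μ ν (indicatorConstLp_coeFn (p := 2) (hs := hA) (hμs := hμA) (c := (1 : ℂ))),
      ae_prod_snd μ ν (indicatorConstLp_coeFn (p := 2) (hs := hB) (hμs := hνB) (c := (1 : ℂ)))]
      with z h1 h2 h3 h4
    rw [h1, h2, h3, h4]
    by_cases ha : z.1 ∈ A <;> by_cases hb : z.2 ∈ B <;> simp [Set.indicator, ha, hb]
  have := hh (indicatorConstLp 2 hA hμA 1) (indicatorConstLp 2 hB hνB 1)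
  rw [key, L2.inner_indicatorConstLp_one] at this
  exact this

theorem L2.eq_zero_of_inner_prodMul {h : Lp ℂ 2 (μ.prod ν)}
    (hh : ∀ f g, inner ℂ (L2.prodMul μ ν f g) h = 0) : h = 0 := by
  have hloc : ∀ i : ℕ, ∀ᵐ z ∂((μ.prod ν).restrict (spanningSets μ i ×ˢ spanningSets ν i)),
      h z = 0 := by
    intro i
    set A := spanningSets μ i
    set B := spanningSets ν i
    have hA : MeasurableSet A := measurableSet_spanningSets μ i
    have hB : MeasurableSet B := measurableSet_spanningSets ν i
    have hμA : μ A < ∞ := measure_spanningSets_lt_top μ i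
    have hνB : ν B < ∞ := measure_spanningSets_lt_top ν i
    have hAB : (μ.prod ν) (A ×ˢ B) < ∞ := by
      rw [Measure.prod_prod]; exact ENNReal.mul_lt_top hμA hνB
    have : IsFiniteMeasure ((μ.prod ν).restrict (A ×ˢ B)) := ⟨by simpa using hAB⟩
    have hint : Integrable h ((μ.prod ν).restrict (A ×ˢ B)) :=
      ((Lp.memLp h).restrict _).integrable (by norm_num)
    refine hint.ae_eq_zero_of_forall_setIntegral_eq_zero (fun s hs _ => ?_)
    induction s, hs using MeasurableSpace.induction_on_inter generateFrom_prod.symm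
      isPiSystem_prod with
    | empty => simp
    | basic t ht =>
      obtain ⟨a, ha, b, hb, rfl⟩ := ht
      have ha' : MeasurableSet a := ha
      have hb' : MeasurableSet b := hb
      rw [Measure.restrict_restrict (ha'.prod hb'), Set.prod_inter_prod]
      exact L2.setIntegral_eq_zero μ ν hh (ha'.inter hA) (hb'.inter hB)
        (measure_ne_top_of_subset Set.inter_subset_right hμA.ne)
        (measure_ne_top_of_subset Set.inter_subset_right hνB.ne)
    | compl t ht ih =>
      have h1 := integral_add_compl ht hint
      rw [ih (measure_lt_top _ _), zero_add] at h1
      rw [h1]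
      exact L2.setIntegral_eq_zero μ ν hh hA hB hμA.ne hνB.ne
    | iUnion f hd hf ih =>
      rw [integral_iUnion hf hd hint.integrableOn]
      simp [ih _ (measure_lt_top _ _)]
  apply Lp.ext
  have hu : (⋃ i, spanningSets μ i ×ˢ spanningSets ν i) = Set.univ := by
    rw [Set.iUnion_prod_of_monotone (monotone_spanningSets μ) (monotone_spanningSets ν),
      iUnion_spanningSets, iUnion_spanningSets, Set.univ_prod_univ]
  have h0 : ∀ᵐ z ∂((μ.prod ν).restrict (⋃ i, spanningSets μ i ×ˢ spanningSets ν i)), h z = 0 :=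
    (ae_restrict_iUnion_iff _ _).2 hloc
  rw [hu, Measure.restrict_univ] at h0
  filter_upwards [h0, Lp.coeFn_zero ℂ 2 (μ.prod ν)] with z h1 h2
  rw [h1, h2]; rfl

theorem L2.denseRange_tensorEmbedding : DenseRange (L2.tensorEmbedding μ ν).toLinearMap := by
  have : (LinearMap.range (L2.tensorEmbedding μ ν).toLinearMap)ᗮ = ⊥ := by
    rw [Submodule.eq_bot_iff]
    intro h hh
    refine L2.eq_zero_of_inner_prodMul μ ν (fun f g => ?_)
    exact (Submodule.mem_orthogonal _ _).1 hh _ ⟨f ⊗ₜ g, rfl⟩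
  have h2 := (Submodule.topologicalClosure_eq_top_iff).2 this
  rw [← Submodule.dense_iff_topologicalClosure_eq_top] at h2
  exact h2

/-- For a unitary operator `T` on `L²(μ)`, the unitary operator `T ⊗ I` on
`L²(μ × ν) = L²(μ) ⊗ L²(ν)`: the continuous extension of `f ⊗ g ↦ T f ⊗ g`. -/
def L2.tensorId (T : Lp ℂ 2 μ ≃ₗᵢ[ℂ] Lp ℂ 2 μ) : Lp ℂ 2 (μ.prod ν) ≃ₗᵢ[ℂ] Lp ℂ 2 (μ.prod ν) :=
  (T.rTensor (Lp ℂ 2 ν)).toLinearEquiv.extendOfIsometry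
    (L2.tensorEmbedding μ ν).toLinearMap (L2.tensorEmbedding μ ν).toLinearMap
    (L2.denseRange_tensorEmbedding μ ν) (L2.denseRange_tensorEmbedding μ ν)
    (fun x => ((L2.tensorEmbedding μ ν).norm_map _).trans
      (((T.rTensor (Lp ℂ 2 ν)).norm_map x).trans ((L2.tensorEmbedding μ ν).norm_map x).symm))

end TensorL2

section SymmetricMatrices

/-- The subspace of symmetric matrices. -/
def symmSubmodule (n : ℕ) (𝕜 : Type) [RCLike 𝕜] : Submodule 𝕜 (Matrix (Fin n) (Fin n) 𝕜) where
  carrier := {A | A.IsSymm}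
  add_mem' := fun ha hb => ha.add hb
  zero_mem' := Matrix.isSymm_zero
  smul_mem' := fun c _ ha => ha.smul c

/-- The space `Symm(n, 𝕜)` of symmetric `n × n` matrices, with its trace inner product. -/
def SymmMat (n : ℕ) (𝕜 : Type) [RCLike 𝕜] : Type := symmSubmodule n 𝕜

namespace SymmMat

variable {n : ℕ} {𝕜 : Type} [RCLike 𝕜]

instance : AddCommGroup (SymmMat n 𝕜) := inferInstanceAs (AddCommGroup (symmSubmodule n 𝕜))

instance : Module 𝕜 (SymmMat n 𝕜) := inferInstanceAs (Module 𝕜 (symmSubmodule n 𝕜))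

/-- The underlying matrix. -/
def mat : SymmMat n 𝕜 →ₗ[𝕜] Matrix (Fin n) (Fin n) 𝕜 := (symmSubmodule n 𝕜).subtype

theorem mat_injective : Function.Injective (mat : SymmMat n 𝕜 → Matrix (Fin n) (Fin n) 𝕜) :=
  Subtype.val_injective

theorem isSymm_mat (A : SymmMat n 𝕜) : (mat A).IsSymm := A.2

instance : FiniteDimensional 𝕜 (SymmMat n 𝕜) :=
  inferInstanceAs (FiniteDimensional 𝕜 (symmSubmodule n 𝕜))

open scoped ComplexOrder in
/-- The trace inner product `⟨A, B⟩ = tr(A* B)`; on real symmetric matrices this is `tr(A B)`. -/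
abbrev innerCore : InnerProductSpace.Core 𝕜 (SymmMat n 𝕜) where
  inner A B := ((mat A).conjTranspose * mat B).trace
  conj_inner_symm A B := by
    rw [starRingEnd_apply, ← Matrix.trace_conjTranspose, Matrix.conjTranspose_mul,
      Matrix.conjTranspose_conjTranspose]
  re_inner_nonneg A := by
    have h := (Matrix.posSemidef_conjTranspose_mul_self (mat A)).trace_nonneg
    exact (RCLike.nonneg_iff.1 h).1
  add_left A B C := by simp [Matrix.add_mul]
  smul_left A B c := by simp
  definite A h := by
    have : mat A = 0 := Matrix.trace_conjTranspose_mul_self_eq_zero_iff.1 h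
    exact mat_injective (by rw [this, map_zero])

instance : NormedAddCommGroup (SymmMat n 𝕜) := innerCore.toNormedAddCommGroup

instance : InnerProductSpace 𝕜 (SymmMat n 𝕜) := InnerProductSpace.ofCore innerCore.toCore

instance : MeasurableSpace (SymmMat n 𝕜) := borel _

instance : BorelSpace (SymmMat n 𝕜) := ⟨rfl⟩

theorem continuous_mat : Continuous (mat : SymmMat n 𝕜 → Matrix (Fin n) (Fin n) 𝕜) :=
  LinearMap.continuous_of_finiteDimensional _

theorem inner_real (A B : SymmMat n ℝ) : inner ℝ A B = (mat A * mat B).trace := by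
  change ((mat A).conjTranspose * mat B).trace = _
  rw [Matrix.conjTranspose_eq_transpose_of_trivial, A.isSymm_mat]

/-- Entrywise real part of a complex symmetric matrix. -/
def re (Z : SymmMat n ℂ) : SymmMat n ℝ := ⟨(mat Z).map Complex.re, (isSymm_mat Z).map _⟩

/-- Entrywise imaginary part of a complex symmetric matrix. -/
def im (Z : SymmMat n ℂ) : SymmMat n ℝ := ⟨(mat Z).map Complex.im, (isSymm_mat Z).map _⟩

/-- A real symmetric matrix, seen as a complex one. -/
def ofReal (X : SymmMat n ℝ) : SymmMat n ℂ :=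
  ⟨(mat X).map Complex.ofReal, (isSymm_mat X).map _⟩

theorem mat_ofReal (X : SymmMat n ℝ) : mat (ofReal X) = (mat X).map Complex.ofReal := rfl

/-- The identification `Symm(n, ℝ) × Symm(n, ℝ) ≃ Symm(n, ℂ)`, `(X, Y) ↦ X + i Y`. -/
def complexEquiv (n : ℕ) : (SymmMat n ℝ × SymmMat n ℝ) ≃ₗ[ℝ] SymmMat n ℂ where
  toFun p := ofReal p.1 + Complex.I • ofReal p.2
  map_add' p q := mat_injective <| by
    ext i j
    simp [mat_ofReal]
    ring
  map_smul' c p := mat_injective <| by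
    have hc : ∀ W : SymmMat n ℂ, c • W = (c : ℂ) • W := fun _ => rfl
    rw [RingHom.id_apply, hc]
    ext i j
    simp [mat_ofReal]
    ring
  invFun Z := (re Z, im Z)
  left_inv p := Prod.ext
    (mat_injective <| by ext i j; change ((mat (ofReal p.1 + Complex.I • ofReal p.2)) i j).re = _
                         simp [mat_ofReal])
    (mat_injective <| by ext i j; change ((mat (ofReal p.1 + Complex.I • ofReal p.2)) i j).im = _
                         simp [mat_ofReal])
  right_inv Z := mat_injective <| by
    ext i j
    simp only [map_add, map_smul, mat_ofReal]
    change (((mat Z i j).re : ℂ)) + Complex.I * ((mat Z i j).im : ℂ) = _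
    rw [mul_comm, Complex.re_add_im]

theorem complexEquiv_apply (p : SymmMat n ℝ × SymmMat n ℝ) :
    complexEquiv n p = ofReal p.1 + Complex.I • ofReal p.2 := rfl

theorem im_complexEquiv (p : SymmMat n ℝ × SymmMat n ℝ) : im (complexEquiv n p) = p.2 :=
  congrArg Prod.snd ((complexEquiv n).left_inv p)

instance : FiniteDimensional ℝ (SymmMat n ℂ) := FiniteDimensional.complexToReal _

/-- The map `(X, Y) ↦ X + i Y` as a measurable equivalence. -/
def complexMeasurableEquiv (n : ℕ) : (SymmMat n ℝ × SymmMat n ℝ) ≃ᵐ SymmMat n ℂ :=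
  (complexEquiv n).toContinuousLinearEquiv.toHomeomorph.toMeasurableEquiv

theorem complexMeasurableEquiv_apply (p : SymmMat n ℝ × SymmMat n ℝ) :
    complexMeasurableEquiv n p = complexEquiv n p := rfl

end SymmMat

open SymmMat

/-- The cone `Ω_n = Pos(n, ℝ)` of positive definite real symmetric matrices. -/
def posCone (n : ℕ) : Set (SymmMat n ℝ) := {Y | (mat Y).PosDef}

/-- The generalized Siegel domain `{Z ∈ Symm(n, ℂ) | Im Z > 0}`. -/
def siegelDomain (n : ℕ) : Set (SymmMat n ℂ) := {Z | (mat (im Z)).PosDef}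

/-- Lebesgue measure `dZ = dX dY` on `Symm(n, ℂ)`, where `Z = X + i Y` and `dX`, `dY` are the
Lebesgue measure of the Euclidean space `Symm(n, ℝ)` with the inner product `tr(A B)`. -/
def lebesgueC (n : ℕ) : Measure (SymmMat n ℂ) :=
  Measure.map (complexEquiv n) ((volume : Measure (SymmMat n ℝ)).prod volume)

/-- The multi-gamma function of the cone `Ω_n`. -/
def multiGamma (n : ℕ) (s : ℝ) : ℝ :=
  (2 * Real.pi) ^ ((n : ℝ) * (n - 1) / 4) *
    ∏ j ∈ Finset.Icc 1 n, Real.Gamma (s - ((j : ℝ) - 1) / 2)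

/-- The normalizing constant `C_{λ,n}` of the weighted measure. -/
def bergmanConst (n : ℕ) (lam : ℝ) : ℝ :=
  multiGamma n lam /
    (Real.pi ^ ((n : ℝ) * (n + 1) / 2) * multiGamma n (lam - ((n : ℝ) + 1) / 2))

/-- The weighted measure `C_{λ,n} det(-i(Z - Z̄))^(λ-n-1) dZ` on the Siegel domain (the determinant
is a positive real number there). -/
def siegelMeasure (n : ℕ) (lam : ℝ) : Measure (SymmMat n ℂ) :=
  ((lebesgueC n).restrict (siegelDomain n)).withDensity fun Z =>
    ENNReal.ofReal (bergmanConst n lam *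
      ((-Complex.I) • (mat Z - (mat Z).map (starRingEnd ℂ))).det.re ^ (lam - n - 1))

/-- The measure `C_{λ,n} det(2Y)^(λ-n-1) dY` on the cone `Ω_n`. -/
def coneMeasure (n : ℕ) (lam : ℝ) : Measure (SymmMat n ℝ) :=
  ((volume : Measure (SymmMat n ℝ)).restrict (posCone n)).withDensity fun Y =>
    ENNReal.ofReal (bergmanConst n lam * ((2 : ℝ) • mat Y).det ^ (lam - n - 1))

instance (n : ℕ) (lam : ℝ) : SigmaFinite (coneMeasure n lam) :=
  SigmaFinite.withDensity_ofReal _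

/-- The product measure `C_{λ,n} det(2Y)^(λ-n-1) dX dY`. -/
def tubeMeasure (n : ℕ) (lam : ℝ) : Measure (SymmMat n ℝ × SymmMat n ℝ) :=
  (volume : Measure (SymmMat n ℝ)).prod (coneMeasure n lam)

theorem siegel_det (n : ℕ) (p : SymmMat n ℝ × SymmMat n ℝ) :
    ((-Complex.I) • (mat (complexEquiv n p) -
      (mat (complexEquiv n p)).map (starRingEnd ℂ))).det.re = ((2 : ℝ) • mat p.2).det := by
  have : (-Complex.I) • (mat (complexEquiv n p) - (mat (complexEquiv n p)).map (starRingEnd ℂ))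
      = ((2 : ℝ) • mat p.2).map Complex.ofRealHom := by
    ext i j
    simp only [complexEquiv_apply, map_add, map_smul, mat_ofReal]
    simp
    linear_combination (-2 * ((mat p.2 i j : ℝ) : ℂ)) * Complex.I_mul_I
  rw [this, ← RingHom.mapMatrix_apply, ← RingHom.map_det, Complex.ofRealHom_eq_coe,
    Complex.ofReal_re]

theorem measurePreserving_complexEquiv (n : ℕ) (lam : ℝ) :
    MeasurePreserving (complexMeasurableEquiv n) (tubeMeasure n lam) (siegelMeasure n lam) := by
  refine ⟨(complexMeasurableEquiv n).measurable, ?_⟩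
  have hpre : complexMeasurableEquiv n ⁻¹' siegelDomain n = Set.univ ×ˢ posCone n := by
    ext p
    simp [siegelDomain, posCone, complexMeasurableEquiv_apply, im_complexEquiv]
  have hmeas : Measurable fun Y : SymmMat n ℝ =>
      ENNReal.ofReal (bergmanConst n lam * ((2 : ℝ) • mat Y).det ^ (lam - n - 1)) := by
    have : Continuous fun Y : SymmMat n ℝ => ((2 : ℝ) • mat Y).det :=
      Continuous.matrix_det (A := fun Y : SymmMat n ℝ => (2 : ℝ) • mat Y) (by
        have := continuous_mat (n := n) (𝕜 := ℝ)
        fun_prop)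
    have := this.measurable
    fun_prop
  have hL : lebesgueC n = Measure.map (complexMeasurableEquiv n)
      ((volume : Measure (SymmMat n ℝ)).prod volume) := rfl
  rw [tubeMeasure, coneMeasure, prod_withDensity_right hmeas, siegelMeasure, hL,
    (complexMeasurableEquiv n).measurableEmbedding.restrict_map, hpre,
    ← Measure.prod_restrict, Measure.restrict_univ]
  ext s hs
  rw [MeasurableEquiv.map_apply, withDensity_apply _ hs,
    withDensity_apply _ ((complexMeasurableEquiv n).measurable hs),
    (complexMeasurableEquiv n).measurableEmbedding.restrict_map, lintegral_map_equiv]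
  simp only [complexMeasurableEquiv_apply, siegel_det]

/-- The natural isometry `L²(𝒮_n, v̂_λ) ≃ L²(Symm(n, ℝ) × Ω_n, C_{λ,n} det(2Y)^(λ-n-1) dX dY)`,
`φ ↦ ((X, Y) ↦ φ(X + i Y))`. -/
def siegelIsometry (n : ℕ) (lam : ℝ) :
    Lp ℂ 2 (siegelMeasure n lam) ≃ₗᵢ[ℂ] Lp ℂ 2 (tubeMeasure n lam) :=
  LinearIsometryEquiv.ofSurjective
    (Lp.compMeasurePreservingₗᵢ ℂ (complexMeasurableEquiv n) (measurePreserving_complexEquiv n lam))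
    (fun g => ⟨Lp.compMeasurePreserving (complexMeasurableEquiv n).symm
        ((measurePreserving_complexEquiv n lam).symm _) g, by
      change Lp.compMeasurePreserving _ _ (Lp.compMeasurePreserving _ _ g) = g
      rw [← Lp.compMeasurePreserving_comp_apply]
      simp⟩)

end SymmetricMatrices

section Fourier

variable {V : Type*} [NormedAddCommGroup V] [InnerProductSpace ℝ V] [FiniteDimensional ℝ V]
  [MeasurableSpace V] [BorelSpace V]

variable (V) in
theorem quasiMeasurePreserving_smul {r : ℝ} (hr : r ≠ 0) :
    Measure.QuasiMeasurePreserving (fun x : V => r • x) volume volume :=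
  ⟨measurable_const_smul r, by
    rw [Measure.map_addHaar_smul _ hr]; exact Measure.smul_absolutelyContinuous⟩

theorem eLpNorm_comp_smul {f : V → ℂ} {r : ℝ} (hr : 0 < r)
    (hf : AEStronglyMeasurable f (volume : Measure V)) :
    eLpNorm (fun x => ((r ^ ((Module.finrank ℝ V : ℝ) / 2) : ℝ) : ℂ) • f (r • x)) 2
      (volume : Measure V) = eLpNorm f 2 (volume : Measure V) := by
  have hmap := Measure.map_addHaar_smul (volume : Measure V) hr.ne'
  have hf' : AEStronglyMeasurable f (Measure.map (fun x : V => r • x) volume) := by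
    rw [hmap]; exact hf.smul_measure _
  have h1 : eLpNorm (fun x => f (r • x)) 2 (volume : Measure V) =
      eLpNorm f 2 (Measure.map (fun x : V => r • x) volume) :=
    (eLpNorm_map_measure hf' (measurable_const_smul r).aemeasurable).symm
  have h2 := eLpNorm_const_smul (μ := (volume : Measure V)) (p := 2)
    ((r ^ ((Module.finrank ℝ V : ℝ) / 2) : ℝ) : ℂ) (fun x => f (r • x))
  have hd : 0 < (r ^ Module.finrank ℝ V)⁻¹ := by positivity
  have hp : 0 < r ^ ((Module.finrank ℝ V : ℝ) / 2) := by positivity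
  refine h2.trans ?_
  rw [h1, hmap, eLpNorm_smul_measure_of_ne_zero, abs_of_pos hd, smul_eq_mul, ← mul_assoc]
  · rw [← ofReal_norm, Complex.norm_real, Real.norm_of_nonneg hp.le,
      ENNReal.ofReal_rpow_of_pos hd, ← ENNReal.ofReal_mul hp.le]
    have : r ^ ((Module.finrank ℝ V : ℝ) / 2) *
        (r ^ Module.finrank ℝ V)⁻¹ ^ (1 / (2 : ℝ≥0∞)).toReal = 1 := by
      rw [← Real.rpow_natCast, ← Real.rpow_neg hr.le, ← Real.rpow_mul hr.le, ← Real.rpow_add hr]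
      convert Real.rpow_zero r
      simp
      ring
    rw [this, ENNReal.ofReal_one, one_mul]
  · simp [abs_pos, hr.ne']

theorem memLp_comp_smul {f : V → ℂ} {r : ℝ} (hr : 0 < r) (hf : MemLp f 2 (volume : Measure V)) :
    MemLp (fun x => ((r ^ ((Module.finrank ℝ V : ℝ) / 2) : ℝ) : ℂ) • f (r • x)) 2
      (volume : Measure V) :=
  ⟨by
    have h := (hf.1.comp_quasiMeasurePreserving (quasiMeasurePreserving_smul V hr.ne')).const_smul
      ((r ^ ((Module.finrank ℝ V : ℝ) / 2) : ℝ) : ℂ)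
    exact h, by rw [eLpNorm_comp_smul hr hf.1]; exact hf.2⟩

variable (V) in
/-- The dilation `g ↦ r^(d/2) g(r x)`, `d = dim V`, as an isometry of `L²(V)`. -/
def dilationIsometry (r : ℝ) (hr : 0 < r) :
    Lp ℂ 2 (volume : Measure V) →ₗᵢ[ℂ] Lp ℂ 2 (volume : Measure V) where
  toFun g := (memLp_comp_smul hr (Lp.memLp g)).toLp
    (fun x => ((r ^ ((Module.finrank ℝ V : ℝ) / 2) : ℝ) : ℂ) • g (r • x))
  map_add' f g := by
    refine (MemLp.toLp_eq_toLp_iff _ ((memLp_comp_smul hr (Lp.memLp f)).add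
      (memLp_comp_smul hr (Lp.memLp g)))).2 ?_
    filter_upwards [(quasiMeasurePreserving_smul V hr.ne').ae (Lp.coeFn_add f g)] with x hx
    simp only [hx, Pi.add_apply, smul_add]
  map_smul' c g := by
    refine (MemLp.toLp_eq_toLp_iff _ ((memLp_comp_smul hr (Lp.memLp g)).const_smul c)).2 ?_
    filter_upwards [(quasiMeasurePreserving_smul V hr.ne').ae (Lp.coeFn_smul c g)] with x hx
    simp only [hx, Pi.smul_apply, smul_comm c]
  norm_map' g := by
    change ‖(memLp_comp_smul hr (Lp.memLp g)).toLp
      (fun x => ((r ^ ((Module.finrank ℝ V : ℝ) / 2) : ℝ) : ℂ) • g (r • x))‖ = ‖g‖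
    rw [Lp.norm_toLp, eLpNorm_comp_smul hr (Lp.memLp g).1, Lp.norm_def]

theorem dilationIsometry_coe (r : ℝ) (hr : 0 < r) (g : Lp ℂ 2 (volume : Measure V)) :
    dilationIsometry V r hr g =ᵐ[volume]
      fun x => ((r ^ ((Module.finrank ℝ V : ℝ) / 2) : ℝ) : ℂ) • g (r • x) :=
  MemLp.coeFn_toLp (memLp_comp_smul hr (Lp.memLp g))

theorem dilationIsometry_inv (r : ℝ) (hr : 0 < r) (g : Lp ℂ 2 (volume : Measure V)) :
    dilationIsometry V r hr (dilationIsometry V r⁻¹ (inv_pos.2 hr) g) = g := by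
  apply Lp.ext
  filter_upwards [dilationIsometry_coe r hr (dilationIsometry V r⁻¹ (inv_pos.2 hr) g),
    (quasiMeasurePreserving_smul V hr.ne').ae (dilationIsometry_coe r⁻¹ (inv_pos.2 hr) g)]
    with x h1 h2
  have hp : r ^ ((Module.finrank ℝ V : ℝ) / 2) ≠ 0 := by positivity
  rw [h1, h2, smul_smul, smul_smul, inv_mul_cancel₀ hr.ne', one_smul, ← Complex.ofReal_mul,
    Real.inv_rpow hr.le, mul_inv_cancel₀ hp, Complex.ofReal_one, one_smul]

variable (V) in
/-- The dilation `g ↦ r^(d/2) g(r x)`, `d = dim V`, as a unitary operator on `L²(V)`. -/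
def dilation (r : ℝ) (hr : 0 < r) :
    Lp ℂ 2 (volume : Measure V) ≃ₗᵢ[ℂ] Lp ℂ 2 (volume : Measure V) :=
  LinearIsometryEquiv.ofSurjective (dilationIsometry V r hr)
    fun g => ⟨_, dilationIsometry_inv r hr g⟩

variable (V) in
/-- The unitary Fourier transform on `L²(V)` in the normalization
`(ℱ f)(x) = (2π)^(-d/2) ∫ e^(-i⟨x, ξ⟩) f(ξ) dξ`, `d = dim V`. Mathlib's transform is
`(𝓕 f)(x) = ∫ e^(-2πi⟨x, ξ⟩) f(ξ) dξ`, so that `(ℱ f)(x) = (2π)^(-d/2) (𝓕 f)(x / 2π)`. -/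
def unitaryFourier : Lp ℂ 2 (volume : Measure V) ≃ₗᵢ[ℂ] Lp ℂ 2 (volume : Measure V) :=
  (Lp.fourierTransformₗᵢ V ℂ).trans (dilation V (2 * Real.pi)⁻¹ (by positivity))

end Fourier

section Operators

open SymmMat

/-- The unitary operator `U = ℱ ⊗ I` from `L²(𝒮_n, v̂_λ)` onto
`L²(Symm(n, ℝ)) ⊗ L²(Ω_n, C_{λ,n} det(2Y)^(λ-n-1) dY)`, realized as an `L²` space of functions of
`(X, Y)`: the Fourier transform in `X = Re Z`. -/
def partialFourier (n : ℕ) (lam : ℝ) :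
    Lp ℂ 2 (siegelMeasure n lam) ≃ₗᵢ[ℂ] Lp ℂ 2 (tubeMeasure n lam) :=
  (siegelIsometry n lam).trans
    (L2.tensorId (volume : Measure (SymmMat n ℝ)) (coneMeasure n lam)
      (unitaryFourier (SymmMat n ℝ)))

/-- `L²(Ω_n)`, with respect to Lebesgue measure. -/
abbrev ConeL2 (n : ℕ) : Type := Lp ℂ 2 ((volume : Measure (SymmMat n ℝ)).restrict (posCone n))

/-- The weighted Bergman space of the Siegel domain: the classes in `L²(𝒮_n, v̂_λ)` of holomorphic
functions on `𝒮_n`. -/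
def bergmanSpace (n : ℕ) (lam : ℝ) : Submodule ℂ (Lp ℂ 2 (siegelMeasure n lam)) where
  carrier := {φ | ∃ F : SymmMat n ℂ → ℂ, DifferentiableOn ℂ F (siegelDomain n) ∧
    φ =ᵐ[siegelMeasure n lam] F}
  add_mem' := by
    rintro φ ψ ⟨F, hF, hφ⟩ ⟨G, hG, hψ⟩
    refine ⟨F + G, hF.add hG, (Lp.coeFn_add φ ψ).trans (hφ.add hψ)⟩
  zero_mem' := ⟨0, differentiableOn_const 0, Lp.coeFn_zero _ _ _⟩
  smul_mem' := by
    rintro c φ ⟨F, hF, hφ⟩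
    exact ⟨c • F, hF.const_smul c, (Lp.coeFn_smul c φ).trans (hφ.const_smul c)⟩

/-- The function
`(X, Y) ↦ (2π)^(n(n+1)/4) Γ_Ω(λ)^(-1/2) χ_Ω(X) f(X) det(X)^(λ/2-(n+1)/4) e^(-tr(XY))`. -/
def sFun (n : ℕ) (lam : ℝ) (f : SymmMat n ℝ → ℂ) (p : SymmMat n ℝ × SymmMat n ℝ) : ℂ :=
  (((2 * Real.pi) ^ ((n : ℝ) * (n + 1) / 4) / Real.sqrt (multiGamma n lam) : ℝ) : ℂ) *
    (posCone n).indicator f p.1 *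
    (((mat p.1).det ^ (lam / 2 - ((n : ℝ) + 1) / 4) : ℝ) : ℂ) *
    ((Real.exp (-(mat p.1 * mat p.2).trace) : ℝ) : ℂ)

open Classical in
/-- The operator `S_λ`: the (unique) bounded operator `f ↦ sFun n λ f`. For `λ > n` such an
operator exists, and the second branch is not taken. -/
def sOp (n : ℕ) (lam : ℝ) : ConeL2 n →L[ℂ] Lp ℂ 2 (tubeMeasure n lam) :=
  if h : ∃ S : ConeL2 n →L[ℂ] Lp ℂ 2 (tubeMeasure n lam),
      ∀ f, S f =ᵐ[tubeMeasure n lam] sFun n lam f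
  then h.choose else 0

/-- The operator `R_λ = S_λ^* U`. -/
def rOp (n : ℕ) (lam : ℝ) : Lp ℂ 2 (siegelMeasure n lam) →L[ℂ] ConeL2 n :=
  (sOp n lam).adjoint ∘L (partialFourier n lam).toContinuousLinearEquiv.toContinuousLinearMap

/-- The integrand `f(ξ) det(ξ)^(λ/2-(n+1)/4) e^(i tr(ξZ))` of the Fourier-Laplace transform. -/
def laplaceIntegrand (n : ℕ) (lam : ℝ) (f : SymmMat n ℝ → ℂ) (Z : SymmMat n ℂ)
    (ξ : SymmMat n ℝ) : ℂ :=
  f ξ * (((mat ξ).det ^ (lam / 2 - ((n : ℝ) + 1) / 4) : ℝ) : ℂ) *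
    Complex.exp (Complex.I * (mat (ofReal ξ) * mat Z).trace)

/-- The Fourier-Laplace transform
`Z ↦ Γ_Ω(λ)^(-1/2) ∫_Ω f(ξ) det(ξ)^(λ/2-(n+1)/4) e^(i tr(ξZ)) dξ`. -/
def fourierLaplace (n : ℕ) (lam : ℝ) (f : SymmMat n ℝ → ℂ) (Z : SymmMat n ℂ) : ℂ :=
  ((1 / Real.sqrt (multiGamma n lam) : ℝ) : ℂ) * ∫ ξ in posCone n, laplaceIntegrand n lam f Z ξ

/-- `T` is a partial isometry with initial space `M = (ker T)ᗮ` and final space `N = range T`. -/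
structure IsPartialIsometry {H K : Type*} [NormedAddCommGroup H] [InnerProductSpace ℂ H]
    [NormedAddCommGroup K] [InnerProductSpace ℂ K] (T : H →L[ℂ] K)
    (M : Submodule ℂ H) (N : Submodule ℂ K) : Prop where
  norm_map : ∀ x ∈ M, ‖T x‖ = ‖x‖
  initial_eq : M = (LinearMap.ker T.toLinearMap)ᗮ
  final_eq : N = LinearMap.range T.toLinearMap

end Operators

end

/-! A function in the range of `S_λ` has the form `h(X) e^(-tr(XY))` with `h` supported in `Ω`.
Integrating `e^(-2 tr(XY))` in `Y` against the cone measure is the gamma integral of the cone. The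
constant `C_{λ,n}` is chosen so that, for `X ∈ Ω`, this integral is the reciprocal square of the
factor `(2π)^(n(n+1)/4) Γ_Ω(λ)^(-1/2) det(X)^(λ/2-(n+1)/4)` (`coneWeight_of_mem`). So `S_λ` is
isometric, and so is `R_λ^* = U⁻¹ S_λ`. An operator with isometric adjoint is a partial isometry
from the range of the adjoint onto the whole target, and what remains is to identify that range with
the Bergman space.

The range consists of holomorphic functions. On almost every slice `Im Z = Y` the operator `U` acts
as `ℱ` (`actsOnFibre_ae`), and the slice of `S_λ f` lies in `L¹ ∩ L²`. Hence `U⁻¹ S_λ f` is given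
there by an honest inverse Fourier integral, which is the Fourier-Laplace integral at `X + iY`
(`adjoint_rOp_ae_eq`). The latter is holomorphic because `e^(-tr(ξY))` decays exponentially on the
cone.

Conversely, every Bergman function comes from some `f`, by a Paley-Wiener argument. The sub-mean
value property turns the weighted `L²` bound on `F` into locally uniform `L²` bounds on its slices
(`exists_sliceLIntegral_le`). These bounds justify a contour shift (`integral_slice_eq`), which
shows that `h(ξ) = e^(tr(ξY)) ℱ(F(· + iY))(ξ)` does not depend on `Y`. Thus `U F = h(X)
e^(-tr(XY))`. Off the cone the gamma integral diverges (`coneWeight_of_notMem`), so the finite norm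
of `F` forces `h` to vanish there, and dividing `h` by the factor above produces `f`
(`exists_sOp_eq`).

The gamma integral is computed for diagonal arguments by induction on `n`, splitting off the first
row by a Schur complement, and is extended to all symmetric arguments by orthogonal conjugation. -/

noncomputable section

/-! ### The cone of positive definite matrices: openness, convexity, trace inequalities. -/

section ConeGeometry

open SymmMat Matrix

namespace SymmMat

variable {n : ℕ}

theorem mem_posCone_iff {Y : SymmMat n ℝ} :
    Y ∈ posCone n ↔ ∀ x : Fin n → ℝ, x ≠ 0 → 0 < x ⬝ᵥ mat Y *ᵥ x := by
  rw [posCone, Set.mem_ofPred_eq, Matrix.posDef_iff_dotProduct_mulVec]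
  simp only [star_trivial, and_iff_right_iff_imp]
  intro _
  rw [Matrix.IsHermitian, Matrix.conjTranspose_eq_transpose_of_trivial]
  exact Y.isSymm_mat

theorem isHermitian_mat (Y : SymmMat n ℝ) : (mat Y).IsHermitian := by
  rw [Matrix.IsHermitian, Matrix.conjTranspose_eq_transpose_of_trivial]
  exact Y.isSymm_mat

/-- The rank one symmetric matrix `x xᵀ`. -/
def rankOne (x : Fin n → ℝ) : SymmMat n ℝ :=
  ⟨vecMulVec x x, by
    change (vecMulVec x x)ᵀ = _
    rw [transpose_vecMulVec]⟩

theorem mat_rankOne (x : Fin n → ℝ) : mat (rankOne x) = vecMulVec x x := rfl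

theorem inner_rankOne (A : SymmMat n ℝ) (x : Fin n → ℝ) :
    inner ℝ A (rankOne x) = x ⬝ᵥ mat A *ᵥ x := by
  rw [inner_real, mat_rankOne, mul_vecMulVec, trace_vecMulVec, dotProduct_comm]

theorem norm_rankOne (x : Fin n → ℝ) : ‖rankOne x‖ = x ⬝ᵥ x := by
  have h := real_inner_self_eq_norm_sq (rankOne x)
  rw [inner_rankOne, mat_rankOne, vecMulVec_mulVec, dotProduct_smul] at h
  have h0 : 0 ≤ x ⬝ᵥ x := by simpa using dotProduct_star_self_nonneg x
  have : (x ⬝ᵥ x) ^ 2 = ‖rankOne x‖ ^ 2 := by rw [← h, sq]; simp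
  exact ((sq_eq_sq₀ h0 (norm_nonneg _)).1 this).symm

/-- Cauchy-Schwarz for the trace inner product with `x xᵀ`, a matrix of norm `x ⬝ᵥ x`. It makes
quadratic forms stable under small perturbations in the trace norm. -/
theorem abs_dotProduct_mulVec_le (W : SymmMat n ℝ) (x : Fin n → ℝ) :
    |x ⬝ᵥ mat W *ᵥ x| ≤ ‖W‖ * (x ⬝ᵥ x) := by
  rw [← inner_rankOne, ← norm_rankOne]
  exact abs_real_inner_le_norm _ _

-- The smallest eigenvalue serves as `δ`; for `n = 0` any `δ` will do. This uniform positivity is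
-- the source both of the openness of the cone and of the exponential decay in the Laplace
-- integrals.
open scoped MatrixOrder in
theorem exists_pos_mul_le {Y : SymmMat n ℝ} (hY : Y ∈ posCone n) :
    ∃ δ : ℝ, 0 < δ ∧ ∀ x : Fin n → ℝ, δ * (x ⬝ᵥ x) ≤ x ⬝ᵥ mat Y *ᵥ x := by
  have hY' : (mat Y).PosDef := hY
  rcases Nat.eq_zero_or_pos n with rfl | hn
  · exact ⟨1, one_pos, fun x => by simp [Subsingleton.elim x 0]⟩
  have : Nonempty (Fin n) := ⟨⟨0, hn⟩⟩
  obtain ⟨i, hi⟩ := Finite.exists_min hY'.1.eigenvalues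
  refine ⟨hY'.1.eigenvalues i, hY'.eigenvalues_pos i, fun x => ?_⟩
  have hps : (mat Y - algebraMap ℝ _ (hY'.1.eigenvalues i)).PosSemidef := by
    rw [← Matrix.le_iff]
    rw [algebraMap_le_iff_le_spectrum (a := mat Y) hY'.1]
    intro t ht
    rw [hY'.1.spectrum_real_eq_range_eigenvalues] at ht
    obtain ⟨j, rfl⟩ := ht
    exact hi j
  have := hps.dotProduct_mulVec_nonneg x
  rw [Algebra.algebraMap_eq_smul_one] at this
  simp [sub_mulVec, smul_mulVec] at this
  linarith

theorem mem_posCone_of_pos_mul_le {Y : SymmMat n ℝ} {δ : ℝ} (hδ : 0 < δ)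
    (h : ∀ x : Fin n → ℝ, δ * (x ⬝ᵥ x) ≤ x ⬝ᵥ mat Y *ᵥ x) : Y ∈ posCone n := by
  refine mem_posCone_iff.2 fun x hx => lt_of_lt_of_le ?_ (h x)
  have : 0 < x ⬝ᵥ x := by simpa using dotProduct_star_self_pos_iff.2 hx
  positivity

theorem mul_le_of_norm_sub_le {Y Y' : SymmMat n ℝ} {δ r : ℝ}
    (h : ∀ x : Fin n → ℝ, δ * (x ⬝ᵥ x) ≤ x ⬝ᵥ mat Y *ᵥ x) (hr : ‖Y' - Y‖ ≤ r)
    (x : Fin n → ℝ) : (δ - r) * (x ⬝ᵥ x) ≤ x ⬝ᵥ mat Y' *ᵥ x := by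
  have h1 := (abs_le.1 (abs_dotProduct_mulVec_le (Y' - Y) x)).1
  have h0 : 0 ≤ x ⬝ᵥ x := by simpa using dotProduct_star_self_nonneg x
  have h2 := mul_le_mul_of_nonneg_right hr h0
  have h3 := h x
  rw [map_sub, sub_mulVec, dotProduct_sub] at h1
  linarith

theorem isOpen_posCone : IsOpen (posCone n) := by
  rw [Metric.isOpen_iff]
  intro Y hY
  obtain ⟨δ, hδ, h⟩ := exists_pos_mul_le hY
  refine ⟨δ / 2, by positivity, fun Y' hY' => ?_⟩
  rw [Metric.mem_ball, dist_eq_norm] at hY'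
  exact mem_posCone_of_pos_mul_le (δ := δ - δ / 2) (by linarith)
    (mul_le_of_norm_sub_le h hY'.le)

theorem convex_posCone : Convex ℝ (posCone n) := by
  intro Y hY Y' hY' a b ha hb hab
  rw [mem_posCone_iff] at *
  intro x hx
  rw [map_add, map_smul, map_smul, add_mulVec, smul_mulVec, smul_mulVec, dotProduct_add,
    dotProduct_smul, dotProduct_smul, smul_eq_mul, smul_eq_mul]
  rcases ha.eq_or_lt with rfl | ha
  · rw [zero_add] at hab
    subst hab
    simpa using hY' x hx
  · have := hY x hx
    have := hY' x hx
    positivity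

theorem continuous_complexEquiv : Continuous (complexEquiv n) :=
  LinearMap.continuous_of_finiteDimensional (complexEquiv n).toLinearMap

theorem complexEquiv_mem_siegelDomain {p : SymmMat n ℝ × SymmMat n ℝ} :
    complexEquiv n p ∈ siegelDomain n ↔ p.2 ∈ posCone n := by
  rw [siegelDomain, Set.mem_ofPred_eq, im_complexEquiv]
  rfl

/-- A positive semidefinite `A` is a sum of matrices `v vᵀ`, and `tr(v vᵀ B)` is the value at `v` of
the quadratic form of `B`. -/
theorem trace_mul_nonneg {A B : Matrix (Fin n) (Fin n) ℝ} (hA : A.PosSemidef)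
    (hB : B.PosSemidef) : 0 ≤ (A * B).trace := by
  obtain ⟨m, v, rfl⟩ := Matrix.posSemidef_iff_eq_sum_vecMulVec.1 hA
  rw [Finset.sum_mul, trace_sum]
  refine Finset.sum_nonneg fun i _ => ?_
  rw [vecMulVec_mul, trace_vecMulVec, dotProduct_comm, ← dotProduct_mulVec]
  simpa using hB.dotProduct_mulVec_nonneg (v i)

/-- The identity matrix. -/
def oneSymm (n : ℕ) : SymmMat n ℝ := ⟨1, Matrix.isSymm_one⟩

theorem mat_oneSymm : mat (oneSymm n) = 1 := rfl

theorem oneSymm_mem_posCone : oneSymm n ∈ posCone n := Matrix.PosDef.one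

theorem inner_oneSymm (A : SymmMat n ℝ) : inner ℝ A (oneSymm n) = (mat A).trace := by
  rw [inner_real, mat_oneSymm, mul_one]

theorem inner_nonneg_of_posSemidef {A B : SymmMat n ℝ} (hA : (mat A).PosSemidef)
    (hB : ∀ x : Fin n → ℝ, 0 ≤ x ⬝ᵥ mat B *ᵥ x) : 0 ≤ inner ℝ A B := by
  rw [inner_real]
  exact trace_mul_nonneg hA (.of_dotProduct_mulVec_nonneg B.isHermitian_mat
    (fun x => by simpa using hB x))

/-- Pair `A` with the positive semidefinite matrix `B - δ • 1`. Together with `norm_le_trace` this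
gives exponential decay of `e^(-tr(AB))` in `‖A‖`. -/
theorem mul_trace_le_inner {A B : SymmMat n ℝ} (hA : (mat A).PosSemidef) {δ : ℝ}
    (hB : ∀ x : Fin n → ℝ, δ * (x ⬝ᵥ x) ≤ x ⬝ᵥ mat B *ᵥ x) :
    δ * (mat A).trace ≤ inner ℝ A B := by
  have := inner_nonneg_of_posSemidef (B := B - δ • oneSymm n) hA (fun x => by
    rw [map_sub, map_smul, mat_oneSymm, sub_mulVec, smul_mulVec, one_mulVec, dotProduct_sub,
      dotProduct_smul, smul_eq_mul]
    linarith [hB x])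
  rw [inner_sub_right, inner_smul_right, inner_oneSymm] at this
  linarith

/-- By Cauchy-Schwarz `(x ⬝ᵥ x) 1 - x xᵀ` is positive semidefinite, and pairing it with `A` gives `A
≤ tr(A) 1`. Hence `2 tr(A) 1 - A ≥ tr(A) 1`, and pairing this with `A` gives `tr(A)² ≤ 2 tr(A)² -
‖A‖²`. -/
theorem norm_le_trace {A : SymmMat n ℝ} (hA : (mat A).PosSemidef) : ‖A‖ ≤ (mat A).trace := by
  have h1 : ∀ x : Fin n → ℝ, x ⬝ᵥ mat A *ᵥ x ≤ (mat A).trace * (x ⬝ᵥ x) := by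
    intro x
    have := inner_nonneg_of_posSemidef (B := (x ⬝ᵥ x) • oneSymm n - rankOne x) hA (fun y => by
      rw [map_sub, map_smul, mat_oneSymm, sub_mulVec, smul_mulVec, one_mulVec, dotProduct_sub,
        dotProduct_smul, smul_eq_mul, ← inner_rankOne (rankOne x)]
      have h := real_inner_le_norm (rankOne x) (rankOne y)
      rw [norm_rankOne, norm_rankOne] at h
      linarith)
    rw [inner_sub_right, inner_smul_right, inner_oneSymm, inner_rankOne] at this
    linarith
  have h2 := mul_trace_le_inner (B := (2 * (mat A).trace) • oneSymm n - A) hA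
    (δ := (mat A).trace) (fun x => by
      rw [map_sub, map_smul, mat_oneSymm, sub_mulVec, smul_mulVec, one_mulVec, dotProduct_sub,
        dotProduct_smul, smul_eq_mul]
      linarith [h1 x])
  rw [inner_sub_right, inner_smul_right, inner_oneSymm, real_inner_self_eq_norm_sq] at h2
  have h3 := hA.trace_nonneg
  nlinarith [norm_nonneg A]

end SymmMat

end ConeGeometry

/-! ### The gamma integral of the cone. -/

section ConeGamma

open SymmMat Matrix

namespace SymmMat

variable {n : ℕ}

theorem norm_sq_eq_sum (A : SymmMat n ℝ) : ‖A‖ ^ 2 = ∑ i, ∑ j, mat A i j ^ 2 := by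
  rw [← real_inner_self_eq_norm_sq, inner_real, trace]
  refine Finset.sum_congr rfl fun i _ => ?_
  rw [diag_apply, mul_apply]
  refine Finset.sum_congr rfl fun j _ => ?_
  rw [A.isSymm_mat.apply i j, sq]

/-- The symmetric matrix with blocks `a`, `b`, `bᵀ`, `C`. -/
def bordered (a : ℝ) (b : Fin n → ℝ) (C : SymmMat n ℝ) : SymmMat (n + 1) ℝ :=
  ⟨Matrix.of fun i j => Fin.cases (Fin.cases a b j)
    (fun i' => Fin.cases (b i') (fun j' => mat C i' j') j) i, by
    change _ᵀ = _
    ext i j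
    refine Fin.cases ?_ (fun i => ?_) i <;> refine Fin.cases ?_ (fun j => ?_) j
    · rfl
    · rfl
    · rfl
    · exact C.isSymm_mat.apply i j⟩

section

variable (a : ℝ) (b : Fin n → ℝ) (C : SymmMat n ℝ)

@[simp] theorem mat_bordered_zero_zero : mat (bordered a b C) 0 0 = a := rfl
@[simp] theorem mat_bordered_zero_succ (j : Fin n) : mat (bordered a b C) 0 j.succ = b j := rfl
@[simp] theorem mat_bordered_succ_zero (i : Fin n) : mat (bordered a b C) i.succ 0 = b i := rfl
@[simp] theorem mat_bordered_succ_succ (i j : Fin n) :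
    mat (bordered a b C) i.succ j.succ = mat C i j := rfl

end

theorem bordered_dotProduct (a : ℝ) (b : Fin n → ℝ) (C : SymmMat n ℝ) (x : Fin (n + 1) → ℝ) :
    x ⬝ᵥ mat (bordered a b C) *ᵥ x =
      a * x 0 ^ 2 + 2 * x 0 * (b ⬝ᵥ Fin.tail x) + Fin.tail x ⬝ᵥ mat C *ᵥ Fin.tail x := by
  simp only [dotProduct, mulVec, Fin.sum_univ_succ, mat_bordered_zero_zero,
    mat_bordered_zero_succ, mat_bordered_succ_zero, mat_bordered_succ_succ, Fin.tail]
  simp only [mul_add, Finset.sum_add_distrib, Finset.mul_sum]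
  have : ∀ i : Fin n, 2 * x 0 * (b i * x i.succ) = x 0 * (b i * x i.succ) + x i.succ * (b i * x 0) :=
    fun i => by ring
  simp only [this, Finset.sum_add_distrib]
  ring

/-- Completing the square in `x 0`: the Schur complement of the corner `a` is exactly `C`, so the
quadratic form splits into a square and the form of `C`. -/
theorem bordered_add_rankOne_mem_posCone {a : ℝ} (ha : 0 < a) (b : Fin n → ℝ) (C : SymmMat n ℝ) :
    bordered a b (C + a⁻¹ • rankOne b) ∈ posCone (n + 1) ↔ C ∈ posCone n := by
  have key : ∀ x : Fin (n + 1) → ℝ, x ⬝ᵥ mat (bordered a b (C + a⁻¹ • rankOne b)) *ᵥ x =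
      a * (x 0 + a⁻¹ * (b ⬝ᵥ Fin.tail x)) ^ 2 + Fin.tail x ⬝ᵥ mat C *ᵥ Fin.tail x := by
    intro x
    rw [bordered_dotProduct, map_add, map_smul, add_mulVec, smul_mulVec, dotProduct_add,
      dotProduct_smul, ← inner_rankOne (rankOne b), inner_rankOne, mat_rankOne, vecMulVec_mulVec,
      dotProduct_smul, dotProduct_comm (Fin.tail x) b]
    simp
    field_simp
    ring
  rw [mem_posCone_iff, mem_posCone_iff]
  constructor
  · intro h y hy
    -- The first coordinate is chosen to make the completed square vanish.
    have := h (Fin.cons (-(a⁻¹ * (b ⬝ᵥ y))) y) (fun h0 => hy (by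
      ext i; simpa using congrFun h0 i.succ))
    rw [key] at this
    simpa using this
  · intro h x hx
    rw [key]
    by_cases hy : Fin.tail x = 0
    · have hx0 : x 0 ≠ 0 := by
        intro h0
        apply hx
        ext i
        refine Fin.cases h0 (fun i => congrFun hy i) i
      simp only [hy, dotProduct_zero, mul_zero, add_zero, zero_dotProduct]
      positivity
    · have := h _ hy
      positivity

theorem pos_of_bordered_mem_posCone {a : ℝ} {b : Fin n → ℝ} {C : SymmMat n ℝ}
    (h : bordered a b C ∈ posCone (n + 1)) : 0 < a :=
  Matrix.PosDef.diag_pos (i := 0) (show (mat (bordered a b C)).PosDef from h)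

theorem det_bordered_add_rankOne {a : ℝ} (ha : a ≠ 0) (b : Fin n → ℝ) (C : SymmMat n ℝ) :
    (mat (bordered a b (C + a⁻¹ • rankOne b))).det = a * (mat C).det := by
  let e : Unit ⊕ Fin n ≃ Fin (n + 1) :=
    (Equiv.sumComm _ _).trans ((Equiv.optionEquivSumPUnit (Fin n)).symm.trans
      (finSuccEquiv n).symm)
  have he1 : ∀ u, e (Sum.inl u) = 0 := fun u => by simp [e]
  have he2 : ∀ i, e (Sum.inr i) = i.succ := fun i => by simp [e]
  rw [← Matrix.det_submatrix_equiv_self e]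
  have : (mat (bordered a b (C + a⁻¹ • rankOne b))).submatrix e e =
      fromBlocks (a • (1 : Matrix Unit Unit ℝ)) (replicateRow Unit b) (replicateCol Unit b)
        (mat (C + a⁻¹ • rankOne b)) := by
    ext i j
    rcases i with i | i <;> rcases j with j | j <;> simp [he1, he2]
  rw [this]
  let _ : Invertible (a • (1 : Matrix Unit Unit ℝ)) :=
    ⟨a⁻¹ • 1, by simp [smul_smul, ha], by simp [smul_smul, ha]⟩
  rw [Matrix.det_fromBlocks₁₁]
  have h2 : mat (C + a⁻¹ • rankOne b) -
      replicateCol Unit b * ⅟(a • (1 : Matrix Unit Unit ℝ)) * replicateRow Unit b = mat C := by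
    change _ - replicateCol Unit b * (a⁻¹ • (1 : Matrix Unit Unit ℝ)) * replicateRow Unit b = _
    ext i j
    simp [mat_rankOne, vecMulVec_apply, Matrix.mul_apply]
  rw [h2]
  simp

/-- Bordered matrices as an isometry from an orthogonal sum. -/
def borderedIsometry (n : ℕ) :
    WithLp 2 (ℝ × WithLp 2 (EuclideanSpace ℝ (Fin n) × SymmMat n ℝ)) ≃ₗᵢ[ℝ] SymmMat (n + 1) ℝ where
  -- Each border entry occurs twice in `tr(A²)`; the factor `1/√2` compensates for this.
  toFun p := bordered p.fst (fun i => (Real.sqrt 2)⁻¹ * p.snd.fst i) p.snd.snd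
  map_add' p q := by
    apply mat_injective
    ext i j
    refine Fin.cases ?_ (fun i => ?_) i <;> refine Fin.cases ?_ (fun j => ?_) j <;>
      simp [mul_add]
  map_smul' c p := by
    apply mat_injective
    ext i j
    refine Fin.cases ?_ (fun i => ?_) i <;> refine Fin.cases ?_ (fun j => ?_) j <;>
      simp [mul_left_comm]
  invFun M := WithLp.toLp 2 (mat M 0 0, WithLp.toLp 2
    (WithLp.toLp 2 fun j => Real.sqrt 2 * mat M 0 j.succ,
      ⟨(mat M).submatrix Fin.succ Fin.succ, M.isSymm_mat.submatrix _⟩))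
  left_inv p := by
    have h : ∀ x : ℝ, √2 * ((√2)⁻¹ * x) = x := fun x => by
      rw [← mul_assoc, mul_inv_cancel₀ (by positivity), one_mul]
    simp only [mat_bordered_zero_zero, mat_bordered_zero_succ, h]
    rfl
  right_inv M := by
    apply mat_injective
    ext i j
    have h : ∀ x : ℝ, (√2)⁻¹ * (√2 * x) = x := fun x => by
      rw [← mul_assoc, inv_mul_cancel₀ (by positivity), one_mul]
    refine Fin.cases ?_ (fun i => ?_) i <;> refine Fin.cases ?_ (fun j => ?_) j
    · rfl
    · exact h _
    · exact (h _).trans (M.isSymm_mat.apply i.succ 0)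
    · rfl
  norm_map' p := by
    rw [← sq_eq_sq₀ (norm_nonneg _) (norm_nonneg _), norm_sq_eq_sum,
      WithLp.prod_norm_sq_eq_of_L2, WithLp.prod_norm_sq_eq_of_L2, EuclideanSpace.norm_sq_eq,
      norm_sq_eq_sum]
    have h2 : ((√2)⁻¹ : ℝ) ^ 2 = 1 / 2 := by
      rw [inv_pow, Real.sq_sqrt (by norm_num)]; norm_num
    simp [Fin.sum_univ_succ, mul_pow, h2, Finset.sum_add_distrib, ← Finset.mul_sum]
    ring

/-- Lebesgue measure of the trace inner product becomes a product over corner, border and block,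
ready for Tonelli. The rescaling of the border is why powers of `2π`, rather than of `π`, appear in
`multiGamma`. -/
theorem measurePreserving_bordered (n : ℕ) :
    MeasurePreserving (fun q : ℝ × ((Fin n → ℝ) × SymmMat n ℝ) =>
      bordered q.1 (fun i => (Real.sqrt 2)⁻¹ * q.2.1 i) q.2.2)
      (volume.prod (volume.prod volume)) volume := by
  have h1 : MeasurePreserving (fun q : (Fin n → ℝ) × SymmMat n ℝ =>
      WithLp.toLp 2 (WithLp.toLp 2 q.1, q.2)) (volume.prod volume)
      (volume : Measure (WithLp 2 (EuclideanSpace ℝ (Fin n) × SymmMat n ℝ))) :=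
    (WithLp.volume_preserving_toLp _ _).comp
      ((PiLp.volume_preserving_toLp (Fin n)).prod (MeasurePreserving.id volume))
  have h2 := (borderedIsometry n).measurePreserving.comp
    ((WithLp.volume_preserving_toLp ℝ _).comp ((MeasurePreserving.id volume).prod h1))
  exact h2

theorem lintegral_pi_gaussian {c : Fin n → ℝ} (hc : ∀ i, 0 < c i) :
    ∫⁻ b : Fin n → ℝ, ENNReal.ofReal (∏ i, Real.exp (-c i * b i ^ 2)) =
      ENNReal.ofReal (∏ i, √(Real.pi / c i)) := by
  rw [← ofReal_integral_eq_lintegral_ofReal]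
  · rw [integral_fintype_prod_volume_eq_prod (fun i (x : ℝ) => Real.exp (-c i * x ^ 2))]
    simp only [integral_gaussian]
  · exact Integrable.fintype_prod (f := fun i (x : ℝ) => Real.exp (-c i * x ^ 2))
      fun i => integrable_exp_neg_mul_sq (hc i)
  · exact Filter.Eventually.of_forall fun b => Finset.prod_nonneg fun i _ => (Real.exp_pos _).le

theorem lintegral_Ioi_rpow_exp {a r : ℝ} (ha : 0 < a) (hr : 0 < r) :
    ∫⁻ x in Set.Ioi (0 : ℝ), ENNReal.ofReal (x ^ (a - 1) * Real.exp (-(r * x))) =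
      ENNReal.ofReal (Real.Gamma a * r ^ (-a)) := by
  rw [← ofReal_integral_eq_lintegral_ofReal]
  · rw [Real.integral_rpow_mul_exp_neg_mul_Ioi ha hr, one_div, Real.inv_rpow hr.le,
      Real.rpow_neg hr.le, mul_comm]
  -- A non-integrable function has integral `0` by convention, whereas the gamma formula gives a
  -- positive value.
  · by_contra h
    have := Real.integral_rpow_mul_exp_neg_mul_Ioi ha hr
    rw [integral_undef h] at this
    have h2 := Real.Gamma_pos_of_pos ha
    have : 0 < (1 / r) ^ a * Real.Gamma a := by positivity
    linarith
  · filter_upwards [ae_restrict_mem measurableSet_Ioi] with x hx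
    have : (0 : ℝ) < x := hx
    positivity

theorem continuous_det_mat : Continuous fun Y : SymmMat n ℝ => (mat Y).det :=
  Continuous.matrix_det continuous_mat

theorem continuous_mat_apply (i j : Fin n) : Continuous fun Y : SymmMat n ℝ => mat Y i j :=
  continuous_mat.matrix_elem i j

theorem det_pos_of_mem {Y : SymmMat n ℝ} (hY : Y ∈ posCone n) : 0 < (mat Y).det :=
  Matrix.PosDef.det_pos hY

theorem measurable_diag_exp_det (d : Fin n → ℝ) (t : ℝ) :
    Measurable fun Y : SymmMat n ℝ =>
      ENNReal.ofReal (Real.exp (-∑ i, d i * mat Y i i) * (mat Y).det ^ t) := by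
  have h1 : Measurable fun Y : SymmMat n ℝ => (mat Y).det := continuous_det_mat.measurable
  have h2 : Continuous fun Y : SymmMat n ℝ => ∑ i, d i * mat Y i i :=
    continuous_finsetSum _ fun i _ => (continuous_mat_apply i i).const_mul _
  have := h2.measurable
  fun_prop

end SymmMat

theorem multiGamma_zero (s : ℝ) : multiGamma 0 s = 1 := by simp [multiGamma]

/-- The recursion matching the induction on matrix size: the power of `2π` comes from the Gaussian
integral over the border, `Γ(s)` from the corner entry, and the rest from the smaller block. -/
theorem multiGamma_succ (n : ℕ) (s : ℝ) :
    multiGamma (n + 1) s =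
      (2 * Real.pi) ^ ((n : ℝ) / 2) * Real.Gamma s * multiGamma n (s - 1 / 2) := by
  have h2 : (0 : ℝ) < 2 * Real.pi := by positivity
  have h : (2 * Real.pi) ^ (((n + 1 : ℕ) : ℝ) * (((n + 1 : ℕ) : ℝ) - 1) / 4) =
      (2 * Real.pi) ^ ((n : ℝ) / 2) * (2 * Real.pi) ^ ((n : ℝ) * (n - 1) / 4) := by
    rw [← Real.rpow_add h2]
    congr 1
    push_cast
    ring
  have h3 : ∀ (m : ℕ) (f : ℕ → ℝ), ∏ j ∈ Finset.Icc 1 m, f j = ∏ i ∈ Finset.range m, f (1 + i) :=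
    fun m f => by
      rw [← Finset.Ico_add_one_right_eq_Icc, Finset.prod_Ico_eq_prod_range, Nat.add_sub_cancel]
  rw [multiGamma, multiGamma, h, h3, h3, Finset.prod_range_succ']
  have h4 : ∀ i : ℕ, Real.Gamma (s - (((1 + (i + 1) : ℕ) : ℝ) - 1) / 2) =
      Real.Gamma (s - 1 / 2 - (((1 + i : ℕ) : ℝ) - 1) / 2) := fun i => by
    congr 1
    push_cast
    ring
  simp only [h4]
  simp
  ring

theorem multiGamma_pos (n : ℕ) {s : ℝ} (hs : ((n : ℝ) - 1) / 2 < s) : 0 < multiGamma n s := by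
  refine mul_pos (by positivity) (Finset.prod_pos fun j hj => Real.Gamma_pos_of_pos ?_)
  have : (j : ℝ) ≤ n := by exact_mod_cast (Finset.mem_Icc.1 hj).2
  linarith

namespace SymmMat

variable {n : ℕ}

/-- The integrand `e^(-tr(DY)) det(Y)^t`, `D` diagonal, of the gamma integral of the cone. -/
def diagIntegrand (d : Fin n → ℝ) (t : ℝ) : SymmMat n ℝ → ℝ≥0∞ :=
  (posCone n).indicator fun Y =>
    ENNReal.ofReal (Real.exp (-∑ i, d i * mat Y i i) * (mat Y).det ^ t)

theorem measurable_diagIntegrand (d : Fin n → ℝ) (t : ℝ) : Measurable (diagIntegrand d t) :=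
  (measurable_diag_exp_det d t).indicator isOpen_posCone.measurableSet

/-- Translating the block by `a⁻¹ b bᵀ` separates the variables: the determinant becomes `a det C`,
and the trace contributes a Gaussian in the border. Since the argument is diagonal, this Gaussian is
a product of one-dimensional ones. -/
theorem diagIntegrand_bordered (d : Fin (n + 1) → ℝ) (t : ℝ) {a : ℝ} (ha : 0 < a) (b : Fin n → ℝ)
    (C : SymmMat n ℝ) :
    diagIntegrand d t (bordered a (fun i => (√2)⁻¹ * b i)
        (C + a⁻¹ • rankOne (fun i => (√2)⁻¹ * b i))) =
      ENNReal.ofReal (Real.exp (-(d 0 * a)) * a ^ t) *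
        (ENNReal.ofReal (∏ i, Real.exp (-(Fin.tail d i / (2 * a)) * b i ^ 2)) *
          diagIntegrand (Fin.tail d) t C) := by
  rw [diagIntegrand, diagIntegrand]
  by_cases hC : C ∈ posCone n
  · rw [Set.indicator_of_mem ((bordered_add_rankOne_mem_posCone ha _ C).2 hC),
      Set.indicator_of_mem hC, det_bordered_add_rankOne ha.ne',
      ← ENNReal.ofReal_mul (Finset.prod_nonneg fun i _ => (Real.exp_pos _).le),
      ← ENNReal.ofReal_mul (by positivity),
      Real.mul_rpow ha.le (det_pos_of_mem hC).le]
    congr 1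
    rw [← Real.exp_sum]
    have h2 : ((√2)⁻¹ : ℝ) * (√2)⁻¹ = 1 / 2 := by
      rw [← mul_inv, Real.mul_self_sqrt (by norm_num)]; norm_num
    have : Real.exp (-∑ i, d i * mat (bordered a (fun i => (√2)⁻¹ * b i)
        (C + a⁻¹ • rankOne fun i => (√2)⁻¹ * b i)) i i) = Real.exp (-(d 0 * a)) *
        (Real.exp (∑ i, -(Fin.tail d i / (2 * a)) * b i ^ 2) *
          Real.exp (-∑ i, Fin.tail d i * mat C i i)) := by
      rw [← Real.exp_add, ← Real.exp_add, Fin.sum_univ_succ, ← Finset.sum_neg_distrib,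
        ← Finset.sum_add_distrib, neg_add, ← Finset.sum_neg_distrib]
      congr 1
      simp only [mat_bordered_zero_zero, mat_bordered_succ_succ, map_add, map_smul,
        Matrix.add_apply, Matrix.smul_apply, mat_rankOne, vecMulVec_apply, Fin.tail]
      congr 1
      refine Finset.sum_congr rfl fun i _ => ?_
      rw [mul_mul_mul_comm, h2, smul_eq_mul]
      field_simp
      ring
    rw [this]
    ring
  · rw [Set.indicator_of_notMem (fun h => hC
      ((bordered_add_rankOne_mem_posCone ha _ C).1 h)), Set.indicator_of_notMem hC]
    simp

theorem prod_sqrt_gaussian {d : Fin n → ℝ} (hd : ∀ i, 0 < d i) {a : ℝ} (ha : 0 < a) :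
    ∏ i, √(Real.pi / (d i / (2 * a))) =
      a ^ ((n : ℝ) / 2) * ((2 * Real.pi) ^ ((n : ℝ) / 2) * (∏ i, d i) ^ (-(1 / 2 : ℝ))) := by
  have : ∀ i, √(Real.pi / (d i / (2 * a))) =
      (a ^ (1 / 2 : ℝ) * (2 * Real.pi) ^ (1 / 2 : ℝ)) * d i ^ (-(1 / 2 : ℝ)) := by
    intro i
    have := hd i
    rw [Real.sqrt_eq_rpow, Real.rpow_neg this.le, ← Real.inv_rpow this.le,
      ← Real.mul_rpow ha.le (by positivity), ← Real.mul_rpow (by positivity) (by positivity)]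
    congr 1
    field_simp
  simp only [this]
  rw [Finset.prod_mul_distrib, Finset.prod_const, Finset.card_univ, Fintype.card_fin,
    mul_pow, ← Real.rpow_natCast, ← Real.rpow_natCast, ← Real.rpow_mul ha.le,
    ← Real.rpow_mul (by positivity), Real.finsetProd_rpow _ _ (fun i _ => (hd i).le),
    mul_assoc]
  congr 2 <;> ring_nf

/-- For `a > 0`, translation invariance in the block and the Gaussian integral in the border apply;
the latter contributes `a^(n/2)`, which raises the power of `a`. For `a ≤ 0` no bordered matrix with
corner `a` is positive definite. -/
theorem lintegral_diagIntegrand_bordered {d : Fin (n + 1) → ℝ} (hd : ∀ i, 0 < d i) (t a : ℝ) :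
    ∫⁻ b : Fin n → ℝ, ∫⁻ C : SymmMat n ℝ,
      diagIntegrand d t (bordered a (fun i => (√2)⁻¹ * b i) C) =
    (Set.Ioi (0 : ℝ)).indicator (fun a =>
      ENNReal.ofReal (a ^ (t + (n : ℝ) / 2) * Real.exp (-(d 0 * a)))) a *
      (ENNReal.ofReal ((2 * Real.pi) ^ ((n : ℝ) / 2) * (∏ i, Fin.tail d i) ^ (-(1 / 2 : ℝ))) *
        ∫⁻ C, diagIntegrand (Fin.tail d) t C) := by
  by_cases ha : a ∈ Set.Ioi (0 : ℝ)
  swap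
  · rw [Set.indicator_of_notMem ha, zero_mul]
    have : ∀ (b : Fin n → ℝ) (C : SymmMat n ℝ), diagIntegrand d t (bordered a b C) = 0 :=
      fun b C => Set.indicator_of_notMem (fun h => ha (pos_of_bordered_mem_posCone h)) _
    simp only [this, lintegral_zero]
  rw [Set.indicator_of_mem ha]
  replace ha : 0 < a := ha
  have inner2 : ∀ b : Fin n → ℝ,
      ∫⁻ C : SymmMat n ℝ, diagIntegrand d t (bordered a (fun i => (√2)⁻¹ * b i) C) =
      ENNReal.ofReal (Real.exp (-(d 0 * a)) * a ^ t) *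
        (ENNReal.ofReal (∏ i, Real.exp (-(Fin.tail d i / (2 * a)) * b i ^ 2)) *
          ∫⁻ C, diagIntegrand (Fin.tail d) t C) := by
    intro b
    rw [← lintegral_add_right_eq_self _ (a⁻¹ • rankOne (fun i => (√2)⁻¹ * b i)),
      ← lintegral_const_mul _ (measurable_diagIntegrand _ t),
      ← lintegral_const_mul _ ((measurable_diagIntegrand _ t).const_mul _)]
    exact lintegral_congr fun C => diagIntegrand_bordered d t ha b C
  have hd' : ∀ i, 0 < Fin.tail d i := fun i => hd i.succ
  simp only [inner2]
  rw [lintegral_const_mul, lintegral_mul_const, lintegral_pi_gaussian, ← mul_assoc, ← mul_assoc,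
    ← ENNReal.ofReal_mul (by positivity), ← ENNReal.ofReal_mul (by positivity)]
  · congr 2
    rw [prod_sqrt_gaussian hd' ha, Real.rpow_add ha]
    ring
  · intro i
    have := hd' i
    positivity
  · fun_prop
  · fun_prop

/-- Induction on the size: integrating out block and border leaves a one-dimensional gamma integral
in the corner, times the integral for size `n` with parameter `s - 1/2`. -/
theorem lintegral_diagIntegrand (n : ℕ) : ∀ {s : ℝ}, ((n : ℝ) - 1) / 2 < s → ∀ {d : Fin n → ℝ},
    (∀ i, 0 < d i) → ∫⁻ Y, diagIntegrand d (s - ((n : ℝ) + 1) / 2) Y =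
    ENNReal.ofReal (multiGamma n s * (∏ i, d i) ^ (-s)) := by
  induction n with
  | zero =>
    intro s _ d _
    have h1 : posCone 0 = Set.univ := Set.eq_univ_of_forall fun Y =>
      mem_posCone_iff.2 fun x hx => (hx (Subsingleton.elim _ _)).elim
    -- In dimension zero the parallelepiped of the empty orthonormal basis is the whole space, a
    -- point of mass one.
    have h2 : (volume : Measure (SymmMat 0 ℝ)) Set.univ = 1 := by
      have h0 : ∀ A : SymmMat 0 ℝ, A = 0 := fun A =>
        mat_injective (Subsingleton.elim _ _)
      have : Module.finrank ℝ (SymmMat 0 ℝ) = 0 :=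
        Module.finrank_eq_zero_iff.2 fun x => ⟨1, one_ne_zero, h0 _⟩
      have h3 := (stdOrthonormalBasis ℝ (SymmMat 0 ℝ)).volume_parallelepiped
      rw [← h3]
      congr 1
      refine (Set.eq_univ_of_forall fun A => ?_).symm
      rw [h0 A, mem_parallelepiped_iff]
      exact ⟨0, ⟨le_rfl, by simp⟩, by simp⟩
    simp only [diagIntegrand, h1, Set.indicator_univ]
    simp [h2, multiGamma_zero]
  | succ n ih =>
    intro s hs d hd
    have hs' : (n : ℝ) / 2 < s := by push_cast at hs; linarith
    have hs0 : 0 < s := lt_of_le_of_lt (by positivity) hs'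
    have ih' := ih (s := s - 1 / 2) (by linarith) (d := Fin.tail d) (fun i => hd i.succ)
    set t : ℝ := s - (((n + 1 : ℕ) : ℝ) + 1) / 2 with ht
    -- The exponent of the determinant is the same for size `n + 1` with parameter `s` and for size
    -- `n` with parameter `s - 1/2`.
    have ht' : s - 1 / 2 - ((n : ℝ) + 1) / 2 = t := by rw [ht]; push_cast; ring
    have ht'' : t + (n : ℝ) / 2 = s - 1 := by rw [ht]; push_cast; ring
    rw [ht'] at ih'
    have hm : Measurable fun q : ℝ × ((Fin n → ℝ) × SymmMat n ℝ) =>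
        diagIntegrand d t (bordered q.1 (fun i => (√2)⁻¹ * q.2.1 i) q.2.2) :=
      (measurable_diagIntegrand d t).comp (measurePreserving_bordered n).measurable
    have hm2 : ∀ a, Measurable fun q : (Fin n → ℝ) × SymmMat n ℝ =>
        diagIntegrand d t (bordered a (fun i => (√2)⁻¹ * q.1 i) q.2) :=
      fun a => by
        change Measurable ((fun q : ℝ × ((Fin n → ℝ) × SymmMat n ℝ) =>
          diagIntegrand d t (bordered q.1 (fun i => (√2)⁻¹ * q.2.1 i) q.2.2)) ∘ Prod.mk a)
        exact hm.comp measurable_prodMk_left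
    rw [← (measurePreserving_bordered n).lintegral_comp (measurable_diagIntegrand d t),
      lintegral_prod _ hm.aemeasurable]
    have inner : ∀ a : ℝ, ∫⁻ q : (Fin n → ℝ) × SymmMat n ℝ,
        diagIntegrand d t (bordered a (fun i => (√2)⁻¹ * q.1 i) q.2)
          ∂((volume : Measure (Fin n → ℝ)).prod (volume : Measure (SymmMat n ℝ))) = _ :=
      fun a => (lintegral_prod _ (hm2 a).aemeasurable).trans
        (lintegral_diagIntegrand_bordered hd t a)
    simp only [inner]
    rw [lintegral_mul_const _ (Measurable.indicator (by fun_prop) measurableSet_Ioi),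
      lintegral_indicator measurableSet_Ioi, ht'', lintegral_Ioi_rpow_exp hs0 (hd 0), ih']
    have h7 := hd 0
    have h8 : 0 < ∏ i, Fin.tail d i := Finset.prod_pos fun i _ => hd i.succ
    have h9 := multiGamma_pos n (s := s - 1 / 2) (by linarith)
    have h10 := Real.Gamma_pos_of_pos hs0
    rw [← ENNReal.ofReal_mul (by positivity), ← ENNReal.ofReal_mul (by positivity),
      multiGamma_succ, Fin.prod_univ_succ, Real.mul_rpow h7.le (Finset.prod_pos fun i _ => hd i.succ).le]
    congr 1
    have h11 : (∏ i, Fin.tail d i) ^ (-s) =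
        (∏ i, Fin.tail d i) ^ (-(1 / 2 : ℝ)) * (∏ i, Fin.tail d i) ^ (-(s - 1 / 2)) := by
      rw [← Real.rpow_add h8]
      congr 1
      ring
    change _ = _ * (d 0 ^ (-s) * (∏ i, Fin.tail d i) ^ (-s))
    rw [h11]
    ring

/-- Conjugation by an orthogonal matrix. -/
def conjIsometry (U : Matrix.unitaryGroup (Fin n) ℝ) : SymmMat n ℝ ≃ₗᵢ[ℝ] SymmMat n ℝ where
  toFun A := ⟨(U : Matrix (Fin n) (Fin n) ℝ) * mat A * (U : Matrix (Fin n) (Fin n) ℝ)ᵀ, by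
    change _ᵀ = _
    rw [transpose_mul, transpose_mul, transpose_transpose, A.isSymm_mat, Matrix.mul_assoc]⟩
  map_add' A B := mat_injective <| by
    change (U : Matrix (Fin n) (Fin n) ℝ) * mat (A + B) * (U : Matrix (Fin n) (Fin n) ℝ)ᵀ =
      (U : Matrix (Fin n) (Fin n) ℝ) * mat A * (U : Matrix (Fin n) (Fin n) ℝ)ᵀ +
      (U : Matrix (Fin n) (Fin n) ℝ) * mat B * (U : Matrix (Fin n) (Fin n) ℝ)ᵀ
    rw [map_add, Matrix.mul_add, Matrix.add_mul]
  map_smul' c A := mat_injective <| by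
    change (U : Matrix (Fin n) (Fin n) ℝ) * mat (c • A) * (U : Matrix (Fin n) (Fin n) ℝ)ᵀ =
      c • ((U : Matrix (Fin n) (Fin n) ℝ) * mat A * (U : Matrix (Fin n) (Fin n) ℝ)ᵀ)
    rw [map_smul, Matrix.mul_smul, Matrix.smul_mul]
  invFun A := ⟨(U : Matrix (Fin n) (Fin n) ℝ)ᵀ * mat A * (U : Matrix (Fin n) (Fin n) ℝ), by
    change _ᵀ = _
    rw [transpose_mul, transpose_mul, transpose_transpose, A.isSymm_mat, Matrix.mul_assoc]⟩
  left_inv A := mat_injective <| by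
    have h : (U : Matrix (Fin n) (Fin n) ℝ)ᵀ * U = 1 := Unitary.coe_star_mul_self U
    change (U : Matrix (Fin n) (Fin n) ℝ)ᵀ * (U * mat A * (U : Matrix (Fin n) (Fin n) ℝ)ᵀ) * U = _
    rw [Matrix.mul_assoc, Matrix.mul_assoc _ _ (U : Matrix (Fin n) (Fin n) ℝ), h, mul_one,
      ← Matrix.mul_assoc, h, one_mul]
  right_inv A := mat_injective <| by
    have h : (U : Matrix (Fin n) (Fin n) ℝ) * (U : Matrix (Fin n) (Fin n) ℝ)ᵀ = 1 :=
      Unitary.coe_mul_star_self U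
    change (U : Matrix (Fin n) (Fin n) ℝ) * ((U : Matrix (Fin n) (Fin n) ℝ)ᵀ * mat A * U) *
      (U : Matrix (Fin n) (Fin n) ℝ)ᵀ = _
    rw [Matrix.mul_assoc, Matrix.mul_assoc _ (U : Matrix (Fin n) (Fin n) ℝ), h, mul_one,
      ← Matrix.mul_assoc, h, one_mul]
  norm_map' A := by
    have h : (U : Matrix (Fin n) (Fin n) ℝ)ᵀ * U = 1 := Unitary.coe_star_mul_self U
    rw [← sq_eq_sq₀ (norm_nonneg _) (norm_nonneg _), ← real_inner_self_eq_norm_sq,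
      ← real_inner_self_eq_norm_sq, inner_real, inner_real]
    change ((U * mat A * (U : Matrix (Fin n) (Fin n) ℝ)ᵀ) *
      (U * mat A * (U : Matrix (Fin n) (Fin n) ℝ)ᵀ)).trace = _
    have h' : ∀ M : Matrix (Fin n) (Fin n) ℝ, (U : Matrix (Fin n) (Fin n) ℝ)ᵀ * (U * M) = M :=
      fun M => by rw [← Matrix.mul_assoc, h, one_mul]
    rw [Matrix.mul_assoc, Matrix.mul_assoc, Matrix.trace_mul_comm]
    simp only [Matrix.mul_assoc, h', h, mul_one]

theorem mat_conjIsometry (U : Matrix.unitaryGroup (Fin n) ℝ) (A : SymmMat n ℝ) :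
    mat (conjIsometry U A) =
      (U : Matrix (Fin n) (Fin n) ℝ) * mat A * star (U : Matrix (Fin n) (Fin n) ℝ) := rfl

theorem conjIsometry_mem_posCone (U : Matrix.unitaryGroup (Fin n) ℝ) (A : SymmMat n ℝ) :
    conjIsometry U A ∈ posCone n ↔ A ∈ posCone n := by
  change (mat (conjIsometry U A)).PosDef ↔ (mat A).PosDef
  rw [mat_conjIsometry]
  exact Matrix.IsUnit.posDef_star_right_conjugate_iff (Unitary.isUnit_coe (U := U))

theorem det_conjIsometry (U : Matrix.unitaryGroup (Fin n) ℝ) (A : SymmMat n ℝ) :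
    (mat (conjIsometry U A)).det = (mat A).det := by
  have h : (U : Matrix (Fin n) (Fin n) ℝ) * star (U : Matrix (Fin n) (Fin n) ℝ) = 1 :=
    Unitary.coe_mul_star_self U
  rw [mat_conjIsometry, Matrix.det_mul_right_comm, h, one_mul]

theorem inner_conjIsometry_eigenvectorUnitary (ξ Y : SymmMat n ℝ) :
    inner ℝ ξ (conjIsometry ξ.isHermitian_mat.eigenvectorUnitary Y) =
      ∑ i, ξ.isHermitian_mat.eigenvalues i * mat Y i i := by
  rw [inner_real, mat_conjIsometry]
  have h := ξ.isHermitian_mat.spectral_theorem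
  rw [Unitary.conjStarAlgAut_apply] at h
  set U := ξ.isHermitian_mat.eigenvectorUnitary with hU
  have h1 : star (U : Matrix (Fin n) (Fin n) ℝ) * U = 1 := Unitary.coe_star_mul_self U
  have h' : ∀ M : Matrix (Fin n) (Fin n) ℝ, star (U : Matrix (Fin n) (Fin n) ℝ) * (U * M) = M :=
    fun M => by rw [← Matrix.mul_assoc, h1, one_mul]
  conv_lhs => rw [h]
  rw [Matrix.mul_assoc, Matrix.mul_assoc, Matrix.trace_mul_comm]
  simp only [Matrix.mul_assoc, h', h1, mul_one]
  simp [trace, diagonal_mul]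

/-- The gamma integral of the cone, as a function of `ξ`. -/
def coneIntegral (t : ℝ) (ξ : SymmMat n ℝ) : ℝ≥0∞ :=
  ∫⁻ Y in posCone n, ENNReal.ofReal (Real.exp (-inner ℝ ξ Y) * (mat Y).det ^ t)

/-- Conjugation by the orthogonal matrix of eigenvectors preserves Lebesgue measure, the cone and
the determinant, and diagonalizes `ξ`. No positivity of `ξ` enters, so the reduction also serves for
divergence off the cone. -/
theorem coneIntegral_eq_diag (t : ℝ) (ξ : SymmMat n ℝ) :
    coneIntegral t ξ = ∫⁻ Y, diagIntegrand ξ.isHermitian_mat.eigenvalues t Y := by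
  have hm : Measurable fun Y : SymmMat n ℝ => (posCone n).indicator
      (fun Y => ENNReal.ofReal (Real.exp (-inner ℝ ξ Y) * (mat Y).det ^ t)) Y := by
    refine Measurable.indicator ?_ isOpen_posCone.measurableSet
    have h1 : Measurable fun Y : SymmMat n ℝ => (mat Y).det := continuous_det_mat.measurable
    have h2 : Measurable fun Y : SymmMat n ℝ => inner ℝ ξ Y := by fun_prop
    fun_prop
  rw [coneIntegral, ← lintegral_indicator isOpen_posCone.measurableSet,
    ← (conjIsometry ξ.isHermitian_mat.eigenvectorUnitary).measurePreserving.lintegral_comp hm]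
  refine lintegral_congr fun Y => ?_
  rw [diagIntegrand]
  by_cases hY : Y ∈ posCone n
  · rw [Set.indicator_of_mem hY, Set.indicator_of_mem ((conjIsometry_mem_posCone _ _).2 hY),
      det_conjIsometry, inner_conjIsometry_eigenvectorUnitary]
  · rw [Set.indicator_of_notMem hY,
      Set.indicator_of_notMem (fun h => hY ((conjIsometry_mem_posCone _ _).1 h))]

theorem coneIntegral_of_mem {s : ℝ} (hs : ((n : ℝ) - 1) / 2 < s) {ξ : SymmMat n ℝ}
    (hξ : ξ ∈ posCone n) : coneIntegral (s - ((n : ℝ) + 1) / 2) ξ =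
      ENNReal.ofReal (multiGamma n s * (mat ξ).det ^ (-s)) := by
  rw [coneIntegral_eq_diag, lintegral_diagIntegrand n hs
    (fun i => Matrix.PosDef.eigenvalues_pos (A := mat ξ) hξ i),
    ξ.isHermitian_mat.det_eq_prod_eigenvalues]
  simp

theorem diagIntegrand_mono {d d' : Fin n → ℝ} (h : ∀ i, d i ≤ d' i) (t : ℝ) (Y : SymmMat n ℝ) :
    diagIntegrand d' t Y ≤ diagIntegrand d t Y := by
  rw [diagIntegrand, diagIntegrand]
  by_cases hY : Y ∈ posCone n
  · rw [Set.indicator_of_mem hY, Set.indicator_of_mem hY]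
    have h1 : ∀ i, 0 ≤ mat Y i i := fun i => (Matrix.PosDef.posSemidef hY).diag_nonneg
    have h2 := det_pos_of_mem hY
    gcongr
    · exact h1 _
    · exact h _
  · rw [Set.indicator_of_notMem hY, Set.indicator_of_notMem hY]

/-- Some eigenvalue is nonpositive. Raising all of them equally until the smallest is `ε > 0` can
only decrease the integral, whose value is then a negative power of the product of the new
eigenvalues. That product tends to `0` with `ε`, so the lower bounds tend to infinity. -/
theorem coneIntegral_of_notMem {s : ℝ} (hs : ((n : ℝ) - 1) / 2 < s) (hs0 : 0 < s)
    {ξ : SymmMat n ℝ} (hξ : ξ ∉ posCone n) : coneIntegral (s - ((n : ℝ) + 1) / 2) ξ = ∞ := by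
  rw [coneIntegral_eq_diag]
  set d := ξ.isHermitian_mat.eigenvalues with hd
  have hex : ∃ i, d i ≤ 0 := by
    by_contra! h
    exact hξ (ξ.isHermitian_mat.posDef_iff_eigenvalues_pos.2 h)
  obtain ⟨i₀, hi₀⟩ := hex
  have : Nonempty (Fin n) := ⟨i₀⟩
  obtain ⟨i, hi⟩ := Finite.exists_min d
  have hdi : d i ≤ 0 := (hi i₀).trans hi₀
  have hpos : ∀ ε : ℝ, 0 < ε → ∀ j, 0 < d j - d i + ε := fun ε hε j => by linarith [hi j]
  have hle : ∀ ε : ℝ, 0 < ε → ENNReal.ofReal (multiGamma n s * (∏ j, (d j - d i + ε)) ^ (-s)) ≤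
      ∫⁻ Y, diagIntegrand d (s - ((n : ℝ) + 1) / 2) Y := by
    intro ε hε
    rw [← lintegral_diagIntegrand n hs (hpos ε hε)]
    exact lintegral_mono fun Y => diagIntegrand_mono (fun j => by linarith) _ _
  have hprod : Filter.Tendsto (fun ε : ℝ => ∏ j, (d j - d i + ε)) (nhdsWithin 0 (Set.Ioi 0))
      (nhdsWithin 0 (Set.Ioi 0)) := by
    rw [tendsto_nhdsWithin_iff]
    constructor
    · have hc : Continuous fun ε : ℝ => ∏ j, (d j - d i + ε) := by fun_prop
      have h0 : ∏ j, (d j - d i + 0) = 0 :=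
        Finset.prod_eq_zero (Finset.mem_univ i) (by ring)
      have := hc.tendsto 0
      rw [h0] at this
      exact this.mono_left nhdsWithin_le_nhds
    · filter_upwards [self_mem_nhdsWithin] with ε hε
      exact Finset.prod_pos fun j _ => hpos ε hε j
  have htop : Filter.Tendsto (fun ε : ℝ => ENNReal.ofReal
      (multiGamma n s * (∏ j, (d j - d i + ε)) ^ (-s))) (nhdsWithin 0 (Set.Ioi 0)) (nhds ∞) :=
    ENNReal.tendsto_ofReal_atTop.comp (((tendsto_rpow_neg_nhdsGT_zero (neg_lt_zero.2 hs0)).comp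
      hprod).const_mul_atTop (multiGamma_pos n hs))
  refine top_le_iff.1 (le_of_tendsto htop ?_)
  filter_upwards [self_mem_nhdsWithin] with ε hε using hle ε hε

end SymmMat

end ConeGamma

/-! ### The inverse Fourier transform on `L¹ ∩ L²`. -/

section FourierInversion

open scoped FourierTransform RealInnerProductSpace ContDiff

variable {V : Type*} [NormedAddCommGroup V] [InnerProductSpace ℝ V] [FiniteDimensional ℝ V]
  [MeasurableSpace V] [BorelSpace V]

/-- Both sides define the same tempered distribution: the `L²` transform by compatibility with the
distributional one, the integral by moving the transform onto the test function. Testing against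
smooth compactly supported functions gives equality almost everywhere. -/
theorem fourierTransformₗᵢ_symm_toLp {p : V → ℂ} (h1 : Integrable p) (h2 : MemLp p 2) :
    (Lp.fourierTransformₗᵢ V ℂ).symm (h2.toLp p) =ᵐ[volume] 𝓕⁻ p := by
  have hcont : Continuous (𝓕⁻ p) := VectorFourier.fourierIntegral_continuous
    Real.continuous_fourierChar (continuous_inner (𝕜 := ℝ) (E := V)).neg h1
  refine ae_eq_of_integral_contDiff_smul_eq
    ((Lp.memLp _).locallyIntegrable (by norm_num)) hcont.locallyIntegrable ?_
  intro g hg hgs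
  have hs : HasCompactSupport (fun x => (g x : ℂ)) := hgs.comp_left (g := Complex.ofReal) rfl
  have hd : ContDiff ℝ ∞ (fun x => (g x : ℂ)) := Complex.ofRealCLM.contDiff.comp hg
  set G : SchwartzMap V ℂ := hs.toSchwartzMap hd with hG
  have hGa : ∀ x, G x = (g x : ℂ) := fun x => rfl
  have key := DFunLike.congr_fun
    (Lp.fourierInv_toTemperedDistribution_eq (h2.toLp p)) G
  rw [TemperedDistribution.fourierInv_apply, Lp.toTemperedDistribution_apply,
    Lp.toTemperedDistribution_apply] at key
  have e1 : ∫ x, (𝓕⁻ G) x • (h2.toLp p) x = ∫ x, (𝓕⁻ G) x • p x :=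
    integral_congr_ae (by filter_upwards [h2.coeFn_toLp] with x hx; rw [hx])
  have e2 : ∫ x, (𝓕⁻ G) x • p x = ∫ x, G x • (𝓕⁻ p) x := by
    have := VectorFourier.integral_fourierIntegral_smul_eq_flip (μ := volume) (ν := volume)
      (L := -innerₗ V) Real.continuous_fourierChar (continuous_inner (𝕜 := ℝ) (E := V)).neg G.integrable h1
    have hflip : (-innerₗ V).flip = -innerₗ V := by
      ext x y
      simp [real_inner_comm]
    rw [hflip] at this
    rw [SchwartzMap.fourierInv_coe]
    exact this
  rw [e1, e2] at key
  simp only [hGa] at key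
  exact key.symm

variable (V) in
theorem dilation_symm_apply (r : ℝ) (hr : 0 < r) (g : Lp ℂ 2 (volume : Measure V)) :
    (dilation V r hr).symm g = dilationIsometry V r⁻¹ (inv_pos.2 hr) g :=
  (LinearIsometryEquiv.symm_apply_eq _).2 (dilationIsometry_inv r hr g).symm

/-- Undoing the dilation replaces `p` by `r^(d/2) p(r ·)` with `r = 2π`. The substitution `ξ = r v`
then absorbs the `2π` of the exponent, and its Jacobian `r^(-d)` leaves the factor `r^(-d/2)`. -/
theorem unitaryFourier_symm_toLp {p : V → ℂ} (h1 : Integrable p) (h2 : MemLp p 2) :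
    (unitaryFourier V).symm (h2.toLp p) =ᵐ[volume] fun x =>
      (((2 * Real.pi) ^ (-((Module.finrank ℝ V : ℝ) / 2)) : ℝ) : ℂ) *
        ∫ ξ, p ξ * Complex.exp (Complex.I * (inner ℝ x ξ : ℝ)) := by
  have hpi : 0 < 2 * Real.pi := by positivity
  set r : ℝ := ((2 * Real.pi)⁻¹)⁻¹ with hr
  have hr' : r = 2 * Real.pi := inv_inv _
  have hr0 : 0 < r := by rw [hr']; positivity
  set q : V → ℂ := fun x => ((r ^ ((Module.finrank ℝ V : ℝ) / 2) : ℝ) : ℂ) • p (r • x) with hq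
  have hq2 : MemLp q 2 := memLp_comp_smul hr0 h2
  have hq1 : Integrable q := (h1.comp_smul hr0.ne').smul (((r ^ ((Module.finrank ℝ V : ℝ) / 2) : ℝ) : ℂ))
  have e1 : (unitaryFourier V).symm (h2.toLp p) =
      (Lp.fourierTransformₗᵢ V ℂ).symm (hq2.toLp q) := by
    change (Lp.fourierTransformₗᵢ V ℂ).symm ((dilation V _ _).symm (h2.toLp p)) = _
    rw [dilation_symm_apply]
    congr 1
    apply Lp.ext
    filter_upwards [dilationIsometry_coe r (by positivity) (h2.toLp p), hq2.coeFn_toLp,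
      (quasiMeasurePreserving_smul V hr0.ne').ae h2.coeFn_toLp] with x ha hb hc
    rw [ha, hb, hq, hc]
  rw [e1]
  refine (fourierTransformₗᵢ_symm_toLp hq1 hq2).trans (Filter.Eventually.of_forall fun x => ?_)
  rw [Real.fourierInv_eq']
  have e2 : (fun v : V => Complex.exp (↑(2 * Real.pi * inner ℝ v x) * Complex.I) • q v) =
      fun v => (fun ξ => ((r ^ ((Module.finrank ℝ V : ℝ) / 2) : ℝ) : ℂ) *
        (p ξ * Complex.exp (Complex.I * (inner ℝ x ξ : ℝ)))) (r • v) := by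
    funext v
    simp only [hq, smul_eq_mul]
    rw [inner_smul_right, real_inner_comm, hr', mul_comm Complex.I]
    ring
  rw [e2]
  refine (Measure.integral_comp_smul volume (fun ξ => ((r ^ ((Module.finrank ℝ V : ℝ) / 2) : ℝ) : ℂ) *
    (p ξ * Complex.exp (Complex.I * (inner ℝ x ξ : ℝ)))) r).trans ?_
  rw [integral_const_mul, abs_of_pos (by positivity),
    Complex.real_smul, ← mul_assoc, ← Complex.ofReal_mul]
  congr 2
  rw [← Real.rpow_natCast, ← Real.rpow_neg hr0.le, ← Real.rpow_add hr0, hr']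
  congr 1
  ring

end FourierInversion

/-! ### The operator `T ⊗ I` acts fibrewise. -/

section Fibres

theorem Lp.enorm_sq_eq_lintegral {α : Type*} [MeasurableSpace α] {μ : Measure α} (u : Lp ℂ 2 μ) :
    ‖u‖ₑ ^ 2 = ∫⁻ x, ‖u x‖ₑ ^ 2 ∂μ := by
  have := eLpNorm_nnreal_pow_eq_lintegral (f := u) (μ := μ) (p := (2 : NNReal)) (by norm_num)
  rw [Lp.enorm_def]
  simpa using this

variable {α β : Type*} [MeasurableSpace α] [MeasurableSpace β]
  (μ : Measure α) (ν : Measure β) [SigmaFinite μ] [SigmaFinite ν]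

variable {μ ν} in
theorem ae_ae_swap_of_ae_prod {p : α × β → Prop} (h : ∀ᵐ z ∂(μ.prod ν), p z) :
    ∀ᵐ y ∂ν, ∀ᵐ x ∂μ, p (x, y) :=
  Measure.ae_ae_of_ae_prod
    ((Measure.measurePreserving_swap (μ := ν) (ν := μ)).quasiMeasurePreserving.ae h)

variable {μ ν} in
theorem ae_memLp_fibre {g : α × β → ℂ} (hg : MemLp g 2 (μ.prod ν)) :
    ∀ᵐ y ∂ν, MemLp (fun x => g (x, y)) 2 μ := by
  have h1 := (memLp_two_iff_integrable_sq_norm hg.1).1 hg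
  have h2 := h1.prod_left_ae
  have h3 : ∀ᵐ y ∂ν, AEStronglyMeasurable (fun x => g (x, y)) μ :=
    hg.1.prod_swap.prodMk_left
  filter_upwards [h2, h3] with y h2 h3
  exact (memLp_two_iff_integrable_sq_norm h3).2 h2

theorem lintegral_fibre_enorm_sq (u : Lp ℂ 2 (μ.prod ν)) :
    ∫⁻ y, ∫⁻ x, ‖u (x, y)‖ₑ ^ 2 ∂μ ∂ν = ‖u‖ₑ ^ 2 := by
  rw [Lp.enorm_sq_eq_lintegral, lintegral_prod_symm]
  exact (Lp.aestronglyMeasurable u).enorm.pow_const 2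

/-- `T ⊗ I` acts as `T` on the fibre over `y` of `g`. -/
def ActsOnFibre (T : Lp ℂ 2 μ ≃ₗᵢ[ℂ] Lp ℂ 2 μ) (g : Lp ℂ 2 (μ.prod ν)) (y : β) : Prop :=
  ∃ φ : Lp ℂ 2 μ, (fun x => g (x, y)) =ᵐ[μ] φ ∧
    (fun x => L2.tensorId μ ν T g (x, y)) =ᵐ[μ] T φ

theorem L2.tensorId_tensorEmbedding (T : Lp ℂ 2 μ ≃ₗᵢ[ℂ] Lp ℂ 2 μ)
    (x : Lp ℂ 2 μ ⊗[ℂ] Lp ℂ 2 ν) :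
    L2.tensorId μ ν T (L2.tensorEmbedding μ ν x) =
      L2.tensorEmbedding μ ν (T.rTensor (Lp ℂ 2 ν) x) := by
  apply LinearMap.extendOfNorm_eq
  · exact L2.denseRange_tensorEmbedding μ ν
  · refine ⟨1, fun y => ?_⟩
    rw [one_mul]
    exact (((L2.tensorEmbedding μ ν).norm_map _).trans
      (((T.rTensor (Lp ℂ 2 ν)).norm_map y).trans ((L2.tensorEmbedding μ ν).norm_map y).symm)).le

theorem actsOnFibre_tensorEmbedding (T : Lp ℂ 2 μ ≃ₗᵢ[ℂ] Lp ℂ 2 μ)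
    (z : Lp ℂ 2 μ ⊗[ℂ] Lp ℂ 2 ν) :
    ∀ᵐ y ∂ν, ActsOnFibre μ ν T (L2.tensorEmbedding μ ν z) y := by
  induction z using TensorProduct.induction_on with
  | zero =>
    have h0 := ae_ae_swap_of_ae_prod (Lp.coeFn_zero ℂ 2 (μ.prod ν))
    filter_upwards [h0] with y hy
    refine ⟨0, ?_, ?_⟩
    · rw [map_zero]
      filter_upwards [hy, Lp.coeFn_zero ℂ 2 μ] with x h1 h2
      rw [h1, h2]; rfl
    · rw [map_zero, map_zero, map_zero]
      filter_upwards [hy, Lp.coeFn_zero ℂ 2 μ] with x h1 h2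
      rw [h1, h2]; rfl
  | tmul f u =>
    have h1 := ae_ae_swap_of_ae_prod (L2.prodMul_coe μ ν f u)
    have h2 := ae_ae_swap_of_ae_prod (L2.prodMul_coe μ ν (T f) u)
    filter_upwards [h1, h2] with y h1 h2
    refine ⟨u y • f, ?_, ?_⟩
    · rw [L2.tensorEmbedding_tmul]
      filter_upwards [h1, Lp.coeFn_smul (u y) f] with x h3 h4
      rw [h3, h4, Pi.smul_apply, smul_eq_mul, mul_comm]
    · rw [L2.tensorId_tensorEmbedding, map_smul]
      change (fun x => L2.prodMul μ ν (T f) u (x, y)) =ᵐ[μ] _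
      filter_upwards [h2, Lp.coeFn_smul (u y) (T f)] with x h3 h4
      rw [h3, h4, Pi.smul_apply, smul_eq_mul, mul_comm]
  | add a b ha hb =>
    have h1 := ae_ae_swap_of_ae_prod (Lp.coeFn_add (L2.tensorEmbedding μ ν a)
      (L2.tensorEmbedding μ ν b))
    have h2 := ae_ae_swap_of_ae_prod (Lp.coeFn_add
      (L2.tensorId μ ν T (L2.tensorEmbedding μ ν a))
      (L2.tensorId μ ν T (L2.tensorEmbedding μ ν b)))
    filter_upwards [ha, hb, h1, h2] with y ⟨φ, hφ, hφ'⟩ ⟨ψ, hψ, hψ'⟩ h1 h2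
    refine ⟨φ + ψ, ?_, ?_⟩
    · rw [map_add]
      filter_upwards [h1, hφ, hψ, Lp.coeFn_add φ ψ] with x a1 a2 a3 a4
      rw [a1, a4, Pi.add_apply, Pi.add_apply, a2, a3]
    · rw [map_add, map_add, map_add]
      filter_upwards [h2, hφ', hψ', Lp.coeFn_add (T φ) (T ψ)] with x a1 a2 a3 a4
      rw [a1, a4, Pi.add_apply, Pi.add_apply, a2, a3]

omit [SigmaFinite μ] [SigmaFinite ν] in
theorem enorm_sub_sq_eq_of_fibre {g e : Lp ℂ 2 (μ.prod ν)} {y : β} {φ ψ : Lp ℂ 2 μ}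
    (h : ∀ᵐ x ∂μ, (g - e) (x, y) = g (x, y) - e (x, y))
    (hφ : (fun x => g (x, y)) =ᵐ[μ] φ) (hψ : (fun x => e (x, y)) =ᵐ[μ] ψ) :
    ‖φ - ψ‖ₑ ^ 2 = ∫⁻ x, ‖(g - e) (x, y)‖ₑ ^ 2 ∂μ := by
  rw [Lp.enorm_sq_eq_lintegral]
  refine lintegral_congr_ae ?_
  filter_upwards [h, hφ, hψ, Lp.coeFn_sub φ ψ] with x a1 a2 a3 a4
  rw [a1, a4, Pi.sub_apply, a2, a3]

/-- The assertion is clear for algebraic tensors, and these are dense. Approximate `g` by tensors `e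
k`: the fibrewise squared errors, before and after applying `T ⊗ I`, have integrals tending to `0`.
Almost every fibre therefore has errors with infimum `0`, and on it the isometry `T` identifies the
two limits. -/
theorem actsOnFibre_ae (T : Lp ℂ 2 μ ≃ₗᵢ[ℂ] Lp ℂ 2 μ) (g : Lp ℂ 2 (μ.prod ν)) :
    ∀ᵐ y ∂ν, ActsOnFibre μ ν T g y := by
  have hd : ∀ k : ℕ, ∃ z, ‖g - L2.tensorEmbedding μ ν z‖ < 1 / ((k : ℝ) + 1) := fun k => by
    obtain ⟨z, hz⟩ := (L2.denseRange_tensorEmbedding μ ν).exists_dist_lt g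
      (show (0 : ℝ) < 1 / ((k : ℝ) + 1) by positivity)
    exact ⟨z, by rw [← dist_eq_norm]; exact hz⟩
  choose z hz using hd
  set S := L2.tensorId μ ν T
  set e : ℕ → Lp ℂ 2 (μ.prod ν) := fun k => L2.tensorEmbedding μ ν (z k) with he
  set m : ℕ → β → ℝ≥0∞ := fun k y =>
    (∫⁻ x, ‖(S g - S (e k)) (x, y)‖ₑ ^ 2 ∂μ) + ∫⁻ x, ‖(g - e k) (x, y)‖ₑ ^ 2 ∂μ with hm
  have hmeas : ∀ u : Lp ℂ 2 (μ.prod ν), AEMeasurable (fun y => ∫⁻ x, ‖u (x, y)‖ₑ ^ 2 ∂μ) ν :=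
    fun u => ((Lp.aestronglyMeasurable u).enorm.pow_const 2).lintegral_prod_left'
  have hmm : ∀ k, AEMeasurable (m k) ν := fun k => (hmeas _).add (hmeas _)
  have hint : ∀ k, ∫⁻ y, m k y ∂ν ≤ ENNReal.ofReal (2 * (1 / ((k : ℝ) + 1)) ^ 2) := by
    intro k
    rw [hm, lintegral_add_left' (hmeas _), lintegral_fibre_enorm_sq, lintegral_fibre_enorm_sq,
      ← map_sub, S.enorm_map, ← two_mul, ENNReal.ofReal_mul (by norm_num),
      ENNReal.ofReal_pow (by positivity), ENNReal.ofReal_ofNat]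
    gcongr
    rw [← ofReal_norm]
    exact ENNReal.ofReal_le_ofReal (hz k).le
  -- The infimum over `k` replaces the choice of an almost everywhere convergent subsequence.
  have hzero : ∫⁻ y, ⨅ k, m k y ∂ν = 0 := by
    refine le_antisymm ?_ zero_le
    have hlim : Filter.Tendsto (fun k : ℕ => ENNReal.ofReal (2 * (1 / ((k : ℝ) + 1)) ^ 2))
        Filter.atTop (nhds 0) := by
      have := ENNReal.tendsto_ofReal
        ((tendsto_one_div_add_atTop_nhds_zero_nat (𝕜 := ℝ)).pow 2 |>.const_mul 2)
      simpa using this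
    refine ge_of_tendsto' hlim fun k => ?_
    exact (lintegral_mono fun y => iInf_le _ k).trans (hint k)
  have hae := (lintegral_eq_zero_iff' (AEMeasurable.iInf hmm)).1 hzero
  have hsub1 : ∀ᵐ y ∂ν, ∀ k, ∀ᵐ x ∂μ, (S g - S (e k)) (x, y) = S g (x, y) - S (e k) (x, y) :=
    ae_all_iff.2 fun k => ae_ae_swap_of_ae_prod (Lp.coeFn_sub (S g) (S (e k)))
  have hsub2 : ∀ᵐ y ∂ν, ∀ k, ∀ᵐ x ∂μ, (g - e k) (x, y) = g (x, y) - e k (x, y) :=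
    ae_all_iff.2 fun k => ae_ae_swap_of_ae_prod (Lp.coeFn_sub g (e k))
  have hten : ∀ᵐ y ∂ν, ∀ k, ActsOnFibre μ ν T (e k) y :=
    ae_all_iff.2 fun k => actsOnFibre_tensorEmbedding μ ν T (z k)
  filter_upwards [hae, hsub1, hsub2, hten, ae_memLp_fibre (Lp.memLp g),
    ae_memLp_fibre (Lp.memLp (S g))] with y h0 h1 h2 h3 h4 h5
  set φ := h4.toLp (fun x => g (x, y))
  set Γ := h5.toLp (fun x => S g (x, y))
  have hφ : (fun x => g (x, y)) =ᵐ[μ] φ := h4.coeFn_toLp.symm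
  have hΓ : (fun x => S g (x, y)) =ᵐ[μ] Γ := h5.coeFn_toLp.symm
  refine ⟨φ, hφ, ?_⟩
  suffices h : Γ = T φ by rw [← h]; exact hΓ
  have hbound : ∀ k, ‖Γ - T φ‖ₑ ^ 2 ≤ 2 * m k y := by
    intro k
    obtain ⟨ψ, hψ1, hψ2⟩ := h3 k
    have e1 := enorm_sub_sq_eq_of_fibre μ ν (h1 k) hΓ hψ2
    have e2 := enorm_sub_sq_eq_of_fibre μ ν (h2 k) hφ hψ1
    have e3 : ‖Γ - T φ‖ₑ ≤ ‖Γ - T ψ‖ₑ + ‖φ - ψ‖ₑ := by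
      have : Γ - T φ = (Γ - T ψ) + T (ψ - φ) := by rw [map_sub]; abel
      rw [this, ← enorm_neg (φ - ψ), neg_sub, ← T.enorm_map (ψ - φ)]
      exact enorm_add_le _ _
    calc ‖Γ - T φ‖ₑ ^ 2 ≤ (‖Γ - T ψ‖ₑ + ‖φ - ψ‖ₑ) ^ 2 := by gcongr
      _ ≤ 2 * (‖Γ - T ψ‖ₑ ^ 2 + ‖φ - ψ‖ₑ ^ 2) := by
        have := ENNReal.rpow_add_le_mul_rpow_add_rpow ‖Γ - T ψ‖ₑ ‖φ - ψ‖ₑ (p := 2) (by norm_num)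
        norm_num at this
        exact this
      _ = 2 * m k y := by rw [e1, e2]
  have h6 : ‖Γ - T φ‖ₑ ^ 2 ≤ 0 := by
    have h7 : ‖Γ - T φ‖ₑ ^ 2 / 2 ≤ ⨅ k, m k y := le_iInf fun k => by
      rw [ENNReal.div_le_iff (by norm_num) (by norm_num), mul_comm]
      exact hbound k
    have h0' : ⨅ k, m k y = 0 := h0
    rw [h0', ENNReal.div_le_iff (by norm_num) (by norm_num), zero_mul] at h7
    exact h7
  have h8 : ‖Γ - T φ‖ₑ = 0 := by simpa using h6
  exact sub_eq_zero.1 (by simpa using h8)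

end Fibres

/-! ### The sub-mean value inequality for holomorphic functions of several variables. -/

section SubMeanValue

variable {E : Type*} [NormedAddCommGroup E] [NormedSpace ℂ E] [FiniteDimensional ℂ E]
  [MeasurableSpace E] [BorelSpace E] (μ : Measure E) [μ.IsAddHaarMeasure]

/-- The image of a Haar measure under this automorphism is again Haar, hence a multiple of `μ`; the
factor is `1` because the unit ball is mapped to itself. -/
theorem measurePreserving_smul_of_norm_eq_one {u : ℂ} (hu : ‖u‖ = 1) :
    MeasurePreserving (fun w : E => u • w) μ μ := by
  have : FiniteDimensional ℝ E := FiniteDimensional.complexToReal E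
  have : ProperSpace E := FiniteDimensional.proper ℝ E
  have hu0 : u ≠ 0 := by rintro rfl; simp at hu
  have hmeas : Measurable fun w : E => u • w := measurable_const_smul u
  refine ⟨hmeas, ?_⟩
  let e : E ≃+ E :=
    { toFun := fun w => u • w
      invFun := fun w => u⁻¹ • w
      left_inv := fun w => by simp [hu0]
      right_inv := fun w => by simp [hu0]
      map_add' := fun a b => smul_add u a b }
  have hH : (Measure.map e μ).IsAddHaarMeasure :=
    e.isAddHaarMeasure_map μ (continuous_const_smul u) (continuous_const_smul u⁻¹)
  have hH' : (Measure.map (fun w : E => u • w) μ).IsAddHaarMeasure := hH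
  have h1 := Measure.isAddLeftInvariant_eq_smul (Measure.map (fun w : E => u • w) μ) μ
  set c := Measure.addHaarScalarFactor (Measure.map (fun w : E => u • w) μ) μ
  have hpre : (fun w : E => u • w) ⁻¹' Metric.ball 0 1 = Metric.ball 0 1 := by
    ext w
    simp [norm_smul, hu]
  have h2 : Measure.map (fun w : E => u • w) μ (Metric.ball 0 1) = μ (Metric.ball 0 1) := by
    rw [Measure.map_apply hmeas measurableSet_ball, hpre]
  rw [h1] at h2 ⊢
  have h3 : μ (Metric.ball (0 : E) 1) ≠ 0 := (Metric.measure_ball_pos μ 0 one_pos).ne'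
  have h4 : μ (Metric.ball (0 : E) 1) ≠ ∞ := measure_ball_lt_top.ne
  have h5 : (c : ℝ≥0∞) = 1 := by
    rw [Measure.smul_apply] at h2
    have : (c : ℝ≥0∞) * μ (Metric.ball 0 1) = 1 * μ (Metric.ball 0 1) := by
      rw [one_mul]; exact h2
    exact (ENNReal.mul_left_inj h3 h4).1 this
  have h6 : c = 1 := by exact_mod_cast h5
  rw [h6, one_smul]

theorem enorm_mul_le_lintegral_circle {f : ℂ → ℂ} (hf : DiffContOnCl ℂ f (Metric.ball 0 1)) :
    ‖f 0‖ₑ * ENNReal.ofReal (2 * Real.pi) ≤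
      ∫⁻ θ in Set.Ioc 0 (2 * Real.pi), ‖f (circleMap 0 1 θ)‖ₑ := by
  have hpi : 0 < 2 * Real.pi := by positivity
  have h := DiffContOnCl.circleAverage (f := f) (c := 0) (R := 1) (by simpa using hf)
  rw [Real.circleAverage, intervalIntegral.integral_of_le hpi.le] at h
  rw [← h, enorm_smul, mul_comm, ← mul_assoc]
  have h2 : ENNReal.ofReal (2 * Real.pi) * ‖(2 * Real.pi)⁻¹‖ₑ = 1 := by
    rw [Real.enorm_of_nonneg (by positivity), ← ENNReal.ofReal_mul hpi.le,
      mul_inv_cancel₀ hpi.ne', ENNReal.ofReal_one]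
  rw [h2, one_mul]
  exact enorm_integral_le_lintegral_enorm _

/-- For each `w` in the ball, apply the one-variable mean value property to `ζ ↦ F (z + ζ • w)` on
the unit disc. Integrating over `w` and exchanging integrals, the rotations `w ↦ e^(iθ) w` preserve
the ball and the measure, so the angular integral only contributes a factor `2π`. Balls of an
arbitrary norm are thus covered. -/
theorem enorm_mul_measure_closedBall_le {F : E → ℂ} {U : Set E} (hF : DifferentiableOn ℂ F U)
    {z : E} {r : ℝ} (hU : Metric.closedBall z r ⊆ U) :
    ‖F z‖ₑ * μ (Metric.closedBall 0 r) ≤ ∫⁻ w in Metric.closedBall 0 r, ‖F (z + w)‖ₑ ∂μ := by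
  have : FiniteDimensional ℝ E := FiniteDimensional.complexToReal E
  have : ProperSpace E := FiniteDimensional.proper ℝ E
  have hpi : 0 < 2 * Real.pi := by positivity
  set B : Set E := Metric.closedBall 0 r with hB
  have hBm : MeasurableSet B := measurableSet_closedBall
  have hmaps : ∀ (ζ : ℂ) (w : E), ‖ζ‖ ≤ 1 → w ∈ B → z + ζ • w ∈ U := by
    intro ζ w hζ hw
    apply hU
    rw [hB, mem_closedBall_zero_iff] at hw
    rw [Metric.mem_closedBall, dist_eq_norm, add_sub_cancel_left, norm_smul]
    exact (mul_le_of_le_one_left (norm_nonneg _) hζ).trans hw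
  have hcirc : ∀ w ∈ B, ‖F z‖ₑ * ENNReal.ofReal (2 * Real.pi) ≤
      ∫⁻ θ in Set.Ioc 0 (2 * Real.pi), ‖F (z + circleMap 0 1 θ • w)‖ₑ := by
    intro w hw
    have hd : DifferentiableOn ℂ (fun ζ : ℂ => F (z + ζ • w)) (Metric.closedBall 0 1) := by
      refine hF.comp (by fun_prop) fun ζ hζ => hmaps ζ w (by simpa using hζ) hw
    have := enorm_mul_le_lintegral_circle
      (f := fun ζ : ℂ => F (z + ζ • w)) (hd.diffContOnCl_ball subset_rfl)
    simpa using this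
  have hcont : ContinuousOn (fun q : E × ℝ => F (z + circleMap 0 1 q.2 • q.1))
      (B ×ˢ Set.Ioc 0 (2 * Real.pi)) := by
    refine hF.continuousOn.comp ?_ fun q hq => hmaps _ _ (by simp) hq.1
    have : Continuous fun q : E × ℝ => z + circleMap 0 1 q.2 • q.1 := by
      have := continuous_circleMap 0 1
      fun_prop
    exact this.continuousOn
  have hae : AEMeasurable (fun q : E × ℝ => ‖F (z + circleMap 0 1 q.2 • q.1)‖ₑ)
      ((μ.restrict B).prod (volume.restrict (Set.Ioc 0 (2 * Real.pi)))) := by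
    rw [Measure.prod_restrict]
    exact (hcont.aestronglyMeasurable (hBm.prod measurableSet_Ioc)).enorm
  have hrot : ∀ θ : ℝ, ∫⁻ w in B, ‖F (z + circleMap 0 1 θ • w)‖ₑ ∂μ =
      ∫⁻ w in B, ‖F (z + w)‖ₑ ∂μ := by
    intro θ
    have hn : ‖circleMap 0 1 θ‖ = 1 := by simp
    have hne : circleMap 0 1 θ ≠ 0 := by
      intro h; rw [h] at hn; simp at hn
    have hpre : (fun w : E => circleMap 0 1 θ • w) ⁻¹' B = B := by
      ext w
      simp [hB, norm_smul]
    have hemb : MeasurableEmbedding (fun w : E => circleMap 0 1 θ • w) :=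
      (Homeomorph.smulOfNeZero _ hne).measurableEmbedding
    have := (measurePreserving_smul_of_norm_eq_one μ hn).setLIntegral_comp_preimage_emb hemb
      (fun w => ‖F (z + w)‖ₑ) B
    rw [hpre] at this
    exact this
  have hmain : (‖F z‖ₑ * μ B) * ENNReal.ofReal (2 * Real.pi) ≤
      (∫⁻ w in B, ‖F (z + w)‖ₑ ∂μ) * ENNReal.ofReal (2 * Real.pi) := by
    calc (‖F z‖ₑ * μ B) * ENNReal.ofReal (2 * Real.pi)
        = ∫⁻ _ in B, ‖F z‖ₑ * ENNReal.ofReal (2 * Real.pi) ∂μ := by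
          rw [setLIntegral_const]; ring
      _ ≤ ∫⁻ w in B, (∫⁻ θ in Set.Ioc 0 (2 * Real.pi), ‖F (z + circleMap 0 1 θ • w)‖ₑ) ∂μ :=
          setLIntegral_mono' hBm hcirc
      _ = ∫⁻ θ in Set.Ioc 0 (2 * Real.pi), ∫⁻ w in B, ‖F (z + circleMap 0 1 θ • w)‖ₑ ∂μ :=
          lintegral_lintegral_swap hae
      _ = _ := by
          simp only [hrot]
          rw [setLIntegral_const, Real.volume_Ioc, sub_zero]
  exact (ENNReal.mul_le_mul_iff_left (by positivity) ENNReal.ofReal_ne_top).1 hmain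

/-- The square of a holomorphic function is holomorphic. -/
theorem enorm_sq_mul_measure_closedBall_le {F : E → ℂ} {U : Set E} (hF : DifferentiableOn ℂ F U)
    {z : E} {r : ℝ} (hU : Metric.closedBall z r ⊆ U) :
    ‖F z‖ₑ ^ 2 * μ (Metric.closedBall 0 r) ≤
      ∫⁻ w in Metric.closedBall 0 r, ‖F (z + w)‖ₑ ^ 2 ∂μ := by
  have := enorm_mul_measure_closedBall_le μ (hF.pow 2) hU
  simpa [enorm_pow] using this

end SubMeanValue

/-! ### The pairing `tr(ξZ)` and holomorphy of Laplace transforms. -/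

section LaplacePairing

open SymmMat

namespace SymmMat

variable {n : ℕ}

theorem inner_ofReal (ξ : SymmMat n ℝ) (Z : SymmMat n ℂ) :
    inner ℂ (ofReal ξ) Z = (mat (ofReal ξ) * mat Z).trace := by
  change ((mat (ofReal ξ)).conjTranspose * mat Z).trace = _
  congr 2
  ext i j
  rw [Matrix.conjTranspose_apply, mat_ofReal, Matrix.map_apply, Matrix.map_apply,
    ξ.isSymm_mat.apply]
  exact Complex.conj_ofReal _

theorem inner_ofReal_ofReal (ξ X : SymmMat n ℝ) :
    inner ℂ (ofReal ξ) (ofReal X) = ((inner ℝ ξ X : ℝ) : ℂ) := by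
  rw [inner_ofReal, inner_real, mat_ofReal, mat_ofReal, Matrix.trace, Matrix.trace]
  simp [Matrix.mul_apply]

theorem norm_ofReal (ξ : SymmMat n ℝ) : ‖ofReal ξ‖ = ‖ξ‖ := by
  rw [← sq_eq_sq₀ (norm_nonneg _) (norm_nonneg _), ← real_inner_self_eq_norm_sq ξ]
  have h := inner_self_eq_norm_sq (𝕜 := ℂ) (ofReal ξ)
  rw [inner_ofReal_ofReal] at h
  exact h.symm

theorem inner_ofReal_complexEquiv (ξ : SymmMat n ℝ) (p : SymmMat n ℝ × SymmMat n ℝ) :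
    inner ℂ (ofReal ξ) (complexEquiv n p) =
      ((inner ℝ ξ p.1 : ℝ) : ℂ) + Complex.I * ((inner ℝ ξ p.2 : ℝ) : ℂ) := by
  rw [complexEquiv_apply, inner_add_right, inner_smul_right, inner_ofReal_ofReal,
    inner_ofReal_ofReal]

/-- This gives `|e^(i tr(ξZ))| = e^(-tr(ξ Im Z))`, so all convergence questions depend on `Im Z`
only. -/
theorem re_I_mul_inner_ofReal (ξ : SymmMat n ℝ) (Z : SymmMat n ℂ) :
    (Complex.I * inner ℂ (ofReal ξ) Z).re = -inner ℝ ξ (im Z) := by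
  obtain ⟨p, rfl⟩ := (complexEquiv n).surjective Z
  rw [inner_ofReal_complexEquiv, im_complexEquiv]
  simp

theorem continuous_ofReal : Continuous (ofReal : SymmMat n ℝ → SymmMat n ℂ) := by
  have : (ofReal : SymmMat n ℝ → SymmMat n ℂ) = fun X => complexEquiv n (X, 0) := by
    funext X
    rw [complexEquiv_apply]
    have : ofReal (0 : SymmMat n ℝ) = 0 := norm_eq_zero.1 (by rw [norm_ofReal, norm_zero])
    simp [this]
  rw [this]
  exact continuous_complexEquiv.comp (by fun_prop)

/-- Holomorphy of Laplace transforms `Z ↦ ∫ p(ξ) e^(i tr(ξZ)) dm(ξ)`. -/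
theorem differentiableOn_laplace {m : Measure (SymmMat n ℝ)} {p : SymmMat n ℝ → ℂ}
    (hp : AEStronglyMeasurable p m) {U : Set (SymmMat n ℂ)}
    (h : ∀ Z ∈ U, ∃ r > 0, Integrable (fun ξ =>
      ‖p ξ‖ * Real.exp (-inner ℝ ξ (im Z) + r * ‖ξ‖)) m) :
    DifferentiableOn ℂ (fun Z => ∫ ξ, p ξ *
      Complex.exp (Complex.I * inner ℂ (ofReal ξ) Z) ∂m) U := by
  intro Z₀ hZ₀
  obtain ⟨r, hr, hint⟩ := h Z₀ hZ₀
  have hcO := continuous_ofReal (n := n)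
  have hmeas : ∀ Z, AEStronglyMeasurable (fun ξ => p ξ *
      Complex.exp (Complex.I * inner ℂ (ofReal ξ) Z)) m := fun Z =>
    hp.mul (by fun_prop : Continuous fun ξ => Complex.exp
      (Complex.I * inner ℂ (ofReal ξ) Z)).aestronglyMeasurable
  have hnorm : ∀ (ξ : SymmMat n ℝ) (Z : SymmMat n ℂ), Z ∈ Metric.ball Z₀ (r / 2) →
      ‖Complex.exp (Complex.I * inner ℂ (ofReal ξ) Z)‖ ≤
        Real.exp (-inner ℝ ξ (im Z₀) + r / 2 * ‖ξ‖) := by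
    intro ξ Z hZ
    rw [Complex.norm_exp, Real.exp_le_exp, ← re_I_mul_inner_ofReal]
    have h1 : inner ℂ (ofReal ξ) Z = inner ℂ (ofReal ξ) Z₀ + inner ℂ (ofReal ξ) (Z - Z₀) := by
      rw [inner_sub_right]; ring
    rw [h1, mul_add, Complex.add_re]
    have h2 : (Complex.I * inner ℂ (ofReal ξ) (Z - Z₀)).re ≤ ‖ξ‖ * ‖Z - Z₀‖ := by
      refine (Complex.re_le_norm _).trans ?_
      rw [norm_mul, Complex.norm_I, one_mul, ← norm_ofReal]
      exact norm_inner_le_norm _ _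
    have h3 : ‖Z - Z₀‖ ≤ r / 2 := by
      rw [← dist_eq_norm]; exact (Metric.mem_ball.1 hZ).le
    nlinarith [norm_nonneg ξ]
  -- Differentiation under the integral on the ball of radius `r / 2`: half of the surplus
  -- `e^(r‖ξ‖)` pays for the displacement of `Z`, and the other half absorbs the factor `‖ξ‖` of the
  -- derivative through `‖ξ‖ ≤ (2/r) e^(r‖ξ‖/2)`.
  have hderiv := hasFDerivAt_integral_of_dominated_of_fderiv_le (μ := m) (𝕜 := ℂ)
    (F := fun Z ξ => p ξ * Complex.exp (Complex.I * inner ℂ (ofReal ξ) Z))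
    (F' := fun Z ξ => (p ξ * (Complex.exp (Complex.I * inner ℂ (ofReal ξ) Z) * Complex.I)) •
      innerSL ℂ (ofReal ξ)) (x₀ := Z₀) (s := Metric.ball Z₀ (r / 2))
    (bound := fun ξ => 2 / r * (‖p ξ‖ * Real.exp (-inner ℝ ξ (im Z₀) + r * ‖ξ‖)))
    (Metric.ball_mem_nhds _ (by positivity)) (Filter.Eventually.of_forall fun Z => hmeas Z)
    ?_ ?_ ?_ (hint.const_mul _) ?_
  · exact hderiv.differentiableAt.differentiableWithinAt
  · refine hint.mono (hmeas Z₀) (Filter.Eventually.of_forall fun ξ => ?_)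
    rw [norm_mul, norm_mul, norm_norm, Real.norm_of_nonneg (Real.exp_pos _).le]
    refine mul_le_mul_of_nonneg_left ((hnorm ξ Z₀ (Metric.mem_ball_self (by positivity))).trans ?_)
      (norm_nonneg _)
    rw [Real.exp_le_exp]
    nlinarith [norm_nonneg ξ]
  · exact (hp.mul (by fun_prop : Continuous fun ξ => Complex.exp
      (Complex.I * inner ℂ (ofReal ξ) Z₀) * Complex.I).aestronglyMeasurable).smul
      ((innerSL ℂ).continuous.comp hcO).aestronglyMeasurable
  · refine Filter.Eventually.of_forall fun ξ Z hZ => ?_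
    rw [norm_smul, norm_mul, norm_mul, Complex.norm_I, mul_one, innerSL_apply_norm, norm_ofReal]
    have h1 := hnorm ξ Z hZ
    have h2 : ‖ξ‖ ≤ 2 / r * Real.exp (r / 2 * ‖ξ‖) := by
      have := Real.add_one_le_exp (r / 2 * ‖ξ‖)
      rw [div_mul_eq_mul_div, le_div_iff₀ hr]
      linarith
    have h3 : -inner ℝ ξ (im Z₀) + r * ‖ξ‖ =
        (-inner ℝ ξ (im Z₀) + r / 2 * ‖ξ‖) + r / 2 * ‖ξ‖ := by ring
    rw [h3, Real.exp_add]
    calc ‖p ξ‖ * ‖Complex.exp (Complex.I * inner ℂ (ofReal ξ) Z)‖ * ‖ξ‖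
        ≤ ‖p ξ‖ * Real.exp (-inner ℝ ξ (im Z₀) + r / 2 * ‖ξ‖) *
          (2 / r * Real.exp (r / 2 * ‖ξ‖)) := by gcongr
      _ = _ := by ring
  · refine Filter.Eventually.of_forall fun ξ Z _ => ?_
    have h1 : HasFDerivAt (fun Z => inner ℂ (ofReal ξ) Z) (innerSL ℂ (ofReal ξ)) Z :=
      (innerSL ℂ (ofReal ξ)).hasFDerivAt
    have h2 := ((h1.const_mul Complex.I).cexp).const_mul (p ξ)
    refine h2.congr_fderiv ?_
    rw [smul_smul, smul_smul]
    congr 1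
    ring

end SymmMat

end LaplacePairing

/-! ### Locally uniform `L²` bounds on the slices `Im Z = Y`. -/

section TubeEstimates

open SymmMat

variable {n : ℕ}

instance isAddHaarMeasure_lebesgueC (n : ℕ) : (lebesgueC n).IsAddHaarMeasure :=
  (complexEquiv n).toContinuousLinearEquiv.isAddHaarMeasure_map _

theorem bergmanConst_pos {n : ℕ} {lam : ℝ} (hlam : (n : ℝ) < lam) : 0 < bergmanConst n lam := by
  have hn : (0 : ℝ) ≤ n := n.cast_nonneg
  have h1 := multiGamma_pos n (s := lam) (by linarith)
  have h2 := multiGamma_pos n (s := lam - ((n : ℝ) + 1) / 2) (by linarith)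
  rw [bergmanConst]
  positivity

theorem det_two_smul_mat (Y : SymmMat n ℝ) :
    ((2 : ℝ) • mat Y).det = 2 ^ n * (mat Y).det := by
  rw [Matrix.det_smul, Fintype.card_fin]

/-- The density is continuous and positive on the compact set `K`, hence bounded below there. Local
estimates can therefore ignore the weight. -/
theorem exists_smul_restrict_le_coneMeasure {lam : ℝ} (hlam : (n : ℝ) < lam)
    {K : Set (SymmMat n ℝ)} (hK : IsCompact K) (hKΩ : K ⊆ posCone n) :
    ∃ c : ℝ≥0∞, c ≠ 0 ∧ c • (volume : Measure (SymmMat n ℝ)).restrict K ≤ coneMeasure n lam := by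
  have hpos : ∀ Y ∈ K, 0 < bergmanConst n lam * ((2 : ℝ) • mat Y).det ^ (lam - n - 1) := by
    intro Y hY
    have h1 := bergmanConst_pos hlam
    have h2 := det_pos_of_mem (hKΩ hY)
    rw [det_two_smul_mat]
    positivity
  have hcont : ContinuousOn (fun Y : SymmMat n ℝ =>
      bergmanConst n lam * ((2 : ℝ) • mat Y).det ^ (lam - n - 1)) K := by
    refine continuousOn_const.mul (ContinuousOn.rpow_const ?_ ?_)
    · simp only [det_two_smul_mat]
      exact (continuous_det_mat.const_mul _).continuousOn
    · intro Y hY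
      have h2 := det_pos_of_mem (hKΩ hY)
      left
      rw [det_two_smul_mat]
      positivity
  obtain ⟨c, hc, hcK⟩ : ∃ c : ℝ, 0 < c ∧ ∀ Y ∈ K,
      c ≤ bergmanConst n lam * ((2 : ℝ) • mat Y).det ^ (lam - n - 1) := by
    rcases K.eq_empty_or_nonempty with rfl | hne
    · exact ⟨1, one_pos, by simp⟩
    · obtain ⟨Y, hY, hmin⟩ := hK.exists_isMinOn hne hcont
      exact ⟨_, hpos Y hY, fun Y' hY' => hmin hY'⟩
  refine ⟨ENNReal.ofReal c, by simpa using hc, Measure.le_iff.2 fun s hs => ?_⟩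
  rw [Measure.smul_apply, Measure.restrict_apply hs, coneMeasure, withDensity_apply _ hs,
    Measure.restrict_restrict hs, smul_eq_mul, ← setLIntegral_const]
  calc ∫⁻ _ in s ∩ K, ENNReal.ofReal c
      ≤ ∫⁻ Y in s ∩ K, ENNReal.ofReal
        (bergmanConst n lam * ((2 : ℝ) • mat Y).det ^ (lam - n - 1)) :=
        setLIntegral_mono' (hs.inter hK.measurableSet) fun Y hY =>
          ENNReal.ofReal_le_ofReal (hcK Y hY.2)
    _ ≤ _ := lintegral_mono_set (Set.inter_subset_inter_right s hKΩ)

/-- The integral of `‖F‖ ^ q` over the slice `Im Z = Y`. -/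
def sliceLIntegral (q : ℕ) (F : SymmMat n ℂ → ℂ) (Y : SymmMat n ℝ) : ℝ≥0∞ :=
  ∫⁻ X, ‖F (complexEquiv n (X, Y))‖ₑ ^ q

theorem aestronglyMeasurable_tube {F : SymmMat n ℂ → ℂ} {S : Set (SymmMat n ℝ)}
    (hF : ContinuousOn F (siegelDomain n)) (hS : MeasurableSet S) (hSΩ : S ⊆ posCone n) :
    AEStronglyMeasurable (fun p => F (complexEquiv n p))
      ((volume : Measure (SymmMat n ℝ)).prod (volume.restrict S)) := by
  rw [← Measure.restrict_univ (μ := (volume : Measure (SymmMat n ℝ))), Measure.prod_restrict]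
  exact (hF.comp continuous_complexEquiv.continuousOn fun p hp =>
    complexEquiv_mem_siegelDomain.2 (hSΩ hp.2)).aestronglyMeasurable (MeasurableSet.univ.prod hS)

theorem aestronglyMeasurable_tubeMeasure {lam : ℝ} {F : SymmMat n ℂ → ℂ}
    (hF : ContinuousOn F (siegelDomain n)) :
    AEStronglyMeasurable (fun p => F (complexEquiv n p)) (tubeMeasure n lam) :=
  (aestronglyMeasurable_tube hF isOpen_posCone.measurableSet subset_rfl).mono_ac
    (Measure.AbsolutelyContinuous.rfl.prod (withDensity_absolutelyContinuous _ _))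

theorem setLIntegral_sliceLIntegral_lt_top {lam : ℝ} (hlam : (n : ℝ) < lam)
    {F : SymmMat n ℂ → ℂ} (hF : ContinuousOn F (siegelDomain n))
    (hint : ∫⁻ p, ‖F (complexEquiv n p)‖ₑ ^ 2 ∂(tubeMeasure n lam) < ∞)
    {K : Set (SymmMat n ℝ)} (hK : IsCompact K) (hKΩ : K ⊆ posCone n) :
    ∫⁻ Y in K, sliceLIntegral 2 F Y < ∞ := by
  obtain ⟨c, hc, hle⟩ := exists_smul_restrict_le_coneMeasure hlam hK hKΩ
  have h1 : c * ∫⁻ Y in K, sliceLIntegral 2 F Y ≤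
      ∫⁻ p, ‖F (complexEquiv n p)‖ₑ ^ 2 ∂(tubeMeasure n lam) := by
    have h2 : AEMeasurable (fun p => ‖F (complexEquiv n p)‖ₑ ^ 2) (tubeMeasure n lam) :=
      (aestronglyMeasurable_tubeMeasure hF).enorm.pow_const 2
    rw [tubeMeasure, lintegral_prod_symm _ h2, ← smul_eq_mul, ← lintegral_smul_measure]
    exact lintegral_mono' hle le_rfl
  refine lt_of_le_of_ne le_top fun htop => ?_
  rw [htop, ENNReal.mul_top hc] at h1
  exact absurd hint (not_lt.2 h1)

theorem sliceLIntegral_translate (q : ℕ) (F : SymmMat n ℂ → ℂ) (Y X' Y' : SymmMat n ℝ) :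
    ∫⁻ X, ‖F (complexEquiv n (X, Y) + complexEquiv n (X', Y'))‖ₑ ^ q =
      sliceLIntegral q F (Y + Y') := by
  simp only [← map_add, Prod.mk_add_mk]
  exact lintegral_add_right_eq_self (fun X => ‖F (complexEquiv n (X, Y + Y'))‖ₑ ^ q) X'

/-- The weighted norm by itself controls almost every slice only. The sub-mean value inequality
bounds `‖F(X + iY)‖²` by an average over a small ball. Integrating over all `X` and using
translation invariance in the real direction leaves an integral of slice norms over a compact
neighbourhood of `Y₀`, which is finite. -/
theorem exists_sliceLIntegral_le {lam : ℝ} (hlam : (n : ℝ) < lam)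
    {F : SymmMat n ℂ → ℂ} (hF : DifferentiableOn ℂ F (siegelDomain n))
    (hint : ∫⁻ p, ‖F (complexEquiv n p)‖ₑ ^ 2 ∂(tubeMeasure n lam) < ∞)
    {Y₀ : SymmMat n ℝ} (hY₀ : Y₀ ∈ posCone n) :
    ∃ ρ > 0, ∃ C < ∞, ∀ Y ∈ Metric.ball Y₀ ρ, sliceLIntegral 2 F Y ≤ C := by
  have : ProperSpace (SymmMat n ℝ) := FiniteDimensional.proper ℝ _
  have : ProperSpace (SymmMat n ℂ) := FiniteDimensional.proper ℂ _
  obtain ⟨ε, hε, hball⟩ := Metric.isOpen_iff.1 isOpen_posCone Y₀ hY₀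
  set ρ := ε / 4 with hρ
  have hρ0 : 0 < ρ := by positivity
  -- The radius `2ρ = ε/2` leaves room for `Y + v` with `Y` in the `ρ`-ball around `Y₀` and `‖v‖ ≤
  -- ρ`, while `K` stays inside the cone.
  set K : Set (SymmMat n ℝ) := Metric.closedBall Y₀ (2 * ρ) with hK
  have hKc : IsCompact K := isCompact_closedBall _ _
  have hKΩ : K ⊆ posCone n := (Metric.closedBall_subset_ball (by rw [hρ]; linarith)).trans hball
  set e := (complexEquiv n).toContinuousLinearEquiv with he
  -- The complex ball of radius `r` is to fit into the product of the `ρ`-balls in real and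
  -- imaginary parts.
  obtain ⟨r, hr, hrρ⟩ : ∃ r > 0, ∀ p : SymmMat n ℝ × SymmMat n ℝ,
      ‖complexEquiv n p‖ ≤ r → ‖p‖ ≤ ρ := by
    have hc : Continuous fun W => ‖e.symm W‖ := e.symm.continuous.norm
    have h0 : ‖e.symm 0‖ < ρ := by simpa using hρ0
    obtain ⟨r, hr, hsub⟩ := Metric.nhds_basis_closedBall.mem_iff.1
      (hc.continuousAt.eventually_lt continuousAt_const h0)
    refine ⟨r, hr, fun p hp => ?_⟩
    have : ‖e.symm (e p)‖ < ρ := hsub (mem_closedBall_zero_iff.2 hp)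
    rw [e.symm_apply_apply] at this
    exact this.le
  set μ := lebesgueC n with hμ
  set B : Set (SymmMat n ℂ) := Metric.closedBall 0 r with hB
  have hBm : MeasurableSet B := measurableSet_closedBall
  have hBpos : μ B ≠ 0 := (Metric.measure_closedBall_pos μ 0 hr).ne'
  have hBfin : μ B ≠ ∞ := measure_closedBall_lt_top.ne
  set V : ℝ≥0∞ := volume (Metric.closedBall (0 : SymmMat n ℝ) ρ) with hV
  have hVfin : V < ∞ := measure_closedBall_lt_top
  set A := ∫⁻ Y in K, sliceLIntegral 2 F Y with hA
  have hAfin : A < ∞ := setLIntegral_sliceLIntegral_lt_top hlam hF.continuousOn hint hKc hKΩ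
  refine ⟨ρ, hρ0, V * A / μ B, ENNReal.div_lt_top (ENNReal.mul_lt_top hVfin hAfin).ne hBpos,
    fun Y hY => ?_⟩
  rw [ENNReal.le_div_iff_mul_le (Or.inl hBpos) (Or.inl hBfin)]
  have hYK : ∀ v : SymmMat n ℝ, ‖v‖ ≤ ρ → Y + v ∈ K := by
    intro v hv
    rw [hK, mem_closedBall_iff_norm]
    have h1 : ‖Y - Y₀‖ < ρ := mem_ball_iff_norm.1 hY
    calc ‖Y + v - Y₀‖ = ‖(Y - Y₀) + v‖ := by congr 1; abel
      _ ≤ ‖Y - Y₀‖ + ‖v‖ := norm_add_le _ _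
      _ ≤ 2 * ρ := by linarith
  have hdom : ∀ X : SymmMat n ℝ, ∀ W ∈ B, complexEquiv n (X, Y) + W ∈ siegelDomain n := by
    intro X W hW
    obtain ⟨p, rfl⟩ := (complexEquiv n).surjective W
    rw [← map_add]
    refine complexEquiv_mem_siegelDomain.2 (hKΩ (hYK _ ?_))
    exact (norm_snd_le p).trans (hrρ p (mem_closedBall_zero_iff.1 hW))
  have hmean : ∀ X, ‖F (complexEquiv n (X, Y))‖ₑ ^ 2 * μ B ≤
      ∫⁻ W in B, ‖F (complexEquiv n (X, Y) + W)‖ₑ ^ 2 ∂μ := fun X =>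
    enorm_sq_mul_measure_closedBall_le μ hF fun Z hZ => by
      have := hdom X (Z - complexEquiv n (X, Y)) (by
        rw [hB, mem_closedBall_zero_iff]; exact mem_closedBall_iff_norm.1 hZ)
      rwa [add_sub_cancel] at this
  have hcont : ContinuousOn (fun q : SymmMat n ℝ × SymmMat n ℂ =>
      F (complexEquiv n (q.1, Y) + q.2)) (Set.univ ×ˢ B) := by
    refine hF.continuousOn.comp ?_ fun q hq => hdom _ _ hq.2
    have h1 := continuous_complexEquiv (n := n)
    have : Continuous fun q : SymmMat n ℝ × SymmMat n ℂ => complexEquiv n (q.1, Y) + q.2 :=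
      (h1.comp (by fun_prop)).add continuous_snd
    exact this.continuousOn
  have hae : AEMeasurable (fun q : SymmMat n ℝ × SymmMat n ℂ =>
      ‖F (complexEquiv n (q.1, Y) + q.2)‖ₑ ^ 2) (volume.prod (μ.restrict B)) := by
    rw [← Measure.restrict_univ (μ := (volume : Measure (SymmMat n ℝ))), Measure.prod_restrict]
    exact (hcont.aestronglyMeasurable (MeasurableSet.univ.prod hBm)).enorm.pow_const 2
  have hemb : MeasurableEmbedding (complexEquiv n) :=
    (complexMeasurableEquiv n).measurableEmbedding
  have hSm : MeasurableSet (Metric.closedBall (0 : SymmMat n ℝ) ρ) := measurableSet_closedBall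
  calc sliceLIntegral 2 F Y * μ B
      = ∫⁻ X, ‖F (complexEquiv n (X, Y))‖ₑ ^ 2 * μ B := (lintegral_mul_const' _ _ hBfin).symm
    _ ≤ ∫⁻ X, (∫⁻ W in B, ‖F (complexEquiv n (X, Y) + W)‖ₑ ^ 2 ∂μ) := lintegral_mono hmean
    _ = ∫⁻ W in B, (∫⁻ X, ‖F (complexEquiv n (X, Y) + W)‖ₑ ^ 2) ∂μ :=
        lintegral_lintegral_swap hae
    _ = ∫⁻ p in complexEquiv n ⁻¹' B, sliceLIntegral 2 F (Y + p.2)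
          ∂((volume : Measure (SymmMat n ℝ)).prod volume) := by
        rw [hμ, lebesgueC, hemb.restrict_map, hemb.lintegral_map]
        refine lintegral_congr fun p => ?_
        exact sliceLIntegral_translate 2 F Y p.1 p.2
    _ ≤ ∫⁻ p in Metric.closedBall 0 ρ ×ˢ Metric.closedBall 0 ρ, sliceLIntegral 2 F (Y + p.2)
          ∂((volume : Measure (SymmMat n ℝ)).prod volume) := by
        refine lintegral_mono_set fun p hp => ?_
        have := hrρ p (mem_closedBall_zero_iff.1 hp)
        exact ⟨mem_closedBall_zero_iff.2 ((norm_fst_le p).trans this),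
          mem_closedBall_zero_iff.2 ((norm_snd_le p).trans this)⟩
    _ ≤ V * ∫⁻ v in Metric.closedBall 0 ρ, sliceLIntegral 2 F (Y + v) := by
        rw [← Measure.prod_restrict]
        refine (lintegral_prod_le _).trans ?_
        change ∫⁻ _ in Metric.closedBall (0 : SymmMat n ℝ) ρ,
          (∫⁻ v in Metric.closedBall 0 ρ, sliceLIntegral 2 F (Y + v)) ≤ _
        rw [setLIntegral_const, mul_comm]
    _ ≤ V * A := by
        gcongr
        have h1 := (measurePreserving_add_left (volume : Measure (SymmMat n ℝ)) Y
          ).setLIntegral_comp_preimage_emb (measurableEmbedding_addLeft Y)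
          (sliceLIntegral 2 F) K
        rw [hA, ← h1]
        exact lintegral_mono_set fun v hv => hYK v (mem_closedBall_zero_iff.1 hv)

end TubeEstimates

/-! ### Shifting the contour between slices. -/

section ContourShift

open SymmMat

variable {n : ℕ}

theorem add_smul_sub_mem_posCone {Y₀ Y₁ : SymmMat n ℝ} (hY₀ : Y₀ ∈ posCone n)
    (hY₁ : Y₁ ∈ posCone n) {t : ℝ} (ht : t ∈ Set.Icc (0 : ℝ) 1) :
    Y₀ + t • (Y₁ - Y₀) ∈ posCone n :=
  convex_posCone.add_smul_sub_mem hY₀ hY₁ ht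

theorem exists_forall_segment_le {N : SymmMat n ℝ → ℝ≥0∞}
    (hloc : ∀ Y₀ ∈ posCone n, ∃ ρ > 0, ∃ C < ∞, ∀ Y ∈ Metric.ball Y₀ ρ, N Y ≤ C)
    {Y₀ Y₁ : SymmMat n ℝ} (hY₀ : Y₀ ∈ posCone n) (hY₁ : Y₁ ∈ posCone n) :
    ∃ C < ∞, ∀ t ∈ Set.Icc (0 : ℝ) 1, N (Y₀ + t • (Y₁ - Y₀)) ≤ C := by
  refine isCompact_Icc.induction_on (p := fun s : Set ℝ => ∃ C < ∞, ∀ t ∈ s,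
    N (Y₀ + t • (Y₁ - Y₀)) ≤ C) ?_ ?_ ?_ ?_
  · exact ⟨0, ENNReal.zero_lt_top, by simp⟩
  · rintro s t hst ⟨C, hC, h⟩
    exact ⟨C, hC, fun x hx => h x (hst hx)⟩
  · rintro s t ⟨C, hC, h⟩ ⟨D, hD, h'⟩
    refine ⟨max C D, max_lt hC hD, ?_⟩
    rintro x (hx | hx)
    · exact (h x hx).trans (le_max_left _ _)
    · exact (h' x hx).trans (le_max_right _ _)
  · intro t ht
    obtain ⟨ρ, hρ, C, hC, h⟩ := hloc _ (add_smul_sub_mem_posCone hY₀ hY₁ ht)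
    have hc : Continuous fun t : ℝ => Y₀ + t • (Y₁ - Y₀) := by fun_prop
    exact ⟨_, mem_nhdsWithin_of_mem_nhds (hc.continuousAt.preimage_mem_nhds
      (Metric.ball_mem_nhds _ hρ)), C, hC, fun s hs => h _ hs⟩

/-- This supplies the Fubini theorem for each of the four edges in the contour shift: along the path
`a` the `L¹` norms of the slices are bounded, and the parameter interval is finite. -/
theorem integrable_slab {G : SymmMat n ℂ → ℂ} (hG : ContinuousOn G (siegelDomain n))
    {a : ℝ → SymmMat n ℝ × SymmMat n ℝ} (ha : Continuous a)
    (hmem : ∀ t ∈ Set.Icc (0 : ℝ) 1, (a t).2 ∈ posCone n) {C : ℝ≥0∞} (hC : C < ∞)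
    (hle : ∀ t ∈ Set.Icc (0 : ℝ) 1, sliceLIntegral 1 G (a t).2 ≤ C) :
    Integrable (fun q : SymmMat n ℝ × ℝ => G (complexEquiv n (q.1, 0) + complexEquiv n (a q.2)))
      ((volume : Measure (SymmMat n ℝ)).prod (volume.restrict (Set.Ioc (0 : ℝ) 1))) := by
  have hm : AEStronglyMeasurable
      (fun q : SymmMat n ℝ × ℝ => G (complexEquiv n (q.1, 0) + complexEquiv n (a q.2)))
      ((volume : Measure (SymmMat n ℝ)).prod (volume.restrict (Set.Ioc (0 : ℝ) 1))) := by
    rw [← Measure.restrict_univ (μ := (volume : Measure (SymmMat n ℝ))), Measure.prod_restrict]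
    refine (hG.comp ?_ ?_).aestronglyMeasurable (MeasurableSet.univ.prod measurableSet_Ioc)
    · have h1 := continuous_complexEquiv (n := n)
      have : Continuous fun q : SymmMat n ℝ × ℝ =>
          complexEquiv n (q.1, 0) + complexEquiv n (a q.2) :=
        (h1.comp (by fun_prop)).add (h1.comp (ha.comp continuous_snd))
      exact this.continuousOn
    · intro q hq
      change complexEquiv n (q.1, 0) + complexEquiv n (a q.2) ∈ siegelDomain n
      rw [← map_add]
      refine complexEquiv_mem_siegelDomain.2 ?_
      rw [Prod.snd_add, zero_add]
      exact hmem _ (Set.Ioc_subset_Icc_self hq.2)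
  refine ⟨hm, ?_⟩
  rw [HasFiniteIntegral, lintegral_prod_symm _ hm.enorm]
  have : ∀ t ∈ Set.Ioc (0 : ℝ) 1,
      ∫⁻ X, ‖G (complexEquiv n (X, 0) + complexEquiv n (a t))‖ₑ ≤ C := by
    intro t ht
    have h1 := sliceLIntegral_translate 1 G 0 (a t).1 (a t).2
    simp only [pow_one, zero_add, Prod.mk.eta] at h1
    rw [h1]
    exact hle t (Set.Ioc_subset_Icc_self ht)
  calc _ ≤ ∫⁻ _ in Set.Ioc (0 : ℝ) 1, C := setLIntegral_mono' measurableSet_Ioc this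
    _ < ∞ := by
      rw [setLIntegral_const, Real.volume_Ioc]
      simpa using hC

/-- Cauchy's theorem: the integral of a holomorphic function over the slice `Im Z = Y` does not
depend on `Y`. -/
theorem integral_slice_eq {G : SymmMat n ℂ → ℂ} (hG : DifferentiableOn ℂ G (siegelDomain n))
    (hloc : ∀ Y₀ ∈ posCone n, ∃ ρ > 0, ∃ C < ∞, ∀ Y ∈ Metric.ball Y₀ ρ, sliceLIntegral 1 G Y ≤ C)
    {Y₀ Y₁ : SymmMat n ℝ} (hY₀ : Y₀ ∈ posCone n) (hY₁ : Y₁ ∈ posCone n) :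
    ∫ X, G (complexEquiv n (X, Y₀)) = ∫ X, G (complexEquiv n (X, Y₁)) := by
  obtain ⟨C, hC, hCle⟩ := exists_forall_segment_le hloc hY₀ hY₁
  set V := Y₁ - Y₀ with hV
  have hseg : ∀ t ∈ Set.Icc (0 : ℝ) 1, Y₀ + t • V ∈ posCone n := fun t ht =>
    add_smul_sub_mem_posCone hY₀ hY₁ ht
  have h0 : (0 : ℝ) ∈ Set.Icc (0 : ℝ) 1 := by simp
  have h1 : (1 : ℝ) ∈ Set.Icc (0 : ℝ) 1 := by simp
  have hY₁' : Y₀ + (1 : ℝ) • V = Y₁ := by rw [hV]; module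
  have hY₀' : Y₀ + (0 : ℝ) • V = Y₀ := by module
  -- Restrict `G` to the complex line through `X + iY₀` in the direction `V`, and apply Cauchy's
  -- theorem on the unit square. After integration over all `X`, translation invariance makes the
  -- two horizontal edges the slice integrals at `Y₀` and `Y₁`, and makes the two vertical edges
  -- cancel. No decay at infinity in `X` is needed.
  set f : SymmMat n ℝ → ℂ → ℂ := fun X w =>
    G (complexEquiv n (X + w.re • V, Y₀ + w.im • V)) with hf
  have hfd : ∀ X, DifferentiableOn ℂ (f X) (Set.uIcc (0 : ℂ).re (1 + Complex.I : ℂ).re ×ℂ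
      Set.uIcc (0 : ℂ).im (1 + Complex.I : ℂ).im) := by
    intro X
    have hw : ∀ w : ℂ, complexEquiv n (X, Y₀) + w • complexEquiv n (V, 0) =
        complexEquiv n (X + w.re • V, Y₀ + w.im • V) := by
      intro w
      have hr : ∀ (c : ℝ) (W : SymmMat n ℂ), (c : ℂ) • W = c • W := fun _ _ => rfl
      have hV0 : complexEquiv n (0, V) = Complex.I • complexEquiv n (V, 0) := by
        have h00 : ofReal (0 : SymmMat n ℝ) = 0 :=
          norm_eq_zero.1 (by rw [norm_ofReal, norm_zero])
        rw [complexEquiv_apply, complexEquiv_apply]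
        simp [h00]
      conv_lhs => rw [← Complex.re_add_im w, add_smul, mul_smul, ← hV0, hr, hr, ← map_smul,
        ← map_smul, ← map_add, ← map_add]
      congr 1
      simp
    have e : f X = fun w : ℂ => G (complexEquiv n (X, Y₀) + w • complexEquiv n (V, 0)) := by
      funext w
      rw [hw]
    rw [e]
    refine hG.comp (by fun_prop) fun w hmem => ?_
    have hw2 : w.im ∈ Set.Icc (0 : ℝ) 1 := by
      have := hmem.2
      simpa using this
    rw [hw]
    exact complexEquiv_mem_siegelDomain.2 (hseg _ hw2)
  have hrect := fun X => Complex.integral_boundary_rect_eq_zero_of_differentiableOn (f X) 0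
    (1 + Complex.I) (hfd X)
  simp only [Complex.zero_re, Complex.zero_im, Complex.add_re, Complex.add_im, Complex.one_re,
    Complex.one_im, Complex.I_re, Complex.I_im, add_zero, zero_add,
    intervalIntegral.integral_of_le zero_le_one] at hrect
  have hedge : ∀ {a : ℝ → SymmMat n ℝ × SymmMat n ℝ}, Continuous a →
      (∀ t ∈ Set.Icc (0 : ℝ) 1, ∃ s ∈ Set.Icc (0 : ℝ) 1, (a t).2 = Y₀ + s • V) →
      Integrable (fun q : SymmMat n ℝ × ℝ =>
        G (complexEquiv n (q.1, 0) + complexEquiv n (a q.2)))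
        ((volume : Measure (SymmMat n ℝ)).prod (volume.restrict (Set.Ioc (0 : ℝ) 1))) := by
    intro a ha h
    refine integrable_slab hG.continuousOn ha ?_ hC ?_
    · intro t ht
      obtain ⟨s, hs, e⟩ := h t ht
      rw [e]
      exact hseg s hs
    · intro t ht
      obtain ⟨s, hs, e⟩ := h t ht
      rw [e]
      exact hCle s hs
  set J : SymmMat n ℝ → ℂ := fun Y => ∫ X, G (complexEquiv n (X, Y)) with hJ
  have hedgeInt : ∀ {a : ℝ → SymmMat n ℝ × SymmMat n ℝ} {g : SymmMat n ℝ → ℝ → ℂ},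
      Continuous a →
      (∀ t ∈ Set.Icc (0 : ℝ) 1, ∃ s ∈ Set.Icc (0 : ℝ) 1, (a t).2 = Y₀ + s • V) →
      (∀ X t, g X t = G (complexEquiv n (X, 0) + complexEquiv n (a t))) →
      Integrable (fun X => ∫ t in Set.Ioc (0 : ℝ) 1, g X t) ∧
        ∫ X, (∫ t in Set.Ioc (0 : ℝ) 1, g X t) = ∫ t in Set.Ioc (0 : ℝ) 1, J (a t).2 := by
    intro a g ha h hg
    have hi := hedge ha h
    simp only [hg]
    refine ⟨hi.integral_prod_left, ?_⟩
    rw [integral_integral_swap hi]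
    refine integral_congr_ae (Filter.Eventually.of_forall fun t => ?_)
    rw [hJ]
    have := integral_add_right_eq_self (μ := volume) (fun X => G (complexEquiv n (X, (a t).2))) (a t).1
    refine Eq.trans ?_ this
    refine integral_congr_ae (Filter.Eventually.of_forall fun X => ?_)
    change G (complexEquiv n (X, 0) + complexEquiv n (a t)) = _
    rw [← map_add]
    congr 2
    exact Prod.ext rfl (zero_add _)
  have e1 := hedgeInt (a := fun s => (s • V, Y₀)) (g := fun X s => f X ((s : ℂ) + ((0 : ℝ) : ℂ) * Complex.I))
    (by fun_prop) (fun t _ => ⟨0, h0, by rw [hY₀']⟩) (fun X t => by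
      rw [← map_add]; simp [hf])
  have e2 := hedgeInt (a := fun s => (s • V, Y₀ + (1 : ℝ) • V))
    (g := fun X s => f X ((s : ℂ) + ((1 : ℝ) : ℂ) * Complex.I))
    (by fun_prop) (fun t _ => ⟨1, h1, rfl⟩) (fun X t => by
      rw [← map_add]; simp [hf])
  have e3 := hedgeInt (a := fun t => (V, Y₀ + t • V))
    (g := fun X t => f X (((1 : ℝ) : ℂ) + (t : ℂ) * Complex.I))
    (by fun_prop) (fun t ht => ⟨t, ht, rfl⟩) (fun X t => by
      rw [← map_add]; simp [hf])
  have e4 := hedgeInt (a := fun t => (0, Y₀ + t • V))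
    (g := fun X t => f X (((0 : ℝ) : ℂ) + (t : ℂ) * Complex.I))
    (by fun_prop) (fun t ht => ⟨t, ht, rfl⟩) (fun X t => by
      rw [← map_add]; simp [hf])
  have hsum := integral_congr_ae (μ := (volume : Measure (SymmMat n ℝ)))
    (Filter.Eventually.of_forall hrect)
  have hsplit := integral_sub ((e1.1.sub e2.1).add (e3.1.const_mul Complex.I))
    (e4.1.const_mul Complex.I)
  have hsplit2 := integral_add (e1.1.sub e2.1) (e3.1.const_mul Complex.I)
  have hsplit3 := integral_sub e1.1 e2.1
  simp only [Pi.sub_apply, Pi.add_apply, integral_const_mul, smul_eq_mul, e1.2, e2.2, e3.2, e4.2,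
    integral_zero] at hsum hsplit hsplit2 hsplit3
  have hc1 : ∫ _ in Set.Ioc (0 : ℝ) 1, J Y₀ = J Y₀ := by simp
  have hc2 : ∫ _ in Set.Ioc (0 : ℝ) 1, J (Y₀ + (1 : ℝ) • V) = J Y₁ := by rw [hY₁']; simp
  rw [hsplit, hsplit2, hsplit3, hc1, hc2] at hsum
  change J Y₀ = J Y₁
  linear_combination hsum

end ContourShift

/-! ### The operator `S_λ` is isometric. -/

section IsometryS

open SymmMat

variable {n : ℕ}

theorem finrank_symmMat (n : ℕ) :
    (Module.finrank ℝ (SymmMat n ℝ) : ℝ) = (n : ℝ) * (n + 1) / 2 := by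
  induction n with
  | zero =>
    have h0 : ∀ A : SymmMat 0 ℝ, A = 0 := fun A => mat_injective (Subsingleton.elim _ _)
    have : Module.finrank ℝ (SymmMat 0 ℝ) = 0 :=
      Module.finrank_eq_zero_iff.2 fun x => ⟨1, one_ne_zero, h0 _⟩
    simp [this]
  | succ n ih =>
    have h := (borderedIsometry n).toLinearEquiv.finrank_eq
    rw [(WithLp.linearEquiv 2 ℝ _).finrank_eq, Module.finrank_prod,
      (WithLp.linearEquiv 2 ℝ _).finrank_eq, Module.finrank_prod, finrank_euclideanSpace,
      Fintype.card_fin, Module.finrank_self] at h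
    rw [← h]
    push_cast
    rw [ih]
    ring

theorem measurable_coneDensity (n : ℕ) (lam : ℝ) : Measurable fun Y : SymmMat n ℝ =>
    ENNReal.ofReal (bergmanConst n lam * ((2 : ℝ) • mat Y).det ^ (lam - n - 1)) := by
  simp only [det_two_smul_mat]
  have h1 : Measurable fun Y : SymmMat n ℝ => (mat Y).det := continuous_det_mat.measurable
  fun_prop

/-- The weight `∫ e^(-2 tr(ξY)) dν(Y)`, `ν` the measure on the cone. -/
def coneWeight (lam : ℝ) (ξ : SymmMat n ℝ) : ℝ≥0∞ :=
  ∫⁻ Y, ENNReal.ofReal (Real.exp (-inner ℝ ξ Y)) ^ 2 ∂(coneMeasure n lam)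

theorem coneWeight_eq {lam : ℝ} (hlam : (n : ℝ) < lam) (ξ : SymmMat n ℝ) :
    coneWeight lam ξ = ENNReal.ofReal (bergmanConst n lam * (2 ^ n) ^ (lam - n - 1)) *
      coneIntegral (lam - n - 1) ((2 : ℝ) • ξ) := by
  have hC := bergmanConst_pos hlam
  rw [coneWeight, coneMeasure, lintegral_withDensity_eq_lintegral_mul _
    (measurable_coneDensity n lam) (by fun_prop), coneIntegral, ← lintegral_const_mul']
  · refine setLIntegral_congr_fun isOpen_posCone.measurableSet fun Y hY => ?_
    have hdet := det_pos_of_mem hY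
    rw [Pi.mul_apply, det_two_smul_mat, Real.mul_rpow (by positivity) hdet.le,
      ← ENNReal.ofReal_pow (Real.exp_pos _).le, ← ENNReal.ofReal_mul (by positivity),
      ← ENNReal.ofReal_mul (by positivity), inner_smul_left, ← Real.exp_nat_mul]
    congr 1
    have : ((2 : ℕ) : ℝ) * -inner ℝ ξ Y = -((starRingEnd ℝ) 2 * inner ℝ ξ Y) := by
      simp
    rw [this]
    ring
  · exact ENNReal.ofReal_ne_top

theorem two_smul_mem_posCone {ξ : SymmMat n ℝ} : (2 : ℝ) • ξ ∈ posCone n ↔ ξ ∈ posCone n := by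
  have : ∀ x : Fin n → ℝ, x ⬝ᵥ (mat ((2 : ℝ) • ξ)).mulVec x = 2 * (x ⬝ᵥ (mat ξ).mulVec x) :=
    fun x => by rw [map_smul, Matrix.smul_mulVec, dotProduct_smul, smul_eq_mul]
  simp only [mem_posCone_iff, this]
  simp

/-- The constant factor `(2π)^(n(n+1)/4) Γ_Ω(λ)^(-1/2)` of `S_λ`. -/
def sConst (n : ℕ) (lam : ℝ) : ℝ :=
  (2 * Real.pi) ^ ((n : ℝ) * (n + 1) / 4) / Real.sqrt (multiGamma n lam)

theorem multiGamma_lam_pos {lam : ℝ} (hlam : (n : ℝ) < lam) : 0 < multiGamma n lam :=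
  multiGamma_pos n (by
    have : (0 : ℝ) ≤ n := n.cast_nonneg
    linarith)

theorem sConst_pos {lam : ℝ} (hlam : (n : ℝ) < lam) : 0 < sConst n lam := by
  have := multiGamma_lam_pos hlam
  rw [sConst]
  positivity

/-- This is the gamma integral with parameter `λ - (n+1)/2` at `2ξ`, and `λ > n` is what puts this
parameter in the range of convergence. The factor `Γ_Ω(λ - (n+1)/2)` cancels against the one in
`C_{λ,n}`. -/
theorem coneWeight_of_mem {lam : ℝ} (hlam : (n : ℝ) < lam) {ξ : SymmMat n ℝ}
    (hξ : ξ ∈ posCone n) :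
    coneWeight lam ξ = ENNReal.ofReal
      ((sConst n lam * (mat ξ).det ^ (lam / 2 - ((n : ℝ) + 1) / 4)) ^ 2)⁻¹ := by
  have hC := bergmanConst_pos hlam
  have hG := multiGamma_lam_pos hlam
  have hdet := det_pos_of_mem hξ
  have hs : ((n : ℝ) - 1) / 2 < lam - ((n : ℝ) + 1) / 2 := by linarith
  have hG' := multiGamma_pos n hs
  have ht : lam - n - 1 = lam - ((n : ℝ) + 1) / 2 - ((n : ℝ) + 1) / 2 := by ring
  rw [coneWeight_eq hlam, ht, coneIntegral_of_mem hs (two_smul_mem_posCone.2 hξ),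
    ← ENNReal.ofReal_mul (by positivity), map_smul, det_two_smul_mat]
  congr 1
  rw [Real.mul_rpow (by positivity) hdet.le, bergmanConst, sConst, mul_pow, div_pow,
    Real.sq_sqrt hG.le, ← Real.rpow_natCast _ 2, ← Real.rpow_natCast _ 2, ← Real.rpow_mul hdet.le,
    ← Real.rpow_mul (by positivity), mul_inv, ← Real.rpow_neg hdet.le, inv_div]
  have e1 : -((lam / 2 - ((n : ℝ) + 1) / 4) * ((2 : ℕ) : ℝ)) = -(lam - ((n : ℝ) + 1) / 2) := by
    push_cast; ring
  have e2 : (n : ℝ) * (n + 1) / 4 * ((2 : ℕ) : ℝ) = (n : ℝ) * (n + 1) / 2 := by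
    push_cast; ring
  rw [e1, e2, Real.mul_rpow (by norm_num) Real.pi_pos.le]
  -- The powers of `2` coming from `det(2Y)`, `det(2ξ)` and `2π` cancel exactly.
  have e3 : ((2 : ℝ) ^ n) ^ (lam - ((n : ℝ) + 1) / 2 - ((n : ℝ) + 1) / 2) *
      ((2 : ℝ) ^ n) ^ (-(lam - ((n : ℝ) + 1) / 2)) * 2 ^ ((n : ℝ) * (n + 1) / 2) = 1 := by
    rw [← Real.rpow_natCast, ← Real.rpow_mul (by norm_num), ← Real.rpow_mul (by norm_num),
      ← Real.rpow_add (by norm_num), ← Real.rpow_add (by norm_num)]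
    convert Real.rpow_zero (2 : ℝ) using 2
    ring
  have hpi : (0 : ℝ) < Real.pi ^ ((n : ℝ) * (n + 1) / 2) := by positivity
  have h2 : (0 : ℝ) < 2 ^ ((n : ℝ) * (n + 1) / 2) := by positivity
  rw [← eq_div_iff h2.ne'] at e3
  generalize ((2 : ℝ) ^ n) ^ (lam - ((n : ℝ) + 1) / 2 - ((n : ℝ) + 1) / 2) = a at *
  generalize ((2 : ℝ) ^ n) ^ (-(lam - ((n : ℝ) + 1) / 2)) = b at *
  generalize (2 : ℝ) ^ ((n : ℝ) * (n + 1) / 2) = c at *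
  generalize Real.pi ^ ((n : ℝ) * (n + 1) / 2) = d at *
  generalize (mat ξ).det ^ (-(lam - ((n : ℝ) + 1) / 2)) = e at *
  generalize multiGamma n (lam - ((n : ℝ) + 1) / 2) = g at *
  generalize multiGamma n lam = g' at *
  calc _ = (a * b) * (g' / (d * g) * g * e) := by ring
    _ = _ := by
      rw [e3]
      field_simp

/-- Here `1 ≤ n` makes `λ - (n+1)/2` positive, as the divergence of the gamma integral requires. The
infinite weight is what confines the Fourier transforms of Bergman functions to the cone. -/
theorem coneWeight_of_notMem (hn : 1 ≤ n) {lam : ℝ} (hlam : (n : ℝ) < lam) {ξ : SymmMat n ℝ}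
    (hξ : ξ ∉ posCone n) : coneWeight lam ξ = ∞ := by
  have hn' : (1 : ℝ) ≤ n := by exact_mod_cast hn
  have hC := bergmanConst_pos hlam
  have ht : lam - n - 1 = lam - ((n : ℝ) + 1) / 2 - ((n : ℝ) + 1) / 2 := by ring
  have hpos : 0 < bergmanConst n lam * (2 ^ n) ^ (lam - n - 1) := by positivity
  rw [coneWeight_eq hlam, ht, coneIntegral_of_notMem (by linarith) (by linarith)
    (fun h => hξ (two_smul_mem_posCone.1 h)), ← ht]
  exact ENNReal.mul_top (by simpa using hpos)

theorem aestronglyMeasurable_mul_exp {lam : ℝ} {H : SymmMat n ℝ → ℂ}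
    (hH : AEStronglyMeasurable H volume) :
    AEStronglyMeasurable (fun p : SymmMat n ℝ × SymmMat n ℝ =>
      H p.1 * ((Real.exp (-inner ℝ p.1 p.2) : ℝ) : ℂ)) (tubeMeasure n lam) :=
  hH.comp_fst.mul (by fun_prop : Continuous fun p : SymmMat n ℝ × SymmMat n ℝ =>
    ((Real.exp (-inner ℝ p.1 p.2) : ℝ) : ℂ)).aestronglyMeasurable

/-- Tonelli, integrating in `Y` first. The resulting weighted norm in `X` serves twice: for the
isometry of `S_λ`, and to locate the support of `h` in the converse direction. -/
theorem lintegral_mul_exp {lam : ℝ} {H : SymmMat n ℝ → ℂ}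
    (hH : AEStronglyMeasurable H volume) :
    ∫⁻ p : SymmMat n ℝ × SymmMat n ℝ,
      ‖H p.1 * ((Real.exp (-inner ℝ p.1 p.2) : ℝ) : ℂ)‖ₑ ^ 2 ∂(tubeMeasure n lam) =
    ∫⁻ X, ‖H X‖ₑ ^ 2 * coneWeight lam X := by
  have hm := (aestronglyMeasurable_mul_exp (lam := lam) hH).enorm.pow_const 2
  rw [tubeMeasure] at hm ⊢
  rw [lintegral_prod _ hm]
  refine lintegral_congr fun X => ?_
  rw [coneWeight, ← lintegral_const_mul _ (by fun_prop)]
  refine lintegral_congr fun Y => ?_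
  rw [enorm_mul, mul_pow]
  congr 2
  rw [← ofReal_norm, Complex.norm_real, Real.norm_of_nonneg (Real.exp_pos _).le]

/-- The factor of `sFun` which depends on `X` only. -/
def sFactor (n : ℕ) (lam : ℝ) (f : SymmMat n ℝ → ℂ) : SymmMat n ℝ → ℂ :=
  (posCone n).indicator fun X =>
    ((sConst n lam * (mat X).det ^ (lam / 2 - ((n : ℝ) + 1) / 4) : ℝ) : ℂ) * f X

theorem sFun_eq (lam : ℝ) (f : SymmMat n ℝ → ℂ) (p : SymmMat n ℝ × SymmMat n ℝ) :
    sFun n lam f p = sFactor n lam f p.1 * ((Real.exp (-inner ℝ p.1 p.2) : ℝ) : ℂ) := by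
  rw [sFun, sFactor, inner_real, sConst]
  by_cases h : p.1 ∈ posCone n
  · rw [Set.indicator_of_mem h, Set.indicator_of_mem h]
    push_cast
    ring
  · rw [Set.indicator_of_notMem h, Set.indicator_of_notMem h]
    simp

theorem continuousOn_det_rpow (b : ℝ) :
    ContinuousOn (fun X : SymmMat n ℝ => (mat X).det ^ b) (posCone n) :=
  continuous_det_mat.continuousOn.rpow_const fun _ hX => Or.inl (det_pos_of_mem hX).ne'

theorem aestronglyMeasurable_sFactor (lam : ℝ) {f : SymmMat n ℝ → ℂ}
    (hf : AEStronglyMeasurable f ((volume : Measure (SymmMat n ℝ)).restrict (posCone n))) :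
    AEStronglyMeasurable (sFactor n lam f) volume := by
  rw [sFactor, aestronglyMeasurable_indicator_iff isOpen_posCone.measurableSet]
  refine AEStronglyMeasurable.mul ?_ hf
  refine ContinuousOn.aestronglyMeasurable ?_ isOpen_posCone.measurableSet
  exact Complex.continuous_ofReal.comp_continuousOn
    (continuousOn_const.mul (continuousOn_det_rpow _))

theorem enorm_sq_sFactor_mul_coneWeight {lam : ℝ} (hlam : (n : ℝ) < lam) (f : SymmMat n ℝ → ℂ)
    (X : SymmMat n ℝ) : ‖sFactor n lam f X‖ₑ ^ 2 * coneWeight lam X =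
      (posCone n).indicator (fun X => ‖f X‖ₑ ^ 2) X := by
  by_cases h : X ∈ posCone n
  · rw [sFactor, Set.indicator_of_mem h, Set.indicator_of_mem h, coneWeight_of_mem hlam h,
      enorm_mul, mul_pow]
    have hdet := det_pos_of_mem h
    have hc := sConst_pos hlam
    have hpos : 0 < sConst n lam * (mat X).det ^ (lam / 2 - ((n : ℝ) + 1) / 4) := by positivity
    rw [← ofReal_norm (E := ℂ) (Complex.ofReal _), Complex.norm_real, Real.norm_of_nonneg hpos.le,
      ← ENNReal.ofReal_pow hpos.le, mul_right_comm, ← ENNReal.ofReal_mul (by positivity),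
      mul_inv_cancel₀ (by positivity), ENNReal.ofReal_one, one_mul]
  · rw [sFactor, Set.indicator_of_notMem h, Set.indicator_of_notMem h]
    simp

theorem lintegral_enorm_sq_sFun {lam : ℝ} (hlam : (n : ℝ) < lam) {f : SymmMat n ℝ → ℂ}
    (hf : AEStronglyMeasurable f ((volume : Measure (SymmMat n ℝ)).restrict (posCone n))) :
    ∫⁻ p, ‖sFun n lam f p‖ₑ ^ 2 ∂(tubeMeasure n lam) = ∫⁻ X in posCone n, ‖f X‖ₑ ^ 2 := by
  simp only [sFun_eq]
  rw [lintegral_mul_exp (aestronglyMeasurable_sFactor lam hf),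
    ← lintegral_indicator isOpen_posCone.measurableSet]
  exact lintegral_congr fun X => enorm_sq_sFactor_mul_coneWeight hlam f X

theorem memLp_two_iff_lintegral {α : Type*} [MeasurableSpace α] {μ : Measure α} {f : α → ℂ}
    (hf : AEStronglyMeasurable f μ) : MemLp f 2 μ ↔ ∫⁻ x, ‖f x‖ₑ ^ 2 ∂μ < ∞ := by
  have := eLpNorm_nnreal_pow_eq_lintegral (f := f) (μ := μ) (p := (2 : NNReal)) (by norm_num)
  simp only [NNReal.coe_ofNat, ENNReal.rpow_ofNat] at this
  rw [← this]
  constructor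
  · intro h
    exact ENNReal.pow_lt_top h.2
  · intro h
    exact ⟨hf, (ENNReal.pow_lt_top_iff.1 h).resolve_right (by norm_num)⟩

theorem aestronglyMeasurable_sFun (lam : ℝ) {f : SymmMat n ℝ → ℂ}
    (hf : AEStronglyMeasurable f ((volume : Measure (SymmMat n ℝ)).restrict (posCone n))) :
    AEStronglyMeasurable (sFun n lam f) (tubeMeasure n lam) := by
  have : sFun n lam f = fun p => sFactor n lam f p.1 *
      ((Real.exp (-inner ℝ p.1 p.2) : ℝ) : ℂ) := funext (sFun_eq lam f)
  rw [this]
  exact aestronglyMeasurable_mul_exp (aestronglyMeasurable_sFactor lam hf)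

theorem memLp_sFun {lam : ℝ} (hlam : (n : ℝ) < lam) (f : ConeL2 n) :
    MemLp (sFun n lam f) 2 (tubeMeasure n lam) := by
  have hf := Lp.aestronglyMeasurable f
  rw [memLp_two_iff_lintegral (aestronglyMeasurable_sFun lam hf), lintegral_enorm_sq_sFun hlam hf,
    ← memLp_two_iff_lintegral hf]
  exact Lp.memLp f

theorem sFun_congr_ae {lam : ℝ} {f g : SymmMat n ℝ → ℂ}
    (h : f =ᵐ[(volume : Measure (SymmMat n ℝ)).restrict (posCone n)] g) :
    sFun n lam f =ᵐ[tubeMeasure n lam] sFun n lam g := by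
  rw [Filter.EventuallyEq, ae_restrict_iff' isOpen_posCone.measurableSet] at h
  filter_upwards [ae_prod_fst volume (coneMeasure n lam) h] with p hp
  rw [sFun_eq, sFun_eq, sFactor, sFactor]
  by_cases hm : p.1 ∈ posCone n
  · rw [Set.indicator_of_mem hm, Set.indicator_of_mem hm, hp hm]
  · rw [Set.indicator_of_notMem hm, Set.indicator_of_notMem hm]

/-- `f ↦ sFun n λ f` as an isometry. -/
def sIsometry {lam : ℝ} (hlam : (n : ℝ) < lam) :
    ConeL2 n →ₗᵢ[ℂ] Lp ℂ 2 (tubeMeasure n lam) where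
  toFun f := (memLp_sFun hlam f).toLp (sFun n lam f)
  map_add' f g := by
    apply Lp.ext
    filter_upwards [(memLp_sFun hlam (f + g)).coeFn_toLp, (memLp_sFun hlam f).coeFn_toLp,
      (memLp_sFun hlam g).coeFn_toLp, Lp.coeFn_add ((memLp_sFun hlam f).toLp (sFun n lam f))
      ((memLp_sFun hlam g).toLp (sFun n lam g)),
      sFun_congr_ae (lam := lam) (Lp.coeFn_add f g)] with p h1 h2 h3 h4 h5
    rw [h1, h4, h5, Pi.add_apply, h2, h3, sFun_eq, sFun_eq, sFun_eq, ← add_mul, sFactor, sFactor,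
      sFactor]
    by_cases hm : p.1 ∈ posCone n
    · simp only [Set.indicator_of_mem hm, Pi.add_apply, mul_add]
    · simp only [Set.indicator_of_notMem hm, add_zero]
  map_smul' c f := by
    apply Lp.ext
    filter_upwards [(memLp_sFun hlam (c • f)).coeFn_toLp, (memLp_sFun hlam f).coeFn_toLp,
      Lp.coeFn_smul c ((memLp_sFun hlam f).toLp (sFun n lam f)),
      sFun_congr_ae (lam := lam) (Lp.coeFn_smul c f)] with p h1 h2 h3 h5
    rw [h1, RingHom.id_apply, h3, h5, Pi.smul_apply, h2, sFun_eq, sFun_eq, sFactor, sFactor,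
      smul_eq_mul, ← mul_assoc]
    by_cases hm : p.1 ∈ posCone n
    · rw [Set.indicator_of_mem hm, Set.indicator_of_mem hm, Pi.smul_apply, smul_eq_mul]
      ring
    · rw [Set.indicator_of_notMem hm, Set.indicator_of_notMem hm, mul_zero]
  norm_map' f := by
    have h1 := Lp.enorm_sq_eq_lintegral ((memLp_sFun hlam f).toLp (sFun n lam f))
    have h2 : ∫⁻ p, ‖(memLp_sFun hlam f).toLp (sFun n lam f) p‖ₑ ^ 2 ∂(tubeMeasure n lam) =
        ∫⁻ p, ‖sFun n lam f p‖ₑ ^ 2 ∂(tubeMeasure n lam) :=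
      lintegral_congr_ae (by
        filter_upwards [(memLp_sFun hlam f).coeFn_toLp] with p hp
        rw [hp])
    rw [h2, lintegral_enorm_sq_sFun hlam (Lp.aestronglyMeasurable f),
      ← Lp.enorm_sq_eq_lintegral f] at h1
    have h3 := (ENNReal.pow_right_strictMono two_ne_zero).injective h1
    change ‖(memLp_sFun hlam f).toLp (sFun n lam f)‖ = ‖f‖
    rw [← toReal_enorm, h3, toReal_enorm]

/-- The isometry `sIsometry` witnesses the existence clause in the definition of `sOp`, so the
default value `0` is not taken. -/
theorem sOp_coe {lam : ℝ} (hlam : (n : ℝ) < lam) (f : ConeL2 n) :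
    sOp n lam f =ᵐ[tubeMeasure n lam] sFun n lam f := by
  have h : ∃ S : ConeL2 n →L[ℂ] Lp ℂ 2 (tubeMeasure n lam),
      ∀ f, S f =ᵐ[tubeMeasure n lam] sFun n lam f :=
    ⟨(sIsometry hlam).toContinuousLinearMap, fun f => (memLp_sFun hlam f).coeFn_toLp⟩
  rw [sOp, dif_pos h]
  exact h.choose_spec f

theorem norm_sOp {lam : ℝ} (hlam : (n : ℝ) < lam) (f : ConeL2 n) : ‖sOp n lam f‖ = ‖f‖ := by
  have : sOp n lam f = sIsometry hlam f :=
    Lp.ext ((sOp_coe hlam f).trans (memLp_sFun hlam f).coeFn_toLp.symm)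
  rw [this, LinearIsometry.norm_map]

theorem adjoint_rOp_apply (lam : ℝ) (f : ConeL2 n) :
    (rOp n lam).adjoint f = (partialFourier n lam).symm (sOp n lam f) := by
  rw [rOp, ContinuousLinearMap.adjoint_comp, ContinuousLinearMap.adjoint_adjoint]
  have : ((partialFourier n lam).toContinuousLinearEquiv.toContinuousLinearMap).adjoint =
      ((partialFourier n lam).symm.toContinuousLinearEquiv.toContinuousLinearMap) :=
    LinearIsometryEquiv.adjoint_eq_symm _
  rw [this]
  rfl

theorem norm_adjoint_rOp {lam : ℝ} (hlam : (n : ℝ) < lam) (f : ConeL2 n) :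
    ‖(rOp n lam).adjoint f‖ = ‖f‖ := by
  rw [adjoint_rOp_apply, LinearIsometryEquiv.norm_map, norm_sOp hlam]

end IsometryS

/-! ### The adjoint as a Fourier-Laplace transform. -/

section AdjointFormula

open SymmMat

variable {n : ℕ}

/-- Its square integrates to the gamma integral with parameter `λ` at `2η`. By Cauchy-Schwarz the
Laplace integral of every `f ∈ L²(Ω)` then converges absolutely. -/
theorem memLp_det_rpow_mul_exp {lam : ℝ} (hlam : (n : ℝ) < lam) {η : SymmMat n ℝ}
    (hη : η ∈ posCone n) :
    MemLp (fun ξ : SymmMat n ℝ => (((mat ξ).det ^ (lam / 2 - ((n : ℝ) + 1) / 4) *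
      Real.exp (-inner ℝ ξ η) : ℝ) : ℂ)) 2 (volume.restrict (posCone n)) := by
  have hm : AEStronglyMeasurable (fun ξ : SymmMat n ℝ =>
      (((mat ξ).det ^ (lam / 2 - ((n : ℝ) + 1) / 4) * Real.exp (-inner ℝ ξ η) : ℝ) : ℂ))
      (volume.restrict (posCone n)) := by
    refine ContinuousOn.aestronglyMeasurable ?_ isOpen_posCone.measurableSet
    refine Complex.continuous_ofReal.comp_continuousOn ((continuousOn_det_rpow _).mul ?_)
    fun_prop
  rw [memLp_two_iff_lintegral hm]
  have h0 : (0 : ℝ) ≤ n := n.cast_nonneg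
  have hs : ((n : ℝ) - 1) / 2 < lam := by linarith
  have key := coneIntegral_of_mem hs (two_smul_mem_posCone.2 hη)
  have : ∫⁻ ξ : SymmMat n ℝ in posCone n,
      ‖(((mat ξ).det ^ (lam / 2 - ((n : ℝ) + 1) / 4) * Real.exp (-inner ℝ ξ η) : ℝ) : ℂ)‖ₑ ^ 2 =
      coneIntegral (lam - ((n : ℝ) + 1) / 2) ((2 : ℝ) • η) := by
    rw [coneIntegral]
    refine setLIntegral_congr_fun isOpen_posCone.measurableSet fun ξ hξ => ?_
    have hdet := det_pos_of_mem hξ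
    have hpos : 0 < (mat ξ).det ^ (lam / 2 - ((n : ℝ) + 1) / 4) * Real.exp (-inner ℝ ξ η) := by
      positivity
    rw [← ofReal_norm, Complex.norm_real, Real.norm_of_nonneg hpos.le,
      ← ENNReal.ofReal_pow hpos.le, mul_pow, ← Real.rpow_natCast _ 2, ← Real.rpow_mul hdet.le,
      ← Real.exp_nat_mul, inner_smul_left, real_inner_comm, mul_comm]
    have e1 : ((2 : ℕ) : ℝ) * -inner ℝ η ξ = -((starRingEnd ℝ) 2 * inner ℝ η ξ) := by simp
    have e2 : (lam / 2 - ((n : ℝ) + 1) / 4) * ((2 : ℕ) : ℝ) = lam - ((n : ℝ) + 1) / 2 := by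
      push_cast; ring
    rw [e1, e2]
  rw [this, key]
  exact ENNReal.ofReal_lt_top

theorem aestronglyMeasurable_mul_det_rpow (b : ℝ) {f : SymmMat n ℝ → ℂ}
    (hf : AEStronglyMeasurable f ((volume : Measure (SymmMat n ℝ)).restrict (posCone n))) :
    AEStronglyMeasurable (fun ξ => f ξ * (((mat ξ).det ^ b : ℝ) : ℂ))
      (volume.restrict (posCone n)) :=
  hf.mul ((Complex.continuous_ofReal.comp_continuousOn
    (continuousOn_det_rpow b)).aestronglyMeasurable isOpen_posCone.measurableSet)

theorem integrable_norm_mul_exp {lam : ℝ} (hlam : (n : ℝ) < lam) (f : ConeL2 n)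
    {η : SymmMat n ℝ} (hη : η ∈ posCone n) :
    Integrable (fun ξ : SymmMat n ℝ =>
      ‖f ξ * (((mat ξ).det ^ (lam / 2 - ((n : ℝ) + 1) / 4) : ℝ) : ℂ)‖ * Real.exp (-inner ℝ ξ η))
      (volume.restrict (posCone n)) := by
  refine ((Lp.memLp f).integrable_mul (memLp_det_rpow_mul_exp hlam hη)).norm.congr
    (Filter.Eventually.of_forall fun ξ => ?_)
  simp only [Pi.mul_apply]
  rw [Complex.ofReal_mul, ← mul_assoc, norm_mul, Complex.norm_real (Real.exp _),
    Real.norm_of_nonneg (Real.exp_pos _).le]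

theorem laplaceIntegrand_eq (lam : ℝ) (f : SymmMat n ℝ → ℂ) (Z : SymmMat n ℂ) (ξ : SymmMat n ℝ) :
    laplaceIntegrand n lam f Z ξ =
      f ξ * (((mat ξ).det ^ (lam / 2 - ((n : ℝ) + 1) / 4) : ℝ) : ℂ) *
        Complex.exp (Complex.I * inner ℂ (ofReal ξ) Z) := by
  rw [laplaceIntegrand, inner_ofReal]

theorem integrableOn_laplaceIntegrand {lam : ℝ} (hlam : (n : ℝ) < lam) (f : ConeL2 n)
    {Z : SymmMat n ℂ} (hZ : Z ∈ siegelDomain n) :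
    IntegrableOn (laplaceIntegrand n lam f Z) (posCone n) volume := by
  have hcO := continuous_ofReal (n := n)
  have hm : AEStronglyMeasurable (laplaceIntegrand n lam f Z)
      ((volume : Measure (SymmMat n ℝ)).restrict (posCone n)) := by
    have : laplaceIntegrand n lam f Z = fun ξ => _ := funext (laplaceIntegrand_eq lam f Z)
    rw [this]
    exact (aestronglyMeasurable_mul_det_rpow _ (Lp.aestronglyMeasurable f)).mul
      (by fun_prop : Continuous fun ξ => Complex.exp
        (Complex.I * inner ℂ (ofReal ξ) Z)).aestronglyMeasurable
  refine (integrable_norm_mul_exp hlam f (η := im Z) hZ).mono hm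
    (Filter.Eventually.of_forall fun ξ => ?_)
  rw [laplaceIntegrand_eq, norm_mul _ (Complex.exp _), Complex.norm_exp, re_I_mul_inner_ofReal]
  exact le_abs_self _

/-- If `Im Z ≥ δ`, then `tr(ξ Im Z) ≥ δ tr ξ` on the cone. Half of this decay pays for the surplus
`e^((δ/2)‖ξ‖)`, since `‖ξ‖ ≤ tr ξ`; the other half is `e^(-tr(ξη))` with `η = (δ/2) 1`, which
suffices for integrability. -/
theorem differentiableOn_fourierLaplace {lam : ℝ} (hlam : (n : ℝ) < lam) (f : ConeL2 n) :
    DifferentiableOn ℂ (fourierLaplace n lam f) (siegelDomain n) := by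
  have hp := aestronglyMeasurable_mul_det_rpow (lam / 2 - ((n : ℝ) + 1) / 4)
    (Lp.aestronglyMeasurable f)
  refine DifferentiableOn.const_mul ?_ _
  simp only [laplaceIntegrand_eq]
  refine differentiableOn_laplace hp fun Z hZ => ?_
  obtain ⟨δ, hδ, hle⟩ := exists_pos_mul_le (n := n) (Y := im Z) hZ
  have hη : (δ / 2) • oneSymm n ∈ posCone n := by
    refine mem_posCone_of_pos_mul_le (half_pos hδ) fun x => ?_
    rw [map_smul, mat_oneSymm, Matrix.smul_mulVec, Matrix.one_mulVec, dotProduct_smul, smul_eq_mul]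
  refine ⟨δ / 2, half_pos hδ, (integrable_norm_mul_exp hlam f hη).mono
    (hp.norm.mul (by fun_prop : Continuous fun ξ : SymmMat n ℝ =>
      Real.exp (-inner ℝ ξ (im Z) + δ / 2 * ‖ξ‖)).aestronglyMeasurable) ?_⟩
  filter_upwards [ae_restrict_mem isOpen_posCone.measurableSet] with ξ hξ
  have hps := Matrix.PosDef.posSemidef (show (mat ξ).PosDef from hξ)
  have h1 := mul_trace_le_inner hps hle
  have h2 := norm_le_trace hps
  rw [inner_real] at h1
  rw [norm_mul _ (Real.exp _), norm_mul _ (Real.exp _), norm_norm,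
    Real.norm_of_nonneg (Real.exp_pos _).le, Real.norm_of_nonneg (Real.exp_pos _).le]
  refine mul_le_mul_of_nonneg_left (Real.exp_le_exp.2 ?_) (norm_nonneg _)
  rw [inner_smul_right, inner_oneSymm, inner_real]
  nlinarith

theorem sFun_mul_exp {lam : ℝ} (f : SymmMat n ℝ → ℂ) (X Y ξ : SymmMat n ℝ) :
    sFun n lam f (ξ, Y) * Complex.exp (Complex.I * (inner ℝ X ξ : ℝ)) =
      (posCone n).indicator (fun ξ => ((sConst n lam : ℝ) : ℂ) *
        laplaceIntegrand n lam f (complexEquiv n (X, Y)) ξ) ξ := by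
  rw [sFun_eq, sFactor]
  by_cases h : ξ ∈ posCone n
  · rw [Set.indicator_of_mem h, Set.indicator_of_mem h, laplaceIntegrand_eq,
      inner_ofReal_complexEquiv, mul_add, Complex.exp_add, ← mul_assoc Complex.I Complex.I,
      Complex.I_mul_I, real_inner_comm X ξ]
    push_cast
    rw [neg_one_mul]
    ring
  · rw [Set.indicator_of_notMem h, Set.indicator_of_notMem h, zero_mul, zero_mul]

/-- The exponentials `e^(-tr(ξY))` and `e^(i tr(ξX))` combine to `e^(i tr(ξZ))`. The powers of `2π`
cancel because the space has dimension `n(n+1)/2`. -/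
theorem integral_sFun_mul_exp (lam : ℝ) (f : SymmMat n ℝ → ℂ) (X Y : SymmMat n ℝ) :
    (((2 * Real.pi) ^ (-((Module.finrank ℝ (SymmMat n ℝ) : ℝ) / 2)) : ℝ) : ℂ) *
      ∫ ξ, sFun n lam f (ξ, Y) * Complex.exp (Complex.I * (inner ℝ X ξ : ℝ)) =
    fourierLaplace n lam f (complexEquiv n (X, Y)) := by
  simp only [sFun_mul_exp]
  rw [integral_indicator isOpen_posCone.measurableSet, integral_const_mul, ← mul_assoc,
    ← Complex.ofReal_mul, fourierLaplace, finrank_symmMat, sConst, ← mul_div_assoc,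
    ← Real.rpow_add (by positivity)]
  congr 3
  rw [show -((n : ℝ) * (n + 1) / 2 / 2) + (n : ℝ) * (n + 1) / 4 = 0 by ring, Real.rpow_zero]

theorem integrable_sFun {lam : ℝ} (hlam : (n : ℝ) < lam) (f : ConeL2 n) {Y : SymmMat n ℝ}
    (hY : Y ∈ posCone n) : Integrable fun ξ => sFun n lam f (ξ, Y) := by
  have hZ : complexEquiv n (0, Y) ∈ siegelDomain n := complexEquiv_mem_siegelDomain.2 hY
  have h1 := (integrable_indicator_iff isOpen_posCone.measurableSet).2
    ((integrableOn_laplaceIntegrand hlam f hZ).const_mul ((sConst n lam : ℝ) : ℂ))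
  refine h1.congr (Filter.Eventually.of_forall fun ξ => ?_)
  have h2 := sFun_mul_exp (lam := lam) f 0 Y ξ
  simp only [inner_zero_left, Complex.ofReal_zero, mul_zero, Complex.exp_zero, mul_one] at h2
  exact h2.symm

theorem ae_eq_prod_of_ae_ae {α β : Type*} [MeasurableSpace α] [MeasurableSpace β] {μ : Measure α}
    {ν : Measure β} [SigmaFinite μ] [SigmaFinite ν] {u v : α × β → ℂ}
    (hu : AEStronglyMeasurable u (μ.prod ν)) (hv : AEStronglyMeasurable v (μ.prod ν))
    (h : ∀ᵐ y ∂ν, (fun x => u (x, y)) =ᵐ[μ] fun x => v (x, y)) : u =ᵐ[μ.prod ν] v := by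
  have hm := (hu.sub hv).enorm
  have h0 : ∫⁻ z, ‖(u - v) z‖ₑ ∂(μ.prod ν) = 0 := by
    rw [lintegral_prod_symm _ hm]
    refine (lintegral_congr_ae ?_).trans lintegral_zero
    filter_upwards [h] with y hy
    refine (lintegral_congr_ae ?_).trans lintegral_zero
    filter_upwards [hy] with x hx
    simp [hx]
  filter_upwards [(lintegral_eq_zero_iff' hm).1 h0] with z hz
  exact sub_eq_zero.1 (by simpa using hz)

theorem siegelIsometry_coe (lam : ℝ) (φ : Lp ℂ 2 (siegelMeasure n lam)) :
    siegelIsometry n lam φ =ᵐ[tubeMeasure n lam] fun p => φ (complexEquiv n p) :=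
  Lp.coeFn_compMeasurePreserving φ (measurePreserving_complexEquiv n lam)

theorem ae_siegelMeasure_iff {lam : ℝ} {p : SymmMat n ℂ → Prop} :
    (∀ᵐ Z ∂(siegelMeasure n lam), p Z) ↔ ∀ᵐ x ∂(tubeMeasure n lam), p (complexEquiv n x) := by
  rw [← (measurePreserving_complexEquiv n lam).map_eq]
  exact (complexMeasurableEquiv n).measurableEmbedding.ae_map_iff

theorem ae_coneMeasure_mem (lam : ℝ) : ∀ᵐ Y ∂(coneMeasure n lam), Y ∈ posCone n :=
  (withDensity_absolutelyContinuous _ _).ae_le (ae_restrict_mem isOpen_posCone.measurableSet)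

/-- On almost every fibre `U` acts as `ℱ`, and the slice of `S_λ f` there lies in `L¹ ∩ L²`, so that
`ℱ⁻¹` is computed by its integral. Equality on almost every fibre gives equality almost everywhere
in the product. -/
theorem adjoint_rOp_ae_eq {lam : ℝ} (hlam : (n : ℝ) < lam) (f : ConeL2 n) :
    (rOp n lam).adjoint f =ᵐ[siegelMeasure n lam] fourierLaplace n lam f := by
  set φ := (rOp n lam).adjoint f with hφ
  set ψ := siegelIsometry n lam φ with hψ
  have hT : L2.tensorId volume (coneMeasure n lam) (unitaryFourier (SymmMat n ℝ)) ψ =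
      sOp n lam f := by
    have : partialFourier n lam φ = sOp n lam f := by
      rw [hφ, adjoint_rOp_apply, LinearIsometryEquiv.apply_symm_apply]
    exact this
  have hdiff := differentiableOn_fourierLaplace hlam f
  have key : ψ =ᵐ[tubeMeasure n lam] fun p => fourierLaplace n lam f (complexEquiv n p) := by
    refine ae_eq_prod_of_ae_ae (Lp.aestronglyMeasurable ψ)
      (aestronglyMeasurable_tubeMeasure hdiff.continuousOn) ?_
    filter_upwards [actsOnFibre_ae volume (coneMeasure n lam) (unitaryFourier (SymmMat n ℝ)) ψ,
      ae_ae_swap_of_ae_prod (sOp_coe hlam f), ae_memLp_fibre (memLp_sFun hlam f),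
      ae_coneMeasure_mem lam] with Y ⟨u, hu, hTu⟩ h1 h2 h3
    rw [hT] at hTu
    have e1 : unitaryFourier (SymmMat n ℝ) u = h2.toLp (fun X => sFun n lam f (X, Y)) :=
      Lp.ext ((hTu.symm.trans h1).trans h2.coeFn_toLp.symm)
    have e2 : u = (unitaryFourier (SymmMat n ℝ)).symm (h2.toLp (fun X => sFun n lam f (X, Y))) := by
      rw [← e1, LinearIsometryEquiv.symm_apply_apply]
    have e3 := unitaryFourier_symm_toLp (integrable_sFun hlam f h3) h2
    rw [← e2] at e3
    filter_upwards [hu, e3] with X a1 a2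
    exact a1.trans (a2.trans (integral_sFun_mul_exp lam f X Y))
  rw [Filter.EventuallyEq, ae_siegelMeasure_iff]
  filter_upwards [key, siegelIsometry_coe lam φ] with p h1 h2
  rw [← h2, h1]

end AdjointFormula

/-! ### The Paley-Wiener direction: Bergman functions lie in the range. -/

section PaleyWiener

open SymmMat

variable {n : ℕ}

/-- The function `ξ ↦ e^(tr(ξY)) κ(ξ)`. -/
def expTilt (κ : SymmMat n ℝ → ℂ) (Y ξ : SymmMat n ℝ) : ℂ :=
  ((Real.exp (inner ℝ ξ Y) : ℝ) : ℂ) * κ ξ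

theorem norm_expTilt_le {κ : SymmMat n ℝ → ℂ} {R : ℝ} (hR : ∀ ξ, R < ‖ξ‖ → κ ξ = 0)
    (Y ξ : SymmMat n ℝ) : ‖expTilt κ Y ξ‖ ≤ Real.exp (R * ‖Y‖) * ‖κ ξ‖ := by
  rw [expTilt, norm_mul, Complex.norm_real, Real.norm_of_nonneg (Real.exp_pos _).le]
  by_cases h : R < ‖ξ‖
  · simp [hR ξ h]
  · refine mul_le_mul_of_nonneg_right (Real.exp_le_exp.2 ?_) (norm_nonneg _)
    exact (real_inner_le_norm ξ Y).trans
      (mul_le_mul_of_nonneg_right (not_lt.1 h) (norm_nonneg _))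

theorem aestronglyMeasurable_expTilt {κ : SymmMat n ℝ → ℂ} (hκ : AEStronglyMeasurable κ volume)
    (Y : SymmMat n ℝ) : AEStronglyMeasurable (expTilt κ Y) volume :=
  (by fun_prop : Continuous fun ξ : SymmMat n ℝ =>
    ((Real.exp (inner ℝ ξ Y) : ℝ) : ℂ)).aestronglyMeasurable.mul hκ

theorem memLp_expTilt {κ : SymmMat n ℝ → ℂ} {p : ℝ≥0∞} (hκ : MemLp κ p volume) {R : ℝ}
    (hR : ∀ ξ, R < ‖ξ‖ → κ ξ = 0) (Y : SymmMat n ℝ) : MemLp (expTilt κ Y) p volume :=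
  hκ.of_le_mul (aestronglyMeasurable_expTilt hκ.1 Y)
    (Filter.Eventually.of_forall fun ξ => norm_expTilt_le hR Y ξ)

theorem integrable_of_memLp_of_support {κ : SymmMat n ℝ → ℂ} (hκ : MemLp κ 2 volume) {R : ℝ}
    (hR : ∀ ξ, R < ‖ξ‖ → κ ξ = 0) : Integrable κ := by
  have : ProperSpace (SymmMat n ℝ) := FiniteDimensional.proper ℝ _
  have hfin : IsFiniteMeasure ((volume : Measure (SymmMat n ℝ)).restrict
      (Metric.closedBall 0 R)) := ⟨by
    simpa using (isCompact_closedBall (0 : SymmMat n ℝ) R).measure_lt_top⟩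
  have h1 : IntegrableOn κ (Metric.closedBall 0 R) :=
    (hκ.restrict (Metric.closedBall 0 R)).integrable (by norm_num)
  refine (integrableOn_iff_integrable_of_support_subset fun ξ hξ => ?_).1 h1
  rw [mem_closedBall_zero_iff]
  exact not_lt.1 fun h => hξ (hR ξ h)

/-- The conjugate of the Laplace transform of a compactly supported function. -/
def conjLaplace (κ : SymmMat n ℝ → ℂ) (Z : SymmMat n ℂ) : ℂ :=
  (((2 * Real.pi) ^ (-((Module.finrank ℝ (SymmMat n ℝ) : ℝ) / 2)) : ℝ) : ℂ) *
    ∫ ξ, (starRingEnd ℂ) (κ ξ) * Complex.exp (Complex.I * inner ℂ (ofReal ξ) (-Z))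

theorem differentiable_conjLaplace {κ : SymmMat n ℝ → ℂ} (hκ : Integrable κ) {R : ℝ}
    (hR : ∀ ξ, R < ‖ξ‖ → κ ξ = 0) : Differentiable ℂ (conjLaplace κ) := by
  have hm : AEStronglyMeasurable (fun ξ => (starRingEnd ℂ) (κ ξ)) volume :=
    Complex.continuous_conj.comp_aestronglyMeasurable hκ.1
  have h := differentiableOn_laplace (m := volume) hm (U := Set.univ) fun Z _ =>
    ⟨1, one_pos, by
      refine (hκ.norm.mul_const (Real.exp (R * ‖im Z‖ + R))).mono'
        (hm.norm.mul (by fun_prop : Continuous fun ξ : SymmMat n ℝ =>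
          Real.exp (-inner ℝ ξ (im Z) + 1 * ‖ξ‖)).aestronglyMeasurable)
        (Filter.Eventually.of_forall fun ξ => ?_)
      rw [norm_mul, norm_norm, RCLike.norm_conj, Real.norm_of_nonneg (Real.exp_pos _).le]
      by_cases hξ : R < ‖ξ‖
      · simp [hR ξ hξ]
      · refine mul_le_mul_of_nonneg_left (Real.exp_le_exp.2 ?_) (norm_nonneg _)
        have h1 := neg_le_of_abs_le (abs_real_inner_le_norm ξ (im Z))
        have h2 := mul_le_mul_of_nonneg_right (not_lt.1 hξ) (norm_nonneg (im Z))
        linarith⟩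
  have h' := differentiableOn_univ.1 h
  have hneg : Differentiable ℂ fun Z : SymmMat n ℂ => -Z :=
    (-ContinuousLinearMap.id ℂ (SymmMat n ℂ)).differentiable
  exact (h'.comp hneg).const_mul _

/-- The complex conjugate of this inverse transform is an entire function of `Z = X + iY`. The inner
product conjugates its first argument, so pairing with a slice of a holomorphic `F` yields a slice
integral of a holomorphic function. -/
theorem unitaryFourier_symm_expTilt {κ : SymmMat n ℝ → ℂ} (hκ : MemLp κ 2 volume) {R : ℝ}
    (hR : ∀ ξ, R < ‖ξ‖ → κ ξ = 0) (Y : SymmMat n ℝ) :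
    (unitaryFourier (SymmMat n ℝ)).symm ((memLp_expTilt hκ hR Y).toLp (expTilt κ Y)) =ᵐ[volume]
      fun X => (starRingEnd ℂ) (conjLaplace κ (complexEquiv n (X, Y))) := by
  have h1 := integrable_of_memLp_of_support hκ hR
  have h2 : Integrable (expTilt κ Y) :=
    memLp_one_iff_integrable.1 (memLp_expTilt (memLp_one_iff_integrable.2 h1) hR Y)
  refine (unitaryFourier_symm_toLp h2 (memLp_expTilt hκ hR Y)).trans
    (Filter.Eventually.of_forall fun X => ?_)
  simp only [conjLaplace]
  rw [map_mul, Complex.conj_ofReal, ← integral_conj]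
  congr 1
  refine integral_congr_ae (Filter.Eventually.of_forall fun ξ => ?_)
  simp only [expTilt]
  rw [map_mul, Complex.conj_conj, ← Complex.exp_conj, inner_neg_right, inner_ofReal_complexEquiv,
    real_inner_comm X ξ]
  simp only [map_mul, map_neg, map_add, Complex.conj_I, Complex.conj_ofReal]
  have : -Complex.I * -(((inner ℝ X ξ : ℝ) : ℂ) + -Complex.I * ((inner ℝ ξ Y : ℝ) : ℂ)) =
      ((inner ℝ ξ Y : ℝ) : ℂ) + Complex.I * ((inner ℝ X ξ : ℝ) : ℂ) := by
    linear_combination (-((inner ℝ ξ Y : ℝ) : ℂ)) * Complex.I_mul_I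
  rw [this, Complex.exp_add]
  push_cast
  ring

/-- Plancherel on the slice; on the support of `κ` the tilt is at most `e^(R‖Y‖)`. -/
theorem sliceLIntegral_conjLaplace_le {κ : SymmMat n ℝ → ℂ} (hκ : MemLp κ 2 volume) {R : ℝ}
    (hR : ∀ ξ, R < ‖ξ‖ → κ ξ = 0) (Y : SymmMat n ℝ) :
    sliceLIntegral 2 (conjLaplace κ) Y ≤
      ENNReal.ofReal (Real.exp (R * ‖Y‖)) ^ 2 * ∫⁻ ξ, ‖κ ξ‖ₑ ^ 2 := by
  have hq := memLp_expTilt hκ hR Y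
  have h1 : sliceLIntegral 2 (conjLaplace κ) Y =
      ‖(unitaryFourier (SymmMat n ℝ)).symm (hq.toLp (expTilt κ Y))‖ₑ ^ 2 := by
    rw [Lp.enorm_sq_eq_lintegral, sliceLIntegral]
    refine lintegral_congr_ae ?_
    filter_upwards [unitaryFourier_symm_expTilt hκ hR Y] with X hX
    rw [hX, RCLike.enorm_conj]
  rw [h1, LinearIsometryEquiv.enorm_map, Lp.enorm_sq_eq_lintegral,
    ← lintegral_const_mul' _ _ (by simp)]
  refine lintegral_mono_ae ?_
  filter_upwards [hq.coeFn_toLp] with ξ hξ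
  rw [hξ, ← mul_pow]
  gcongr
  rw [← ofReal_norm, ← ofReal_norm, ← ENNReal.ofReal_mul (Real.exp_pos _).le]
  exact ENNReal.ofReal_le_ofReal (norm_expTilt_le hR Y ξ)

theorem sliceLIntegral_one_mul_le {F G : SymmMat n ℂ → ℂ} {Y : SymmMat n ℝ}
    (hF : AEStronglyMeasurable (fun X => F (complexEquiv n (X, Y))) volume) :
    sliceLIntegral 1 (fun Z => F Z * G Z) Y ≤ sliceLIntegral 2 F Y + sliceLIntegral 2 G Y := by
  simp only [sliceLIntegral, pow_one]
  rw [← lintegral_add_left' (hF.enorm.pow_const 2)]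
  refine lintegral_mono fun X => ?_
  rw [enorm_mul, sq, sq]
  rcases le_total ‖F (complexEquiv n (X, Y))‖ₑ ‖G (complexEquiv n (X, Y))‖ₑ with h | h
  · exact (mul_le_mul_left h _).trans le_add_self
  · exact (mul_le_mul_right h _).trans le_self_add

theorem continuous_slice {F : SymmMat n ℂ → ℂ} (hF : ContinuousOn F (siegelDomain n))
    {Y : SymmMat n ℝ} (hY : Y ∈ posCone n) : Continuous fun X => F (complexEquiv n (X, Y)) :=
  hF.comp_continuous (continuous_complexEquiv.comp (by fun_prop))
    fun _ => complexEquiv_mem_siegelDomain.2 hY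

theorem memLp_slice {lam : ℝ} (hlam : (n : ℝ) < lam) {F : SymmMat n ℂ → ℂ}
    (hF : DifferentiableOn ℂ F (siegelDomain n))
    (hint : ∫⁻ p, ‖F (complexEquiv n p)‖ₑ ^ 2 ∂(tubeMeasure n lam) < ∞)
    {Y : SymmMat n ℝ} (hY : Y ∈ posCone n) :
    MemLp (fun X => F (complexEquiv n (X, Y))) 2 volume := by
  rw [memLp_two_iff_lintegral (continuous_slice hF.continuousOn hY).aestronglyMeasurable]
  obtain ⟨ρ, hρ, C, hC, hle⟩ := exists_sliceLIntegral_le hlam hF hint hY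
  exact (hle Y (Metric.mem_ball_self hρ)).trans_lt hC

theorem inner_expTilt_unitaryFourier_slice {F : SymmMat n ℂ → ℂ} {Y : SymmMat n ℝ}
    (hFY : MemLp (fun X => F (complexEquiv n (X, Y))) 2 volume)
    {κ : SymmMat n ℝ → ℂ} (hκ : MemLp κ 2 volume) {R : ℝ} (hR : ∀ ξ, R < ‖ξ‖ → κ ξ = 0) :
    inner ℂ ((memLp_expTilt hκ hR Y).toLp (expTilt κ Y))
      (unitaryFourier (SymmMat n ℝ) (hFY.toLp _)) =
    ∫ X, F (complexEquiv n (X, Y)) * conjLaplace κ (complexEquiv n (X, Y)) := by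
  rw [← LinearIsometryEquiv.inner_map_map (unitaryFourier (SymmMat n ℝ)).symm,
    LinearIsometryEquiv.symm_apply_apply, L2.inner_def]
  refine integral_congr_ae ?_
  filter_upwards [unitaryFourier_symm_expTilt hκ hR Y, hFY.coeFn_toLp] with X h1 h2
  rw [h1, h2]
  simp

/-- The real factor `e^(tr(ξY))` moves freely from `κ` to the transform of `F`, and Plancherel does
the rest. The right-hand side is then open to the contour shift in `Y`. -/
theorem integral_conj_mul_expTilt {F : SymmMat n ℂ → ℂ} {Y : SymmMat n ℝ}
    (hFY : MemLp (fun X => F (complexEquiv n (X, Y))) 2 volume)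
    {κ : SymmMat n ℝ → ℂ} (hκ : MemLp κ 2 volume) {R : ℝ} (hR : ∀ ξ, R < ‖ξ‖ → κ ξ = 0) :
    Integrable (fun ξ => (starRingEnd ℂ) (κ ξ) *
      expTilt (unitaryFourier (SymmMat n ℝ) (hFY.toLp _)) Y ξ) ∧
    ∫ ξ, (starRingEnd ℂ) (κ ξ) * expTilt (unitaryFourier (SymmMat n ℝ) (hFY.toLp _)) Y ξ =
      ∫ X, F (complexEquiv n (X, Y)) * conjLaplace κ (complexEquiv n (X, Y)) := by
  have hq := memLp_expTilt hκ hR Y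
  have e : (fun ξ => inner ℂ (hq.toLp (expTilt κ Y) ξ)
      (unitaryFourier (SymmMat n ℝ) (hFY.toLp _) ξ)) =ᵐ[volume] fun ξ =>
      (starRingEnd ℂ) (κ ξ) * expTilt (unitaryFourier (SymmMat n ℝ) (hFY.toLp _)) Y ξ := by
    filter_upwards [hq.coeFn_toLp] with ξ hξ
    rw [hξ, expTilt, expTilt, RCLike.inner_apply, map_mul, Complex.conj_ofReal]
    ring
  refine ⟨(L2.integrable_inner _ _).congr e, ?_⟩
  rw [← integral_congr_ae e, ← L2.inner_def, inner_expTilt_unitaryFourier_slice hFY hκ hR]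

/-- The functions `ξ ↦ e^(tr(ξY)) (ℱ F(· + iY))(ξ)` agree for all `Y` in the cone. -/
theorem expTilt_unitaryFourier_slice_ae_eq {lam : ℝ} (hlam : (n : ℝ) < lam)
    {F : SymmMat n ℂ → ℂ} (hF : DifferentiableOn ℂ F (siegelDomain n))
    (hint : ∫⁻ p, ‖F (complexEquiv n p)‖ₑ ^ 2 ∂(tubeMeasure n lam) < ∞)
    {Y₀ Y₁ : SymmMat n ℝ} (hY₀ : Y₀ ∈ posCone n) (hY₁ : Y₁ ∈ posCone n) :
    expTilt (unitaryFourier (SymmMat n ℝ) ((memLp_slice hlam hF hint hY₀).toLp _)) Y₀ =ᵐ[volume]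
      expTilt (unitaryFourier (SymmMat n ℝ) ((memLp_slice hlam hF hint hY₁).toLp _)) Y₁ := by
  set u₀ := unitaryFourier (SymmMat n ℝ) ((memLp_slice hlam hF hint hY₀).toLp _)
  set u₁ := unitaryFourier (SymmMat n ℝ) ((memLp_slice hlam hF hint hY₁).toLp _)
  have hloc : ∀ R : ℕ, ∀ᵐ ξ : SymmMat n ℝ, ‖ξ‖ ≤ R → expTilt u₀ Y₀ ξ = expTilt u₁ Y₁ ξ := by
    intro R
    -- The truncated difference of the two functions is itself the test function: its pairing with
    -- the difference is `∫ ‖κ‖²`, which the contour shift shows to be zero.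
    set κ : SymmMat n ℝ → ℂ :=
      (Metric.closedBall 0 (R : ℝ)).indicator (expTilt u₀ Y₀ - expTilt u₁ Y₁) with hκdef
    have hind : ∀ (u : Lp ℂ 2 (volume : Measure (SymmMat n ℝ))) (Y : SymmMat n ℝ),
        MemLp ((Metric.closedBall 0 (R : ℝ)).indicator (expTilt u Y)) 2 volume := by
      intro u Y
      have h1 : MemLp ((Metric.closedBall 0 (R : ℝ)).indicator u) 2 volume :=
        (Lp.memLp u).indicator measurableSet_closedBall
      have h2 := memLp_expTilt h1 (R := R) (fun ξ hξ => Set.indicator_of_notMem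
        (fun h => not_le.2 hξ (mem_closedBall_zero_iff.1 h)) _) Y
      convert h2 using 1
      funext ξ
      by_cases h : ξ ∈ Metric.closedBall (0 : SymmMat n ℝ) R
      · rw [Set.indicator_of_mem h, expTilt, expTilt, Set.indicator_of_mem h]
      · rw [Set.indicator_of_notMem h, expTilt, Set.indicator_of_notMem h, mul_zero]
    have hκ : MemLp κ 2 volume := by
      rw [hκdef, Set.indicator_sub']
      exact (hind u₀ Y₀).sub (hind u₁ Y₁)
    have hR : ∀ ξ, (R : ℝ) < ‖ξ‖ → κ ξ = 0 := fun ξ hξ => Set.indicator_of_notMem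
        (fun h => not_le.2 hξ (mem_closedBall_zero_iff.1 h)) _
    obtain ⟨i0, e0⟩ := integral_conj_mul_expTilt (memLp_slice hlam hF hint hY₀) hκ hR
    obtain ⟨i1, e1⟩ := integral_conj_mul_expTilt (memLp_slice hlam hF hint hY₁) hκ hR
    have hΨ := differentiable_conjLaplace (integrable_of_memLp_of_support hκ hR) hR
    -- The product of `F` with an entire function is holomorphic, and its `L¹` slice norms are
    -- locally bounded because both factors have locally bounded `L²` slice norms.
    have hslice := integral_slice_eq (G := fun Z => F Z * conjLaplace κ Z)
      (hF.mul hΨ.differentiableOn) (fun Y hY => by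
        obtain ⟨ρ, hρ, C, hC, hle⟩ := exists_sliceLIntegral_le hlam hF hint hY
        obtain ⟨ε, hε, hball⟩ := Metric.isOpen_iff.1 isOpen_posCone Y hY
        refine ⟨min ρ ε, lt_min hρ hε, C + ENNReal.ofReal (Real.exp (R * (‖Y‖ + ρ))) ^ 2 *
          ∫⁻ ξ, ‖κ ξ‖ₑ ^ 2, ?_, fun Y' hY' => ?_⟩
        · exact ENNReal.add_lt_top.2 ⟨hC, ENNReal.mul_lt_top (by simp)
            ((memLp_two_iff_lintegral hκ.1).1 hκ)⟩
        · have h1 : Y' ∈ Metric.ball Y ρ := Metric.ball_subset_ball (min_le_left _ _) hY'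
          have h2 : Y' ∈ posCone n := hball (Metric.ball_subset_ball (min_le_right _ _) hY')
          refine (sliceLIntegral_one_mul_le
            (continuous_slice hF.continuousOn h2).aestronglyMeasurable).trans ?_
          refine add_le_add (hle Y' h1) ((sliceLIntegral_conjLaplace_le hκ hR Y').trans ?_)
          gcongr
          have h3 := norm_le_norm_add_norm_sub' Y' Y
          have h4 : ‖Y' - Y‖ < ρ := by rw [← dist_eq_norm]; exact h1
          linarith) hY₀ hY₁
    have hzero : ∫ ξ, ‖κ ξ‖ ^ 2 = 0 := by
      have h1 : ∫ ξ, ((starRingEnd ℂ) (κ ξ) * expTilt u₀ Y₀ ξ -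
          (starRingEnd ℂ) (κ ξ) * expTilt u₁ Y₁ ξ) = 0 := by
        rw [integral_sub i0 i1, sub_eq_zero]
        exact e0.trans (hslice.trans e1.symm)
      have h2 : ∫ ξ, ((‖κ ξ‖ ^ 2 : ℝ) : ℂ) = 0 := by
        rw [← h1]
        refine integral_congr_ae (Filter.Eventually.of_forall fun ξ => ?_)
        change ((‖κ ξ‖ ^ 2 : ℝ) : ℂ) = _ * _ - _ * _
        rw [← mul_sub, Complex.ofReal_pow, ← Complex.conj_mul']
        by_cases h : ξ ∈ Metric.closedBall (0 : SymmMat n ℝ) R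
        · rw [hκdef, Set.indicator_of_mem h, Pi.sub_apply]
        · rw [hκdef, Set.indicator_of_notMem h, map_zero, zero_mul, zero_mul]
      exact Complex.ofReal_eq_zero.1 (integral_ofReal.symm.trans h2)
    have hae := (integral_eq_zero_iff_of_nonneg (fun ξ => sq_nonneg ‖κ ξ‖)
      ((memLp_two_iff_integrable_sq_norm hκ.1).1 hκ)).1 hzero
    filter_upwards [hae] with ξ hξ hle
    have h1 : κ ξ = 0 := by simpa using hξ
    rw [hκdef, Set.indicator_of_mem (mem_closedBall_zero_iff.2 hle), Pi.sub_apply] at h1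
    exact sub_eq_zero.1 h1
  filter_upwards [ae_all_iff.2 hloc] with ξ hξ
  obtain ⟨R, hR⟩ := exists_nat_ge ‖ξ‖
  exact hξ R hR

theorem measurable_coneWeight (lam : ℝ) :
    Measurable (coneWeight lam : SymmMat n ℝ → ℝ≥0∞) := by
  have h : Measurable fun p : SymmMat n ℝ × SymmMat n ℝ =>
      ENNReal.ofReal (Real.exp (-inner ℝ p.1 p.2)) ^ 2 := by
    have : Continuous fun p : SymmMat n ℝ × SymmMat n ℝ => Real.exp (-inner ℝ p.1 p.2) := by
      fun_prop
    exact this.measurable.ennreal_ofReal.pow_const 2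
  exact h.lintegral_prod_right'

/-- Functions of the form `h(X) e^(-tr(XY))` in `L²` lie in the range of `S_λ`. -/
theorem exists_sOp_eq (hn : 1 ≤ n) {lam : ℝ} (hlam : (n : ℝ) < lam) {h : SymmMat n ℝ → ℂ}
    (hh : AEStronglyMeasurable h volume) (g : Lp ℂ 2 (tubeMeasure n lam))
    (hg : g =ᵐ[tubeMeasure n lam] fun p => h p.1 * ((Real.exp (-inner ℝ p.1 p.2) : ℝ) : ℂ)) :
    ∃ f : ConeL2 n, sOp n lam f = g := by
  have hΩ := (isOpen_posCone (n := n)).measurableSet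
  have hfin : ∫⁻ X, ‖h X‖ₑ ^ 2 * coneWeight lam X < ∞ := by
    rw [← lintegral_mul_exp hh]
    have h1 := (memLp_two_iff_lintegral (Lp.aestronglyMeasurable g)).1 (Lp.memLp g)
    refine lt_of_eq_of_lt (lintegral_congr_ae ?_) h1
    filter_upwards [hg] with p hp
    rw [hp]
  set c : SymmMat n ℝ → ℝ := fun X => sConst n lam * (mat X).det ^ (lam / 2 - ((n : ℝ) + 1) / 4)
    with hc
  have hcpos : ∀ X ∈ posCone n, 0 < c X := fun X hX => by
    have h1 := sConst_pos hlam
    have h2 := det_pos_of_mem hX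
    rw [hc]
    positivity
  set f : SymmMat n ℝ → ℂ := fun X => ((c X)⁻¹ : ℝ) * h X with hf
  have hsf : sFactor n lam f =ᵐ[volume] h := by
    have hae := ae_lt_top' ((hh.enorm.pow_const 2).mul (measurable_coneWeight lam).aemeasurable)
      hfin.ne
    filter_upwards [hae] with X hX
    rw [sFactor]
    by_cases hm : X ∈ posCone n
    · have h1 := (hcpos X hm).ne'
      rw [Set.indicator_of_mem hm, hf, ← mul_assoc, ← Complex.ofReal_mul]
      change ((c X * (c X)⁻¹ : ℝ) : ℂ) * h X = h X
      rw [mul_inv_cancel₀ h1, Complex.ofReal_one, one_mul]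
    -- Off the cone the weight is infinite, so finiteness of `‖h X‖² * coneWeight lam X` forces `h X
    -- = 0`.
    · rw [Set.indicator_of_notMem hm]
      rw [Pi.mul_apply, coneWeight_of_notMem hn hlam hm] at hX
      by_contra hne
      have h2 : ‖h X‖ₑ ^ 2 ≠ 0 := pow_ne_zero 2 (enorm_ne_zero.2 (Ne.symm hne))
      rw [ENNReal.mul_top h2] at hX
      exact lt_irrefl _ hX
  have hfm : AEStronglyMeasurable f (volume.restrict (posCone n)) := by
    refine AEStronglyMeasurable.mul ?_ hh.restrict
    refine ContinuousOn.aestronglyMeasurable ?_ hΩ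
    exact Complex.continuous_ofReal.comp_continuousOn
      ((continuousOn_const.mul (continuousOn_det_rpow _)).inv₀ fun X hX => (hcpos X hX).ne')
  have hf2 : MemLp f 2 (volume.restrict (posCone n)) := by
    rw [memLp_two_iff_lintegral hfm, ← lintegral_indicator hΩ]
    refine lt_of_eq_of_lt (lintegral_congr_ae ?_) hfin
    filter_upwards [hsf] with X hX
    rw [← enorm_sq_sFactor_mul_coneWeight hlam f X, hX]
  refine ⟨hf2.toLp f, Lp.ext ?_⟩
  filter_upwards [sOp_coe hlam (hf2.toLp f), sFun_congr_ae (lam := lam) hf2.coeFn_toLp, hg,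
    ae_prod_fst volume (coneMeasure n lam) hsf] with p h1 h2 h3 h4
  rw [h1, h2, h3, sFun_eq, h4]

/-- The profile `h` is read off from the slice over the identity matrix. Since the tilted transforms
of all slices agree, `U φ` equals `h(X) e^(-tr(XY))` on almost every fibre, and `exists_sOp_eq`
applies. -/
theorem bergmanSpace_le_range (hn : 1 ≤ n) {lam : ℝ} (hlam : (n : ℝ) < lam)
    {φ : Lp ℂ 2 (siegelMeasure n lam)} (hφ : φ ∈ bergmanSpace n lam) :
    ∃ f : ConeL2 n, (rOp n lam).adjoint f = φ := by
  obtain ⟨F, hF, hφF⟩ := hφ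
  set ψ := siegelIsometry n lam φ with hψ
  have hψF : ψ =ᵐ[tubeMeasure n lam] fun p => F (complexEquiv n p) := by
    rw [Filter.EventuallyEq, ae_siegelMeasure_iff] at hφF
    exact (siegelIsometry_coe lam φ).trans hφF
  have hint : ∫⁻ p, ‖F (complexEquiv n p)‖ₑ ^ 2 ∂(tubeMeasure n lam) < ∞ := by
    have h1 := (memLp_two_iff_lintegral (Lp.aestronglyMeasurable ψ)).1 (Lp.memLp ψ)
    refine lt_of_eq_of_lt (lintegral_congr_ae ?_) h1
    filter_upwards [hψF] with p hp
    rw [hp]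
  have h1mem := oneSymm_mem_posCone (n := n)
  set h := expTilt (unitaryFourier (SymmMat n ℝ)
    ((memLp_slice hlam hF hint h1mem).toLp _)) (oneSymm n) with hh
  have hm : AEStronglyMeasurable h volume :=
    aestronglyMeasurable_expTilt (Lp.aestronglyMeasurable _) _
  have hg : partialFourier n lam φ =ᵐ[tubeMeasure n lam]
      fun p => h p.1 * ((Real.exp (-inner ℝ p.1 p.2) : ℝ) : ℂ) := by
    refine ae_eq_prod_of_ae_ae (Lp.aestronglyMeasurable _) (aestronglyMeasurable_mul_exp hm) ?_
    filter_upwards [actsOnFibre_ae volume (coneMeasure n lam) (unitaryFourier (SymmMat n ℝ)) ψ,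
      ae_ae_swap_of_ae_prod hψF, ae_coneMeasure_mem lam] with Y ⟨u, hu, hTu⟩ h1 hY
    have e1 : u = (memLp_slice hlam hF hint hY).toLp _ :=
      Lp.ext ((hu.symm.trans h1).trans (memLp_slice hlam hF hint hY).coeFn_toLp.symm)
    rw [e1] at hTu
    filter_upwards [hTu, expTilt_unitaryFourier_slice_ae_eq hlam hF hint h1mem hY] with X h2 h3
    refine h2.trans ?_
    rw [hh, h3, expTilt, mul_right_comm, ← Complex.ofReal_mul, ← Real.exp_add, add_neg_cancel,
      Real.exp_zero, Complex.ofReal_one, one_mul]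
  obtain ⟨f, hf⟩ := exists_sOp_eq hn hlam hm _ hg
  exact ⟨f, by rw [adjoint_rOp_apply, hf, LinearIsometryEquiv.symm_apply_apply]⟩

end PaleyWiener

/-! ### Partial isometries from isometric adjoints. -/

section PartialIsometry

/-- If `T*` is isometric, then `T` is a partial isometry from the range of `T*` onto the whole
space. -/
theorem isPartialIsometry_of_norm_adjoint {H K : Type*} [NormedAddCommGroup H]
    [InnerProductSpace ℂ H] [CompleteSpace H] [NormedAddCommGroup K] [InnerProductSpace ℂ K]
    [CompleteSpace K] (T : H →L[ℂ] K) (h : ∀ x, ‖T.adjoint x‖ = ‖x‖) :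
    IsPartialIsometry T (LinearMap.range T.adjoint.toLinearMap) ⊤ := by
  have hid : ∀ x, T (T.adjoint x) = x := fun x => by
    have h1 := (ContinuousLinearMap.norm_map_iff_adjoint_comp_self T.adjoint).1 h
    rw [ContinuousLinearMap.adjoint_adjoint] at h1
    exact DFunLike.congr_fun h1 x
  refine ⟨?_, ?_, ?_⟩
  · rintro _ ⟨x, rfl⟩
    change ‖T (T.adjoint x)‖ = ‖T.adjoint x‖
    rw [hid, h]
  · ext y
    constructor
    · rintro ⟨x, rfl⟩
      refine (Submodule.mem_orthogonal _ _).2 fun u hu => ?_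
      change inner ℂ u (T.adjoint x) = 0
      rw [ContinuousLinearMap.adjoint_inner_right]
      have : T u = 0 := hu
      rw [this, inner_zero_left]
    · intro hy
      refine ⟨T y, ?_⟩
      change T.adjoint (T y) = y
      -- The vector `w` lies in the kernel of `T`, while `y` and `T* T y` are both orthogonal to
      -- that kernel; hence `w` is orthogonal to itself.
      set w := y - T.adjoint (T y) with hw
      have hTw : T w = 0 := by rw [hw, map_sub, hid, sub_self]
      have h1 : inner ℂ w y = 0 := (Submodule.mem_orthogonal _ _).1 hy w hTw
      have h2 : inner ℂ w (T.adjoint (T y)) = 0 := by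
        rw [ContinuousLinearMap.adjoint_inner_right, hTw, inner_zero_left]
      have h3 : inner ℂ w w = 0 := by
        nth_rewrite 2 [hw]
        rw [inner_sub_right, h1, h2, sub_zero]
      exact (sub_eq_zero.1 (inner_self_eq_zero.1 h3)).symm
  · exact (LinearMap.range_eq_top.2 fun x => ⟨T.adjoint x, hid x⟩).symm

end PartialIsometry

/-! ### The range of the adjoint, and the main theorem. -/

theorem range_adjoint_rOp {n : ℕ} (hn : 1 ≤ n) {lam : ℝ} (hlam : (n : ℝ) < lam) :
    LinearMap.range (rOp n lam).adjoint.toLinearMap = bergmanSpace n lam := by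
  ext φ
  constructor
  · rintro ⟨f, rfl⟩
    exact ⟨_, differentiableOn_fourierLaplace hlam f, adjoint_rOp_ae_eq hlam f⟩
  · intro hφ
    obtain ⟨f, hf⟩ := bergmanSpace_le_range hn hlam hφ
    exact ⟨f, hf⟩

theorem mainTheorem5 (n : ℕ) (hn : 1 ≤ n) (lam : ℝ) (hlam : (n : ℝ) < lam) :
    -- the operator `S_λ` is well defined and bounded
    (∀ f : ConeL2 n, sOp n lam f =ᵐ[tubeMeasure n lam] sFun n lam f) ∧
    -- `R_λ = S_λ^* U` is a partial isometry
    IsPartialIsometry (rOp n lam) (bergmanSpace n lam) ⊤ ∧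
    -- its adjoint is an isometry onto the Bergman space
    (∀ f : ConeL2 n, ‖(rOp n lam).adjoint f‖ = ‖f‖) ∧
    LinearMap.range (rOp n lam).adjoint.toLinearMap = bergmanSpace n lam ∧
    -- the value of the adjoint at `f` is the holomorphic function `fourierLaplace n lam f`
    (∀ f : ConeL2 n,
      (∀ Z ∈ siegelDomain n,
        IntegrableOn (laplaceIntegrand n lam f Z) (posCone n) volume) ∧
      DifferentiableOn ℂ (fourierLaplace n lam f) (siegelDomain n) ∧
      (rOp n lam).adjoint f =ᵐ[siegelMeasure n lam] fourierLaplace n lam f) := by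
  have hnorm := norm_adjoint_rOp (n := n) hlam
  have hrange := range_adjoint_rOp hn hlam
  refine ⟨sOp_coe hlam, ?_, hnorm, hrange, fun f => ⟨fun Z hZ => ?_, ?_, ?_⟩⟩
  · rw [← hrange]
    exact isPartialIsometry_of_norm_adjoint _ hnorm
  · exact integrableOn_laplaceIntegrand hlam f hZ
  · exact differentiableOn_fourierLaplace hlam f
  · exact adjoint_rOp_ae_eq hlam f

end
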